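/- Let $F$ be a field of characteristic $0$ and let $A=UT_4(F)$ be the algebra of $4\times 4$ upper triangular matrices with the elementary $\mathbb{Z}_2$-grading induced by $(0,1,0,1)$ (that is, $A_0$ is spanned by the matrix units $e_{kj}$, $k\le j$, with $j-k$ even, and $A_1$ by those with $j-k$ odd), endowed with the super-symplectic superinvolution $$\begin{pmatrix} a & b & c & d \\ 0 & e & f & g \\ 0 & 0 & h & i \\ 0 & 0 & 0 & l\end{pmatrix}^{\bar s}=\begin{pmatrix} l & i & g & d \\ 0 & h & -f & c \\ 0 & 0 & e & b \\ 0 & 0 & 0 & a\end{pmatrix}.$$ Let $\mathcal F=F\langle y_i^+,y_i^-,z_i^+,z_i^- : i\rangle$ (countably many variables of each kind) be the free unital superalgebra with superinvolution: the $y$'s have degree $0$, the $z$'s have degree $1$, $(y_i^{\pm})^*=\pm y_i^{\pm}$, $(z_i^{\pm})^*=\pm z_i^{\pm}$, and $(uv)^*=(-1)^{|u||v|}v^*u^*$ for homogeneous $u,v$. A $T_2^*$-ideal is a two-sided ideal of $\mathcal F$ stable under all graded endomorphisms of $\mathcal F$ commuting with $*$. Let $\mathrm{Id}^*(A)$ be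 the set of all $f\in\mathcal F$ that vanish under every substitution of the $y^+,y^-,z^+,z^-$ by elements of $A_0^+,A_0^-,A_1^+,A_1^-$ respectively, where $A_i^{\pm}=\{a\in A_i : a^{\bar s}=\pm a\}$. Then $\mathrm{Id}^*(A)$ is the $T_2^*$-ideal generated by the following polynomials. Conventions: $y_i$ denotes either of $y_i^\pm$, $z_i$ either of $z_i^\pm$, $x_i$ any variable (each choice gives a generator); differently named variables in a polynomial are distinct; commutators are left-normed, $[u_1,\dots,u_k]=[[u_1,\dots,u_{k-1}],u_k]$; $w_1,\dots,w_k$ are distinct even variables, $w_i\in\{y_i^+,y_i^-\}$, $g$ is the number of skew variables among them, $k\ge 0$ and $\sigma\in S_k$ are arbitrary. 1. $[y_1,y_2]\,x\,[y_3,y_4]$; 2. $[x_1,x_2,x_3]-[x_3,x_2,x_1]-[x_1,x_3,x_2]$; 3. $[y_1,y_2,y_{i_3},\dots,y_{i_k}]-[y_1,y_2,y_3,\dots,y_k]$, for $k\ge 2$ and $(i_3,\dots,i_k)$ any permutation of $(3,\dots,k)$; 4. $z_1^+\,y\,z_2^+$; 5. $z_1^+z_2z_3^+-z_3^+z_2z_1^+$;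 6. $z_1^-z_2z_3^--z_3^-z_2z_1^-$; 7. $z_1z_2z_3z_4$; 8. $z_1^-y_4z_2^+y_5z_3^-$; 9. $z_1^-y_2z_3^-y_4z_5^++z_5^+y_2z_3^-y_4z_1^-$; 10. $[y_1,\dots,y_a]\,z\,y^+-y^+[y_1,\dots,y_a]\,z$, for $a\ge 2$; 11. $[y_1,\dots,y_a]\,z\,y^-+y^-[y_1,\dots,y_a]\,z$, for $a\ge 2$; 12. $(w_1\cdots w_k-w_{\sigma(1)}\cdots w_{\sigma(k)})z^++(-1)^{g+1}z^+(w_k\cdots w_1-w_{\sigma(k)}\cdots w_{\sigma(1)})$; 13. $(w_1\cdots w_k-w_{\sigma(1)}\cdots w_{\sigma(k)})z^-+(-1)^{g}z^-(w_k\cdots w_1-w_{\sigma(k)}\cdots w_{\sigma(1)})$; 14. $w_{\sigma(1)}\cdots w_{\sigma(k)}z_1z_2-w_1\cdots w_kz_1z_2$; 15. $z_1w_{\sigma(1)}\cdots w_{\sigma(k)}z_2-z_1w_1\cdots w_kz_2$; 16. $z_1z_2w_{\sigma(1)}\cdots w_{\sigma(k)}-z_1z_2w_1\cdots w_k$; 17.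 $z^-w_1\cdots w_kz^++(-1)^{g+1}w_1\cdots w_kz^-z^+$; 18. $z^+w_1\cdots w_kz^-+(-1)^{g+1}z^+z^-w_1\cdots w_k$; 19. $(-1)^{a'+c'}Yz_1^-Y'z_2^-Y''-(-1)^{c'}z_1^-YY'z_2^-Y''+z_1^-YY'Y''z_2^--(-1)^{a'}Yz_1^-Y'Y''z_2^-$, where $Y,Y',Y''$ are products of pairwise distinct even variables: $Y$ of $a$ symmetric ones followed by $a'$ skew ones, $Y'$ of $b$ symmetric ones followed by $b'$ skew ones, $Y''$ of $c$ symmetric ones followed by $c'$ skew ones, with $a,a',b,b',c,c'\ge 0$ arbitrary; 20. $z_1z_2w_1\cdots w_kz_3-(-1)^gz_1w_1\cdots w_kz_2z_3$; 21. $(-1)^gw_1\cdots w_kz_1z_2z_3-z_1z_2z_3w_1\cdots w_k$. -/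

import Mathlib

noncomputable section

namespace StarPI

/-! ### Superalgebras with superinvolution -/

/-- A superinvolution of the algebra `A` with respect to the `ZMod 2`-grading `𝒜 0, 𝒜 1`. -/
structure Superinvolution {F A : Type*} [Field F] [Ring A] [Algebra F A]
    (𝒜 : ZMod 2 → Submodule F A) where
  toFun : A →ₗ[F] A
  map_mem : ∀ i, ∀ a ∈ 𝒜 i, toFun a ∈ 𝒜 i
  involutive : ∀ a, toFun (toFun a) = a
  map_mul : ∀ i j, ∀ a ∈ 𝒜 i, ∀ b ∈ 𝒜 j,
    toFun (a * b) = (-1 : ℤˣ) ^ (i.val * j.val) • (toFun b * toFun a)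

/-! ### The free superalgebra with superinvolution -/

/-- The variables of the free `*`-algebra: `deg` is the homogeneous degree (`0` for the even
variables `y`, `1` for the odd variables `z`), `sgn` is `1` for symmetric and `-1` for skew
variables, and `idx` is the index. -/
structure StarVar where
  deg : ZMod 2
  sgn : ℤˣ
  idx : ℕ

/-- The free unital associative algebra
`F⟨y₁⁺, y₁⁻, z₁⁺, z₁⁻, y₂⁺, y₂⁻, z₂⁺, z₂⁻, …⟩`. -/
abbrev FreeStar (F : Type*) [Field F] := FreeAlgebra F StarVar

/-- The monomial spelled by a word in the variables. -/
def mono (F : Type*) [Field F] (w : List StarVar) : FreeStar F :=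
  (w.map (FreeAlgebra.ι F)).prod

/-- The homogeneous degree of a word. -/
def wordDeg (w : List StarVar) : ZMod 2 := (w.map StarVar.deg).sum

/-- The `ZMod 2`-grading of the free `*`-algebra. -/
def freeGrading (F : Type*) [Field F] (i : ZMod 2) : Submodule F (FreeStar F) :=
  Submodule.span F {f | ∃ w : List StarVar, wordDeg w = i ∧ f = mono F w}

/-- The number of odd letters of a word. -/
def oddCount (w : List StarVar) : ℕ := (w.map fun x => x.deg.val).sum

/-- The sign `c` in `(x₁ ⋯ xₙ)^* = c • (xₙ ⋯ x₁)`: every pair of odd letters contributes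
a factor `-1`, and every skew letter contributes a factor `-1`. -/
def wordSign (w : List StarVar) : ℤˣ :=
  (-1) ^ (oddCount w).choose 2 * (w.map StarVar.sgn).prod

/-- The linear map underlying the superinvolution of the free `*`-algebra. -/
def freeStarMap (F : Type*) [Field F] : FreeStar F →ₗ[F] FreeStar F :=
  (FreeAlgebra.basisFreeMonoid F StarVar).constr F
    fun w => wordSign w.toList • mono F w.toList.reverse

theorem basis_eq_mono (F : Type*) [Field F] (w : FreeMonoid StarVar) :
    FreeAlgebra.basisFreeMonoid F StarVar w = mono F w.toList := by
  simp [FreeAlgebra.basisFreeMonoid, mono, FreeAlgebra.equivMonoidAlgebraFreeMonoid,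
    FreeMonoid.lift_apply]

theorem freeStarMap_mono (F : Type*) [Field F] (w : List StarVar) :
    freeStarMap F (mono F w) = wordSign w • mono F w.reverse := by
  have h := basis_eq_mono F (FreeMonoid.ofList w)
  rw [FreeMonoid.toList_ofList] at h
  rw [← h, freeStarMap, Module.Basis.constr_basis]
  rfl

theorem mono_append (F : Type*) [Field F] (v w : List StarVar) :
    mono F (v ++ w) = mono F v * mono F w := by
  simp [mono]

theorem wordDeg_reverse (w : List StarVar) : wordDeg w.reverse = wordDeg w := by
  simp [wordDeg, List.sum_reverse]

theorem wordSign_reverse (w : List StarVar) : wordSign w.reverse = wordSign w := by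
  simp [wordSign, oddCount, List.sum_reverse, List.prod_reverse]

theorem oddCount_cast (w : List StarVar) : ((oddCount w : ℕ) : ZMod 2) = wordDeg w := by
  induction w with
  | nil => simp [oddCount, wordDeg]
  | cons x w ih =>
    simp only [oddCount, wordDeg, List.map_cons, List.sum_cons, Nat.cast_add] at ih ⊢
    rw [ih, ZMod.natCast_zmod_val]

theorem choose_two_add (m n : ℕ) : (m + n).choose 2 = m.choose 2 + n.choose 2 + m * n := by
  induction n with
  | zero => simp
  | succ n ih =>
    rw [← add_assoc, Nat.choose_succ_succ' (m + n) 1, ih, Nat.choose_succ_succ' n 1]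
    simp
    ring

theorem neg_one_pow_oddCount (v w : List StarVar) :
    (-1 : ℤˣ) ^ (oddCount v * oddCount w) = (-1) ^ ((wordDeg v).val * (wordDeg w).val) := by
  rw [← oddCount_cast, ← oddCount_cast, ZMod.val_natCast, ZMod.val_natCast,
    Int.units_pow_eq_pow_mod_two, Nat.mul_mod, ← Int.units_pow_eq_pow_mod_two]

theorem wordSign_append (v w : List StarVar) :
    wordSign (v ++ w) =
      (-1) ^ ((wordDeg v).val * (wordDeg w).val) * (wordSign w * wordSign v) := by
  have h : oddCount (v ++ w) = oddCount v + oddCount w := by simp [oddCount]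
  rw [← neg_one_pow_oddCount, wordSign, h, choose_two_add, pow_add, pow_add, wordSign, wordSign,
    List.map_append, List.prod_append]
  ac_rfl

/-- The superinvolution of the free `*`-algebra. -/
def freeStar (F : Type*) [Field F] : Superinvolution (freeGrading F) where
  toFun := freeStarMap F
  map_mem := by
    intro i a ha
    induction ha using Submodule.span_induction with
    | mem f hf =>
      obtain ⟨w, hw, rfl⟩ := hf
      rw [freeStarMap_mono, Units.smul_def]
      have h : mono F w.reverse ∈ freeGrading F i :=
        Submodule.subset_span ⟨w.reverse, by rw [wordDeg_reverse, hw], rfl⟩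
      exact zsmul_mem h _
    | zero => simp
    | add f g _ _ hf hg => rw [map_add]; exact add_mem hf hg
    | smul c f _ hf => rw [map_smul]; exact Submodule.smul_mem _ _ hf
  involutive := by
    intro a
    have : freeStarMap F ∘ₗ freeStarMap F = LinearMap.id := by
      refine (FreeAlgebra.basisFreeMonoid F StarVar).ext fun w => ?_
      rw [basis_eq_mono, LinearMap.comp_apply, freeStarMap_mono, Units.smul_def, map_zsmul,
        freeStarMap_mono, wordSign_reverse, ← Units.smul_def, smul_smul, List.reverse_reverse]
      simp
    exact LinearMap.congr_fun this a
  map_mul := by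
    intro i j a ha b hb
    induction ha using Submodule.span_induction with
    | mem f hf =>
      obtain ⟨v, rfl, rfl⟩ := hf
      induction hb using Submodule.span_induction with
      | mem g hg =>
        obtain ⟨w, rfl, rfl⟩ := hg
        rw [← mono_append, freeStarMap_mono, freeStarMap_mono, freeStarMap_mono, wordSign_append,
          List.reverse_append, mono_append, smul_mul_smul_comm, smul_smul]
      | zero => simp
      | add f g _ _ hf hg => rw [mul_add, map_add, hf, hg, map_add, add_mul, smul_add]
      | smul c f _ hf =>
        rw [mul_smul_comm, map_smul, hf, map_smul, smul_mul_assoc, smul_comm]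
    | zero => simp
    | add f g _ _ hf hg => rw [add_mul, map_add, hf, hg, map_add, mul_add, smul_add]
    | smul c f _ hf =>
      rw [smul_mul_assoc, map_smul, hf, map_smul, mul_smul_comm, smul_comm]

/-- A `T₂^*`-ideal: a two-sided ideal of the free `*`-algebra that is stable under every graded
endomorphism commuting with the superinvolution. -/
def IsT2StarIdeal {F : Type*} [Field F] (I : TwoSidedIdeal (FreeStar F)) : Prop :=
  ∀ φ : FreeStar F →ₐ[F] FreeStar F,
    (∀ i, ∀ a ∈ freeGrading F i, φ a ∈ freeGrading F i) →
    (∀ a, φ ((freeStar F).toFun a) = (freeStar F).toFun (φ a)) →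
    ∀ f ∈ I, φ f ∈ I

/-- The `T₂^*`-ideal generated by a set of polynomials. -/
def t2StarIdealSpan {F : Type*} [Field F] (S : Set (FreeStar F)) : TwoSidedIdeal (FreeStar F) :=
  sInf {I | IsT2StarIdeal I ∧ S ⊆ (I : Set (FreeStar F))}

/-- `Id^*(A)`: the polynomials that vanish whenever the variables are replaced by elements of
`A₀⁺, A₀⁻, A₁⁺, A₁⁻` according to their degree and symmetry. -/
def starIdentities {F A : Type*} [Field F] [Ring A] [Algebra F A]
    {𝒜 : ZMod 2 → Submodule F A} (s : Superinvolution 𝒜) : Set (FreeStar F) :=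
  {f | ∀ v : StarVar → A, (∀ x, v x ∈ 𝒜 x.deg ∧ s.toFun (v x) = x.sgn • v x) →
    FreeAlgebra.lift F v f = 0}

/-! ### Upper triangular matrices -/

/-- The algebra `UT_n(F)` of upper triangular matrices. -/
abbrev UT (F : Type*) [Field F] (n : ℕ) : Subalgebra F (Matrix (Fin n) (Fin n) F) :=
  Matrix.blockTriangularSubalgebra F F (id : Fin n → Fin n)

/-- The elementary grading of `UT_n(F)` induced by `g`: the component of degree `i` is spanned by
the matrix units `e_{kj}`, `k ≤ j`, with `g k + g j = i`. -/
def elementaryGrading (F : Type*) [Field F] {n : ℕ} (g : Fin n → ZMod 2) (i : ZMod 2) :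
    Submodule F (UT F n) where
  carrier := {M | ∀ k j, g k + g j ≠ i → M.1 k j = 0}
  zero_mem' := by intro k j _; rfl
  add_mem' := by
    intro M N hM hN k j h
    simp [hM k j h, hN k j h]
  smul_mem' := by
    intro c M hM k j h
    simp [hM k j h]

/-- The matrix `M^s̄`, for `M` upper triangular of order 4. -/
def superSymplecticMatrix {F : Type*} [Field F] (M : Matrix (Fin 4) (Fin 4) F) :
    Matrix (Fin 4) (Fin 4) F :=
  !![M 3 3, M 2 3,   M 1 3,  M 0 3;
     0,     M 2 2, -(M 1 2), M 0 2;
     0,     0,       M 1 1,  M 0 1;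
     0,     0,       0,      M 0 0]

theorem superSymplecticMatrix_mem {F : Type*} [Field F] (M : Matrix (Fin 4) (Fin 4) F) :
    superSymplecticMatrix M ∈ UT F 4 := by
  intro i j h
  fin_cases i <;> fin_cases j <;>
    first
    | rfl
    | exact absurd h (by decide)

theorem superSymplecticMatrix_add {F : Type*} [Field F] (M N : Matrix (Fin 4) (Fin 4) F) :
    superSymplecticMatrix (M + N) = superSymplecticMatrix M + superSymplecticMatrix N := by
  ext i j
  fin_cases i <;> fin_cases j <;> simp [superSymplecticMatrix, -neg_add_rev, neg_add]

theorem superSymplecticMatrix_smul {F : Type*} [Field F] (c : F) (M : Matrix (Fin 4) (Fin 4) F) :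
    superSymplecticMatrix (c • M) = c • superSymplecticMatrix M := by
  ext i j
  fin_cases i <;> fin_cases j <;> simp [superSymplecticMatrix]

/-- The linear map underlying the super-symplectic superinvolution of `UT_4(F)`. -/
def superSymplecticMap (F : Type*) [Field F] : UT F 4 →ₗ[F] UT F 4 where
  toFun M := ⟨superSymplecticMatrix M.1, superSymplecticMatrix_mem M.1⟩
  map_add' M N := Subtype.ext (superSymplecticMatrix_add M.1 N.1)
  map_smul' c M := Subtype.ext (superSymplecticMatrix_smul c M.1)

theorem superSymplecticMatrix_mul_even {F : Type*} [Field F] (M N : Matrix (Fin 4) (Fin 4) F)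
    (hM : ∀ k j, j < k → M k j = 0) (hN : ∀ k j, j < k → N k j = 0)
    (h : (M 0 1 = 0 ∧ M 1 2 = 0 ∧ M 2 3 = 0 ∧ M 0 3 = 0) ∨
      (N 0 1 = 0 ∧ N 1 2 = 0 ∧ N 2 3 = 0 ∧ N 0 3 = 0)) :
    superSymplecticMatrix (M * N) = superSymplecticMatrix N * superSymplecticMatrix M := by
  ext i j
  rcases h with ⟨h₁, h₂, h₃, h₄⟩ | ⟨h₁, h₂, h₃, h₄⟩ <;> fin_cases i <;> fin_cases j <;>
    simp [superSymplecticMatrix, Matrix.mul_apply, Fin.sum_univ_four, hM, hN, h₁, h₂, h₃, h₄] <;>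
    ring

theorem superSymplecticMatrix_mul_odd {F : Type*} [Field F] (M N : Matrix (Fin 4) (Fin 4) F)
    (hM : ∀ k j, j < k → M k j = 0) (hN : ∀ k j, j < k → N k j = 0)
    (hMd : ∀ k, M k k = 0) (hNd : ∀ k, N k k = 0)
    (h : M 0 2 = 0 ∧ M 1 3 = 0 ∧ N 0 2 = 0 ∧ N 1 3 = 0) :
    superSymplecticMatrix (M * N) = -(superSymplecticMatrix N * superSymplecticMatrix M) := by
  obtain ⟨h₁, h₂, h₃, h₄⟩ := h
  ext i j
  fin_cases i <;> fin_cases j <;>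
    simp [superSymplecticMatrix, Matrix.mul_apply, Fin.sum_univ_four, hM, hN, hMd, hNd, h₁, h₂,
      h₃, h₄] <;>
    ring

/-- The super-symplectic superinvolution of `UT_4(F)` with the elementary grading
induced by `(0,1,0,1)`. -/
def superSymplectic (F : Type*) [Field F] :
    Superinvolution (elementaryGrading F (![0, 1, 0, 1] : Fin 4 → ZMod 2)) where
  toFun := superSymplecticMap F
  map_mem := by
    intro i M hM k j h
    change superSymplecticMatrix M.1 k j = 0
    fin_cases k <;> fin_cases j <;>
      first
      | rfl
      | exact hM _ _ h
      | exact neg_eq_zero.mpr (hM _ _ h)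
  involutive := by
    intro M
    apply Subtype.ext
    ext i j
    change superSymplecticMatrix (superSymplecticMatrix M.1) i j = M.1 i j
    have hM := M.2
    fin_cases i <;> fin_cases j <;>
      first
      | rfl
      | exact neg_neg _
      | exact (hM (by decide)).symm
  map_mul := by
    intro i j M hM N hN
    have hM' : ∀ k l : Fin 4, l < k → M.1 k l = 0 := fun k l h => M.2 h
    have hN' : ∀ k l : Fin 4, l < k → N.1 k l = 0 := fun k l h => N.2 h
    have zmod_two (i : ZMod 2) : i = 0 ∨ i = 1 := by
      revert i
      decide
    apply Subtype.ext
    rcases zmod_two i with rfl | rfl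
    · have h := superSymplecticMatrix_mul_even M.1 N.1 hM' hN' (Or.inl
        ⟨hM _ _ (by decide), hM _ _ (by decide), hM _ _ (by decide), hM _ _ (by decide)⟩)
      have h1 : (-1 : ℤˣ) ^ ((0 : ZMod 2).val * j.val) = 1 := by simp
      rw [h1, one_smul]
      exact h
    rcases zmod_two j with rfl | rfl
    · have h := superSymplecticMatrix_mul_even M.1 N.1 hM' hN' (Or.inr
        ⟨hN _ _ (by decide), hN _ _ (by decide), hN _ _ (by decide), hN _ _ (by decide)⟩)
      have h1 : (-1 : ℤˣ) ^ ((1 : ZMod 2).val * (0 : ZMod 2).val) = 1 := by simp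
      rw [h1, one_smul]
      exact h
    · have h := superSymplecticMatrix_mul_odd M.1 N.1 hM' hN'
        (fun k => hM _ _ (by fin_cases k <;> decide)) (fun k => hN _ _ (by fin_cases k <;> decide))
        ⟨hM _ _ (by decide), hM _ _ (by decide), hN _ _ (by decide), hN _ _ (by decide)⟩
      have h1 : (-1 : ℤˣ) ^ ((1 : ZMod 2).val * (1 : ZMod 2).val) = -1 := by decide
      rw [h1, Units.neg_smul, one_smul]
      exact h

/-! ### The generating polynomials -/

section Generators

variable (F : Type*) [Field F]

/-- The even variable `y_i⁺` (`ε = 1`) or `y_i⁻` (`ε = -1`). -/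
def y (ε : ℤˣ) (i : ℕ) : FreeStar F := FreeAlgebra.ι F ⟨0, ε, i⟩

/-- The odd variable `z_i⁺` (`ε = 1`) or `z_i⁻` (`ε = -1`). -/
def z (ε : ℤˣ) (i : ℕ) : FreeStar F := FreeAlgebra.ι F ⟨1, ε, i⟩

/-- Any of the variables `y_i⁺, y_i⁻, z_i⁺, z_i⁻`. -/
def x (d : ZMod 2) (ε : ℤˣ) (i : ℕ) : FreeStar F := FreeAlgebra.ι F ⟨d, ε, i⟩

/-- The left-normed commutator `[a, l₁, l₂, …, l_k] = [⋯[[a, l₁], l₂], …, l_k]`. -/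
def comm {R : Type*} [Ring R] (a : R) (l : List R) : R := l.foldl (fun c b => c * b - b * c) a

/-- The word `w_{σ(1)} ⋯ w_{σ(k)}` as a list, where `w_i = y_i⁺` if `ε i = 1` and `w_i = y_i⁻` if
`ε i = -1`. The index `i : Fin k` stands for `i + 1 ∈ {1, …, k}`. -/
def wList {k : ℕ} (ε : Fin k → ℤˣ) (σ : Equiv.Perm (Fin k)) : List (FreeStar F) :=
  List.ofFn fun i => y F (ε (σ i)) ((σ i : ℕ) + 1)

/-- The product `w_{σ(1)} ⋯ w_{σ(k)}`. -/
def w {k : ℕ} (ε : Fin k → ℤˣ) (σ : Equiv.Perm (Fin k)) : FreeStar F := (wList F ε σ).prod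

/-- The product `w_{σ(k)} ⋯ w_{σ(1)}`. -/
def wRev {k : ℕ} (ε : Fin k → ℤˣ) (σ : Equiv.Perm (Fin k)) : FreeStar F :=
  (wList F ε σ).reverse.prod

/-- The number `g` of skew variables among `w_1, …, w_k`. -/
def skewCount {k : ℕ} (ε : Fin k → ℤˣ) : ℕ := (Finset.univ.filter fun i => ε i = -1).card

/-- The list `y_3, …, y_{m+2}`, permuted by `σ`, of even variables with signs `ε`. -/
def tailList {m : ℕ} (ε : Fin m → ℤˣ) (σ : Equiv.Perm (Fin m)) : List (FreeStar F) :=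
  List.ofFn fun i => y F (ε (σ i)) ((σ i : ℕ) + 3)

/-- The product `y⁺_{s+1} ⋯ y⁺_{s+a} y⁻_{s+a+1} ⋯ y⁻_{s+a+a'}`. -/
def block (s a a' : ℕ) : FreeStar F :=
  (List.ofFn fun i : Fin a => y F 1 (s + i + 1)).prod *
    (List.ofFn fun i : Fin a' => y F (-1) (s + a + i + 1)).prod

/-- The generators of the `T₂^*`-ideal of identities. A sign `ε` or `δ` left free means that
the variable may be symmetric or skew. -/
inductive IsGenerator : FreeStar F → Prop
  /-- `[y₁, y₂] x [y₃, y₄]` -/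
  | comm_x_comm (ε₁ ε₂ ε₃ ε₄ δ : ℤˣ) (d : ZMod 2) :
      IsGenerator (comm (y F ε₁ 1) [y F ε₂ 2] * x F d δ 0 * comm (y F ε₃ 3) [y F ε₄ 4])
  /-- `[x₁, x₂, x₃] - [x₃, x₂, x₁] - [x₁, x₃, x₂]` -/
  | jacobi (ε₁ ε₂ ε₃ : ℤˣ) (d₁ d₂ d₃ : ZMod 2) :
      IsGenerator (comm (x F d₁ ε₁ 1) [x F d₂ ε₂ 2, x F d₃ ε₃ 3]
        - comm (x F d₃ ε₃ 3) [x F d₂ ε₂ 2, x F d₁ ε₁ 1]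
        - comm (x F d₁ ε₁ 1) [x F d₃ ε₃ 3, x F d₂ ε₂ 2])
  /-- `[y₁, y₂, y_{i₃}, …, y_{i_k}] - [y₁, y₂, y₃, …, y_k]` -/
  | comm_perm (ε₁ ε₂ : ℤˣ) (m : ℕ) (ε : Fin m → ℤˣ) (σ : Equiv.Perm (Fin m)) :
      IsGenerator (comm (y F ε₁ 1) (y F ε₂ 2 :: tailList F ε σ)
        - comm (y F ε₁ 1) (y F ε₂ 2 :: tailList F ε 1))
  /-- `z₁⁺ y z₂⁺` -/
  | zpos_y_zpos (ε : ℤˣ) :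
      IsGenerator (z F 1 1 * y F ε 0 * z F 1 2)
  /-- `z₁⁺ z₂ z₃⁺ - z₃⁺ z₂ z₁⁺` -/
  | zpos_swap (δ : ℤˣ) :
      IsGenerator (z F 1 1 * z F δ 2 * z F 1 3 - z F 1 3 * z F δ 2 * z F 1 1)
  /-- `z₁⁻ z₂ z₃⁻ - z₃⁻ z₂ z₁⁻` -/
  | zneg_swap (δ : ℤˣ) :
      IsGenerator (z F (-1) 1 * z F δ 2 * z F (-1) 3 - z F (-1) 3 * z F δ 2 * z F (-1) 1)
  /-- `z₁ z₂ z₃ z₄` -/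
  | zzzz (δ₁ δ₂ δ₃ δ₄ : ℤˣ) :
      IsGenerator (z F δ₁ 1 * z F δ₂ 2 * z F δ₃ 3 * z F δ₄ 4)
  /-- `z₁⁻ y₄ z₂⁺ y₅ z₃⁻` -/
  | zneg_zpos_zneg (ε₄ ε₅ : ℤˣ) :
      IsGenerator (z F (-1) 1 * y F ε₄ 4 * z F 1 2 * y F ε₅ 5 * z F (-1) 3)
  /-- `z₁⁻ y₂ z₃⁻ y₄ z₅⁺ + z₅⁺ y₂ z₃⁻ y₄ z₁⁻` -/
  | zneg_zneg_zpos (ε₂ ε₄ : ℤˣ) :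
      IsGenerator (z F (-1) 1 * y F ε₂ 2 * z F (-1) 3 * y F ε₄ 4 * z F 1 5
        + z F 1 5 * y F ε₂ 2 * z F (-1) 3 * y F ε₄ 4 * z F (-1) 1)
  /-- `[y₁, …, y_a] z y⁺ - y⁺ [y₁, …, y_a] z`, `a = m + 2 ≥ 2` -/
  | comm_z_ypos (ε₁ ε₂ δ : ℤˣ) (m : ℕ) (ε : Fin m → ℤˣ) :
      IsGenerator (comm (y F ε₁ 1) (y F ε₂ 2 :: tailList F ε 1) * z F δ 0 * y F 1 0
        - y F 1 0 * comm (y F ε₁ 1) (y F ε₂ 2 :: tailList F ε 1) * z F δ 0)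
  /-- `[y₁, …, y_a] z y⁻ + y⁻ [y₁, …, y_a] z`, `a = m + 2 ≥ 2` -/
  | comm_z_yneg (ε₁ ε₂ δ : ℤˣ) (m : ℕ) (ε : Fin m → ℤˣ) :
      IsGenerator (comm (y F ε₁ 1) (y F ε₂ 2 :: tailList F ε 1) * z F δ 0 * y F (-1) 0
        + y F (-1) 0 * comm (y F ε₁ 1) (y F ε₂ 2 :: tailList F ε 1) * z F δ 0)
  /-- `(w₁ ⋯ w_k - w_{σ(1)} ⋯ w_{σ(k)}) z⁺ + (-1)^{g+1} z⁺ (w_k ⋯ w₁ - w_{σ(k)} ⋯ w_{σ(1)})` -/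
  | perm_zpos (k : ℕ) (ε : Fin k → ℤˣ) (σ : Equiv.Perm (Fin k)) :
      IsGenerator ((w F ε 1 - w F ε σ) * z F 1 0
        + (-1) ^ (skewCount ε + 1) * (z F 1 0 * (wRev F ε 1 - wRev F ε σ)))
  /-- `(w₁ ⋯ w_k - w_{σ(1)} ⋯ w_{σ(k)}) z⁻ + (-1)^g z⁻ (w_k ⋯ w₁ - w_{σ(k)} ⋯ w_{σ(1)})` -/
  | perm_zneg (k : ℕ) (ε : Fin k → ℤˣ) (σ : Equiv.Perm (Fin k)) :
      IsGenerator ((w F ε 1 - w F ε σ) * z F (-1) 0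
        + (-1) ^ skewCount ε * (z F (-1) 0 * (wRev F ε 1 - wRev F ε σ)))
  /-- `w_{σ(1)} ⋯ w_{σ(k)} z₁ z₂ - w₁ ⋯ w_k z₁ z₂` -/
  | perm_z_z (k : ℕ) (ε : Fin k → ℤˣ) (σ : Equiv.Perm (Fin k)) (δ₁ δ₂ : ℤˣ) :
      IsGenerator (w F ε σ * z F δ₁ 1 * z F δ₂ 2 - w F ε 1 * z F δ₁ 1 * z F δ₂ 2)
  /-- `z₁ w_{σ(1)} ⋯ w_{σ(k)} z₂ - z₁ w₁ ⋯ w_k z₂` -/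
  | z_perm_z (k : ℕ) (ε : Fin k → ℤˣ) (σ : Equiv.Perm (Fin k)) (δ₁ δ₂ : ℤˣ) :
      IsGenerator (z F δ₁ 1 * w F ε σ * z F δ₂ 2 - z F δ₁ 1 * w F ε 1 * z F δ₂ 2)
  /-- `z₁ z₂ w_{σ(1)} ⋯ w_{σ(k)} - z₁ z₂ w₁ ⋯ w_k` -/
  | z_z_perm (k : ℕ) (ε : Fin k → ℤˣ) (σ : Equiv.Perm (Fin k)) (δ₁ δ₂ : ℤˣ) :
      IsGenerator (z F δ₁ 1 * z F δ₂ 2 * w F ε σ - z F δ₁ 1 * z F δ₂ 2 * w F ε 1)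
  /-- `z⁻ w₁ ⋯ w_k z⁺ + (-1)^{g+1} w₁ ⋯ w_k z⁻ z⁺` -/
  | zneg_w_zpos (k : ℕ) (ε : Fin k → ℤˣ) :
      IsGenerator (z F (-1) 0 * w F ε 1 * z F 1 0
        + (-1) ^ (skewCount ε + 1) * (w F ε 1 * z F (-1) 0 * z F 1 0))
  /-- `z⁺ w₁ ⋯ w_k z⁻ + (-1)^{g+1} z⁺ z⁻ w₁ ⋯ w_k` -/
  | zpos_w_zneg (k : ℕ) (ε : Fin k → ℤˣ) :
      IsGenerator (z F 1 0 * w F ε 1 * z F (-1) 0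
        + (-1) ^ (skewCount ε + 1) * (z F 1 0 * z F (-1) 0 * w F ε 1))
  /-- `(-1)^{a'+c'} A z₁⁻ B z₂⁻ C - (-1)^{c'} z₁⁻ A B z₂⁻ C + z₁⁻ A B C z₂⁻ - (-1)^{a'} A z₁⁻ B C z₂⁻`
  where `A`, `B`, `C` are products of `a`, `b`, `c` symmetric followed by `a'`, `b'`, `c'` skew
  even variables, all distinct -/
  | three_blocks (a a' b b' c c' : ℕ) (A B C : FreeStar F)
      (hA : A = block F 0 a a')
      (hB : B = block F (a + a') b b')
      (hC : C = block F (a + a' + b + b') c c') :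
      IsGenerator ((-1) ^ (a' + c') * (A * z F (-1) 1 * B * z F (-1) 2 * C)
        - (-1) ^ c' * (z F (-1) 1 * A * B * z F (-1) 2 * C)
        + z F (-1) 1 * A * B * C * z F (-1) 2
        - (-1) ^ a' * (A * z F (-1) 1 * B * C * z F (-1) 2))
  /-- `z₁ z₂ w₁ ⋯ w_k z₃ - (-1)^g z₁ w₁ ⋯ w_k z₂ z₃` -/
  | zz_w_z (k : ℕ) (ε : Fin k → ℤˣ) (δ₁ δ₂ δ₃ : ℤˣ) :
      IsGenerator (z F δ₁ 1 * z F δ₂ 2 * w F ε 1 * z F δ₃ 3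
        - (-1) ^ skewCount ε * (z F δ₁ 1 * w F ε 1 * z F δ₂ 2 * z F δ₃ 3))
  /-- `(-1)^g w₁ ⋯ w_k z₁ z₂ z₃ - z₁ z₂ z₃ w₁ ⋯ w_k` -/
  | w_zzz (k : ℕ) (ε : Fin k → ℤˣ) (δ₁ δ₂ δ₃ : ℤˣ) :
      IsGenerator ((-1) ^ skewCount ε * (w F ε 1 * z F δ₁ 1 * z F δ₂ 2 * z F δ₃ 3)
        - z F δ₁ 1 * z F δ₂ 2 * z F δ₃ 3 * w F ε 1)

end Generators

end StarPI

end

/-!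
The inclusion `span_le_starIdentities` is a computation with matrices: the identities form a
`T₂^*`-ideal, and each generator vanishes (`IsMatrixAssignment.lift_generator`). What makes the
generators with arbitrary permutations vanish is that a product of even letters has a diagonal that
does not depend on their order, and that reversing the product swaps the entries `(1, 3)` and
`(2, 4)` up to sign (`IsMatrixAssignment.even_word`).

For the converse let `π` be the projection to the quotient by the ideal of the generators.
Evaluation on generic matrices, with entries in a polynomial ring, kills all identities
(`lift_genericMatrix_eq_zero`), so it suffices that `π` factors, as a linear map, through this
evaluation. The linear map `recover π` on matrices of polynomials is defined on monomials, and
`KillsGenerators.recover_word` says that it takes the generic value of each word `w` to `π w`.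

* For a word in even letters, the entry `(1, 1)` gives the multiset of its letters, hence the word
  up to the commutator ideal `commSpan π`. The entry `(1, 3)` is a sum over the letters of the
  word. If the term of the letter `a` between `U` and `V` is sent, up to sign, to
  `U * (a V - sort (a V))`, where `sort` rearranges the letters into a fixed order, the sum
  telescopes to the difference of the word and its rearrangement (`KillsGenerators.telescope13`). This uses that the
  commutator ideal squares to zero.
* For one odd letter, the entry `(1, 4)` contains the entry `(1, 3)` of the even word on the left
  and the entry `(2, 4)` of the even word on the right, and the same telescoping applies to each
  (`KillsGenerators.recover_odd₁`).
* For two or three odd letters the even letters between consecutive odd ones commute modulo the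
  generators, the other relations move the even letters to positions determined by the monomials
  that occur in the matrix entries, and each sign pattern of the odd letters is a short
  verification (`KillsGenerators.recover_odd₂`, `KillsGenerators.recover_odd₃`).
* Products of four odd elements vanish on both sides.
-/

namespace StarPI

/-! ### Graded homomorphisms commuting with the superinvolution -/

section FreeStar

variable {F : Type*} [Field F]

/-- An assignment of elements of a superalgebra with superinvolution to the variables that respects
degree and symmetry. -/
def Admissible {A : Type*} [Ring A] [Algebra F A] {𝒜 : ZMod 2 → Submodule F A}
    (s : Superinvolution 𝒜) (v : StarVar → A) : Prop :=
  ∀ x, v x ∈ 𝒜 x.deg ∧ s.toFun (v x) = x.sgn • v x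

theorem lift_mono {A : Type*} [Ring A] [Algebra F A] (v : StarVar → A) (L : List StarVar) :
    FreeAlgebra.lift F v (mono F L) = (L.map v).prod := by
  simp [mono, map_list_prod, Function.comp_def]

theorem linearMap_ext_mono {M : Type*} [AddCommMonoid M] [Module F M]
    {f g : FreeStar F →ₗ[F] M} (h : ∀ L, f (mono F L) = g (mono F L)) : f = g :=
  (FreeAlgebra.basisFreeMonoid F StarVar).ext fun L => by rw [basis_eq_mono, h]

theorem mono_mem_freeGrading (L : List StarVar) : mono F L ∈ freeGrading F (wordDeg L) :=
  Submodule.subset_span ⟨L, rfl, rfl⟩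

theorem wordDeg_append (v w : List StarVar) : wordDeg (v ++ w) = wordDeg v + wordDeg w := by
  simp [wordDeg]

theorem wordDeg_cons (a : StarVar) (w : List StarVar) :
    wordDeg (a :: w) = a.deg + wordDeg w := by
  simp [wordDeg]

theorem wordSign_cons (a : StarVar) (w : List StarVar) :
    wordSign (a :: w) = (-1) ^ (a.deg.val * (wordDeg w).val) * (wordSign w * a.sgn) := by
  have h := wordSign_append [a] w
  have h1 : a.deg.val.choose 2 = 0 := Nat.choose_eq_zero_of_lt (ZMod.val_lt a.deg)
  have h2 : wordSign [a] = a.sgn := by simp [wordSign, oddCount, h1]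
  rw [h2] at h
  simpa [wordDeg] using h

instance : SetLike.GradedMonoid (freeGrading F) where
  one_mem := Submodule.subset_span ⟨[], rfl, rfl⟩
  mul_mem i j a b ha hb := by
    have h : freeGrading F i * freeGrading F j ≤ freeGrading F (i + j) := by
      rw [freeGrading, freeGrading, Submodule.span_mul_span, Submodule.span_le]
      rintro _ ⟨_, ⟨v, rfl, rfl⟩, _, ⟨w, rfl, rfl⟩, rfl⟩
      exact Submodule.subset_span ⟨v ++ w, wordDeg_append v w, (mono_append F v w).symm⟩
    exact h (Submodule.mul_mem_mul ha hb)

theorem freeStar_one : (freeStar F).toFun 1 = 1 := by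
  have h := freeStarMap_mono F []
  simp only [mono, wordSign, oddCount, List.map_nil, List.prod_nil, List.sum_nil,
    List.reverse_nil, Nat.choose_zero_succ, pow_zero, mul_one, one_smul] at h
  exact h

section

variable {A : Type*} [Ring A] [Algebra F A] {𝒜 : ZMod 2 → Submodule F A}
  [SetLike.GradedMonoid 𝒜] {s : Superinvolution 𝒜} {v : StarVar → A}

theorem Admissible.prod_mem (hv : Admissible s v) (L : List StarVar) :
    (L.map v).prod ∈ 𝒜 (wordDeg L) := by
  induction L with
  | nil => simpa [wordDeg] using SetLike.GradedOne.one_mem (A := 𝒜)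
  | cons a L ih =>
    rw [List.map_cons, List.prod_cons, wordDeg_cons]
    exact SetLike.GradedMul.mul_mem (hv a).1 ih

theorem Admissible.lift_mem (hv : Admissible s v) {i : ZMod 2} {f : FreeStar F}
    (hf : f ∈ freeGrading F i) : FreeAlgebra.lift F v f ∈ 𝒜 i := by
  have h : freeGrading F i ≤ (𝒜 i).comap (FreeAlgebra.lift F v).toLinearMap := by
    rw [freeGrading, Submodule.span_le]
    rintro _ ⟨L, rfl, rfl⟩
    simpa [lift_mono] using hv.prod_mem L
  exact h hf

theorem Admissible.star_prod (hv : Admissible s v) (h1 : s.toFun 1 = 1) (L : List StarVar) :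
    s.toFun (L.map v).prod = wordSign L • (L.reverse.map v).prod := by
  induction L with
  | nil => simpa [wordSign, oddCount] using h1
  | cons a L ih =>
    rw [List.map_cons, List.prod_cons, s.map_mul _ _ _ (hv a).1 _ (hv.prod_mem L), ih, (hv a).2,
      smul_mul_smul_comm, smul_smul, wordSign_cons]
    simp

theorem Admissible.lift_star (hv : Admissible s v) (h1 : s.toFun 1 = 1) (f : FreeStar F) :
    s.toFun (FreeAlgebra.lift F v f) = FreeAlgebra.lift F v ((freeStar F).toFun f) := by
  have h : s.toFun ∘ₗ (FreeAlgebra.lift F v).toLinearMap =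
      (FreeAlgebra.lift F v).toLinearMap ∘ₗ (freeStar F).toFun := by
    refine linearMap_ext_mono fun L => ?_
    have h2 : (freeStar F).toFun (mono F L) = wordSign L • mono F L.reverse :=
      freeStarMap_mono F L
    simp only [LinearMap.comp_apply, AlgHom.toLinearMap_apply]
    rw [h2, lift_mono, hv.star_prod h1, Units.smul_def, Units.smul_def, map_zsmul, lift_mono]
  exact LinearMap.congr_fun h f

end

theorem freeStar_ι (a : StarVar) :
    (freeStar F).toFun (FreeAlgebra.ι F a) = a.sgn • FreeAlgebra.ι F a := by
  have h := freeStarMap_mono F [a]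
  rw [wordSign_cons] at h
  simp [mono, wordDeg, wordSign, oddCount] at h
  exact h

theorem ι_mem_freeGrading (a : StarVar) : FreeAlgebra.ι F a ∈ freeGrading F a.deg := by
  simpa [mono, wordDeg] using mono_mem_freeGrading (F := F) [a]

/-- A `T₂^*`-ideal is stable under all admissible substitutions. -/
theorem IsT2StarIdeal.lift_mem {I : TwoSidedIdeal (FreeStar F)} (hI : IsT2StarIdeal I)
    {v : StarVar → FreeStar F} (hv : Admissible (freeStar F) v) {f : FreeStar F} (hf : f ∈ I) :
    FreeAlgebra.lift F v f ∈ I :=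
  hI _ (fun _ _ ha => hv.lift_mem ha) (fun a => (hv.lift_star freeStar_one a).symm) f hf

theorem isT2StarIdeal_span (S : Set (FreeStar F)) : IsT2StarIdeal (t2StarIdealSpan S) := by
  intro φ h1 h2 f hf
  rw [t2StarIdealSpan, TwoSidedIdeal.mem_sInf] at hf ⊢
  exact fun I hI => hI.1 φ h1 h2 f (hf I hI)

theorem subset_t2StarIdealSpan {S : Set (FreeStar F)} {f : FreeStar F} (hf : f ∈ S) :
    f ∈ t2StarIdealSpan S := by
  rw [t2StarIdealSpan, TwoSidedIdeal.mem_sInf]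
  exact fun I hI => hI.2 hf

/-- The identities of a superalgebra with superinvolution, as a two-sided ideal. -/
def identityIdeal {A : Type*} [Ring A] [Algebra F A] {𝒜 : ZMod 2 → Submodule F A}
    (s : Superinvolution 𝒜) : TwoSidedIdeal (FreeStar F) :=
  TwoSidedIdeal.mk' (starIdentities s) (fun v _ => map_zero _)
    (fun {f g} hf hg v hv => by rw [map_add, hf v hv, hg v hv, add_zero])
    (fun {f} hf v hv => by rw [map_neg, hf v hv, neg_zero])
    (fun {f g} hg v hv => by rw [map_mul, hg v hv, mul_zero])
    (fun {f g} hf v hv => by rw [map_mul, hf v hv, zero_mul])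

theorem mem_identityIdeal {A : Type*} [Ring A] [Algebra F A] {𝒜 : ZMod 2 → Submodule F A}
    {s : Superinvolution 𝒜} {f : FreeStar F} : f ∈ identityIdeal s ↔ f ∈ starIdentities s := by
  exact TwoSidedIdeal.mem_mk' _ _ _ _ _ _ _

theorem isT2StarIdeal_identityIdeal {A : Type*} [Ring A] [Algebra F A]
    {𝒜 : ZMod 2 → Submodule F A} [SetLike.GradedMonoid 𝒜] {s : Superinvolution 𝒜}
    (h1 : s.toFun 1 = 1) : IsT2StarIdeal (identityIdeal s) := by
  intro φ hφ hs f hf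
  rw [mem_identityIdeal] at hf ⊢
  intro v hv
  have hv' : Admissible s v := hv
  have h := hf (fun a => FreeAlgebra.lift F v (φ (FreeAlgebra.ι F a))) fun a =>
    ⟨hv'.lift_mem (hφ _ _ (ι_mem_freeGrading a)), by
      rw [hv'.lift_star h1, ← hs, freeStar_ι, Units.smul_def, Units.smul_def, map_zsmul,
        map_zsmul]⟩
  rw [← h]
  refine DFunLike.congr_fun (f := (FreeAlgebra.lift F v).comp φ) ?_ f
  ext a
  simp

end FreeStar

/-! ### The graded matrices of order four -/

section Matrices

variable {R : Type*} [CommRing R]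

/-- The upper triangular matrix of order four with the given entries, listed by rows. -/
def upper (a b c d e f g h i l : R) : Matrix (Fin 4) (Fin 4) R :=
  !![a, b, c, d; 0, e, f, g; 0, 0, h, i; 0, 0, 0, l]

theorem upper_mul (a b c d e f g h i l a' b' c' d' e' f' g' h' i' l' : R) :
    upper a b c d e f g h i l * upper a' b' c' d' e' f' g' h' i' l' =
      upper (a * a') (a * b' + b * e') (a * c' + b * f' + c * h')
        (a * d' + b * g' + c * i' + d * l') (e * e') (e * f' + f * h')
        (e * g' + f * i' + g * l') (h * h') (h * i' + i * l') (l * l') := by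
  ext j k
  fin_cases j <;> fin_cases k <;> simp [upper, Matrix.mul_apply, Fin.sum_univ_four]

theorem upper_add (a b c d e f g h i l a' b' c' d' e' f' g' h' i' l' : R) :
    upper a b c d e f g h i l + upper a' b' c' d' e' f' g' h' i' l' =
      upper (a + a') (b + b') (c + c') (d + d') (e + e') (f + f') (g + g') (h + h') (i + i')
        (l + l') := by
  ext j k
  fin_cases j <;> fin_cases k <;> simp [upper]

theorem upper_sub (a b c d e f g h i l a' b' c' d' e' f' g' h' i' l' : R) :
    upper a b c d e f g h i l - upper a' b' c' d' e' f' g' h' i' l' =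
      upper (a - a') (b - b') (c - c') (d - d') (e - e') (f - f') (g - g') (h - h') (i - i')
        (l - l') := by
  ext j k
  fin_cases j <;> fin_cases k <;> simp [upper]

theorem upper_smul (r a b c d e f g h i l : R) :
    r • upper a b c d e f g h i l =
      upper (r * a) (r * b) (r * c) (r * d) (r * e) (r * f) (r * g) (r * h) (r * i) (r * l) := by
  ext j k
  fin_cases j <;> fin_cases k <;> simp [upper]

theorem upper_zero : upper (0 : R) 0 0 0 0 0 0 0 0 0 = 0 := by
  ext j k
  fin_cases j <;> fin_cases k <;> simp [upper]

theorem upper_one : upper (1 : R) 0 0 0 1 0 0 1 0 1 = 1 := by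
  ext j k
  fin_cases j <;> fin_cases k <;> simp [upper]

/-- The even matrix with diagonal `a, e, s e, s a` and entries `c`, `d` in the positions `(1, 3)`
and `(2, 4)`. For `s = ±1` these include the products of symmetric and skew even elements. -/
def evMat (s a e c d : R) : Matrix (Fin 4) (Fin 4) R := upper a 0 c 0 e 0 d (s * e) 0 (s * a)

/-- The odd matrix with entries `b, f, s b` above the diagonal and corner entry `d`. The symmetric
odd elements are those with `s = 1` and `f = 0`, the skew ones those with `s = -1` and `d = 0`. -/
def odMat (s b f d : R) : Matrix (Fin 4) (Fin 4) R := upper 0 b 0 d 0 f 0 0 (s * b) 0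

/-- An assignment of matrices to the variables of the form forced by degree and symmetry. -/
structure IsMatrixAssignment (V : StarVar → Matrix (Fin 4) (Fin 4) R) : Prop where
  even : ∀ ε i, ∃ a e c, V ⟨0, ε, i⟩ = evMat ((ε : ℤ) : R) a e c (((ε : ℤ) : R) * c)
  odd_pos : ∀ i, ∃ b d, V ⟨1, 1, i⟩ = odMat 1 b 0 d
  odd_neg : ∀ i, ∃ b f, V ⟨1, -1, i⟩ = odMat (-1) b f 0

/-- The product of the signs of the letters of a word. -/
def sgnProd (L : List StarVar) : ℤˣ := (L.map StarVar.sgn).prod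

/-- All letters of the word are even. -/
def IsEven (L : List StarVar) : Prop := ∀ a ∈ L, a.deg = 0

theorem IsEven.cons_iff {a : StarVar} {L : List StarVar} :
    IsEven (a :: L) ↔ a.deg = 0 ∧ IsEven L := by
  simp [IsEven]

theorem IsEven.append_iff {L L' : List StarVar} :
    IsEven (L ++ L') ↔ IsEven L ∧ IsEven L' := by
  simp only [IsEven, List.mem_append, or_imp, forall_and]

theorem IsEven.perm {L L' : List StarVar} (h : IsEven L) (hp : L.Perm L') : IsEven L' :=
  fun a ha => h a (hp.mem_iff.mpr ha)

theorem IsEven.reverse {L : List StarVar} (h : IsEven L) : IsEven L.reverse :=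
  h.perm (List.reverse_perm L).symm

theorem sgn_mul_self (u : ℤˣ) : ((u : ℤ) : R) * ((u : ℤ) : R) = 1 := by
  rcases Int.units_eq_one_or u with rfl | rfl <;> simp

/-- Reversing a word in the even letters swaps the entries `(1, 3)` and `(2, 4)`, up to sign. -/
theorem IsMatrixAssignment.even_word {V : StarVar → Matrix (Fin 4) (Fin 4) R}
    (hV : IsMatrixAssignment V) {L : List StarVar} (hL : IsEven L) :
    ∃ c d, (L.map V).prod = evMat ((sgnProd L : ℤ) : R) (L.map fun x => V x 0 0).prod
        (L.map fun x => V x 1 1).prod c d ∧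
      (L.reverse.map V).prod = evMat ((sgnProd L : ℤ) : R) (L.map fun x => V x 0 0).prod
        (L.map fun x => V x 1 1).prod (((sgnProd L : ℤ) : R) * d) (((sgnProd L : ℤ) : R) * c) := by
  induction L with
  | nil =>
    refine ⟨0, 0, ?_⟩
    simp [sgnProd, evMat, upper_one]
  | cons x L ih =>
    obtain ⟨hx, hL'⟩ := IsEven.cons_iff.mp hL
    obtain ⟨c, d, h1, h2⟩ := ih hL'
    obtain ⟨dx, ε, i⟩ := x
    obtain rfl : dx = 0 := hx
    obtain ⟨a, e, c', h⟩ := hV.even ε i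
    have h0 : V ⟨0, ε, i⟩ 0 0 = a := by rw [h]; rfl
    have h0' : V ⟨0, ε, i⟩ 1 1 = e := by rw [h]; rfl
    have hs := sgn_mul_self (R := R) ε
    have hs' := sgn_mul_self (R := R) (sgnProd L)
    simp only [List.map_cons, List.prod_cons, List.reverse_cons, List.map_append, List.prod_append,
      h0, h0', sgnProd, h1, h2, h, List.map_nil, List.prod_nil, mul_one, Units.val_mul,
      Int.cast_mul, evMat, upper_mul]
    simp only [sgnProd] at hs'
    generalize (((L.map StarVar.sgn).prod : ℤ) : R) = s at *
    generalize ((ε : ℤ) : R) = t at *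
    refine ⟨_, _, congr (congr (congr (congr (congr (congr (congr (congr (congr (congr rfl
      ?_) ?_) rfl) ?_) ?_) ?_) rfl) ?_) ?_) ?_, congr (congr (congr (congr (congr (congr (congr
      (congr (congr (congr rfl ?_) ?_) ?_) ?_) ?_) ?_) ?_) ?_) ?_) ?_⟩
    all_goals try ring1
    · linear_combination (-((L.map fun x => V x 0 0).prod * c') * t ^ 2) * hs' -
        (L.map fun x => V x 0 0).prod * c' * hs
    · linear_combination (-((L.map fun x => V x 1 1).prod * t * c')) * hs'

theorem IsMatrixAssignment.odd {V : StarVar → Matrix (Fin 4) (Fin 4) R}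
    (hV : IsMatrixAssignment V) (δ : ℤˣ) (i : ℕ) :
    ∃ b f d, V ⟨1, δ, i⟩ = odMat ((δ : ℤ) : R) b f d := by
  rcases Int.units_eq_one_or δ with rfl | rfl
  · obtain ⟨b, d, h⟩ := hV.odd_pos i
    exact ⟨b, 0, d, by simpa using h⟩
  · obtain ⟨b, f, h⟩ := hV.odd_neg i
    exact ⟨b, f, 0, by simpa using h⟩

theorem map_comm {R S : Type*} [Ring R] [Ring S] (φ : R →+* S) (a : R) (l : List R) :
    φ (comm a l) = comm (φ a) (l.map φ) := by
  induction l generalizing a with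
  | nil => rfl
  | cons b l ih =>
    have h := ih (a * b - b * a)
    simp only [map_sub, map_mul] at h
    exact h

theorem comm_cons {R : Type*} [Ring R] (a b : R) (l : List R) :
    comm a (b :: l) = comm (a * b - b * a) l := rfl

theorem comm_nil {R : Type*} [Ring R] (a : R) : comm a [] = a := rfl

/-- Commuting with even letters rescales the entries `(1, 3)` and `(2, 4)`, by factors that do not
depend on the order of the letters. -/
theorem IsMatrixAssignment.comm_word {V : StarVar → Matrix (Fin 4) (Fin 4) R}
    (hV : IsMatrixAssignment V) {L : List StarVar} (hL : IsEven L) (c d : R) :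
    comm (upper 0 0 c 0 0 0 d 0 0 0) (L.map V) =
      upper 0 0 (c * (L.map fun x => V x 2 2 - V x 0 0).prod) 0 0 0
        (d * (L.map fun x => V x 3 3 - V x 1 1).prod) 0 0 0 := by
  induction L generalizing c d with
  | nil => simp [comm_nil]
  | cons x L ih =>
    obtain ⟨hx, hL'⟩ := IsEven.cons_iff.mp hL
    obtain ⟨dx, ε, i⟩ := x
    obtain rfl : dx = 0 := hx
    obtain ⟨a, e, c', h⟩ := hV.even ε i
    have h1 : upper 0 0 c 0 0 0 d 0 0 0 * V ⟨0, ε, i⟩ - V ⟨0, ε, i⟩ * upper 0 0 c 0 0 0 d 0 0 0 =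
        upper 0 0 (c * (V ⟨0, ε, i⟩ 2 2 - V ⟨0, ε, i⟩ 0 0)) 0 0 0
          (d * (V ⟨0, ε, i⟩ 3 3 - V ⟨0, ε, i⟩ 1 1)) 0 0 0 := by
      have h2 : V ⟨0, ε, i⟩ 2 2 = ((ε : ℤ) : R) * e := by rw [h]; rfl
      have h3 : V ⟨0, ε, i⟩ 3 3 = ((ε : ℤ) : R) * a := by rw [h]; rfl
      have h4 : V ⟨0, ε, i⟩ 0 0 = a := by rw [h]; rfl
      have h5 : V ⟨0, ε, i⟩ 1 1 = e := by rw [h]; rfl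
      rw [h2, h3, h4, h5, h, evMat, upper_mul, upper_mul, upper_sub]
      congr 1 <;> ring
    simp only [List.map_cons, comm_cons, List.prod_cons]
    rw [h1, ih hL']
    congr 1 <;> ring

end Matrices

/-! ### The generators are identities -/

section Words

/-- The word `w_{σ(1)} ⋯ w_{σ(k)}` of even letters. -/
def wWord {k : ℕ} (ε : Fin k → ℤˣ) (σ : Equiv.Perm (Fin k)) : List StarVar :=
  List.ofFn fun i => ⟨0, ε (σ i), (σ i : ℕ) + 1⟩

/-- The word `y_{σ(3)} ⋯ y_{σ(m+2)}` of even letters. -/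
def tailWord {m : ℕ} (ε : Fin m → ℤˣ) (σ : Equiv.Perm (Fin m)) : List StarVar :=
  List.ofFn fun i => ⟨0, ε (σ i), (σ i : ℕ) + 3⟩

/-- The word `y⁺_{s+1} ⋯ y⁺_{s+a} y⁻_{s+a+1} ⋯ y⁻_{s+a+a'}`. -/
def blockWord (s a a' : ℕ) : List StarVar :=
  (List.ofFn fun i : Fin a => ⟨0, 1, s + i + 1⟩) ++
    List.ofFn fun i : Fin a' => ⟨0, -1, s + a + i + 1⟩

variable {F : Type*} [Field F]

theorem w_eq {k : ℕ} (ε : Fin k → ℤˣ) (σ : Equiv.Perm (Fin k)) :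
    w F ε σ = mono F (wWord ε σ) := by
  simp [w, wList, mono, wWord, y, List.map_ofFn, Function.comp_def]

theorem wRev_eq {k : ℕ} (ε : Fin k → ℤˣ) (σ : Equiv.Perm (Fin k)) :
    wRev F ε σ = mono F (wWord ε σ).reverse := by
  simp [wRev, wList, mono, wWord, y, List.map_ofFn, Function.comp_def, List.map_reverse]

theorem tailList_eq {m : ℕ} (ε : Fin m → ℤˣ) (σ : Equiv.Perm (Fin m)) :
    tailList F ε σ = (tailWord ε σ).map (FreeAlgebra.ι F) := by
  simp [tailList, tailWord, y, List.map_ofFn, Function.comp_def]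

theorem block_eq (s a a' : ℕ) : block F s a a' = mono F (blockWord s a a') := by
  simp [block, mono, blockWord, y, List.map_ofFn, Function.comp_def]

theorem wWord_perm {k : ℕ} (ε : Fin k → ℤˣ) (σ : Equiv.Perm (Fin k)) :
    (wWord ε σ).Perm (wWord ε 1) :=
  Equiv.Perm.ofFn_comp_perm σ fun i => (⟨0, ε i, (i : ℕ) + 1⟩ : StarVar)

theorem tailWord_perm {m : ℕ} (ε : Fin m → ℤˣ) (σ : Equiv.Perm (Fin m)) :
    (tailWord ε σ).Perm (tailWord ε 1) :=
  Equiv.Perm.ofFn_comp_perm σ fun i => (⟨0, ε i, (i : ℕ) + 3⟩ : StarVar)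

theorem isEven_wWord {k : ℕ} (ε : Fin k → ℤˣ) (σ : Equiv.Perm (Fin k)) : IsEven (wWord ε σ) := by
  simp [IsEven, wWord, List.mem_ofFn]

theorem isEven_tailWord {m : ℕ} (ε : Fin m → ℤˣ) (σ : Equiv.Perm (Fin m)) :
    IsEven (tailWord ε σ) := by
  simp [IsEven, tailWord, List.mem_ofFn]

theorem isEven_blockWord (s a a' : ℕ) : IsEven (blockWord s a a') := by
  simp only [IsEven, blockWord, List.mem_append, List.mem_ofFn]
  rintro _ (⟨i, rfl⟩ | ⟨i, rfl⟩) <;> rfl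

theorem neg_one_pow_skewCount {k : ℕ} (ε : Fin k → ℤˣ) :
    (-1) ^ skewCount ε = sgnProd (wWord ε 1) := by
  have h : ∀ u : ℤˣ, u = if u = -1 then -1 else 1 := by decide
  rw [sgnProd, wWord, List.map_ofFn, List.prod_ofFn, skewCount]
  simp only [Function.comp_apply, Equiv.Perm.one_apply]
  rw [Finset.prod_congr rfl fun i _ => h (ε i), Finset.prod_ite]
  simp

theorem sgnProd_blockWord (s a a' : ℕ) : sgnProd (blockWord s a a') = (-1) ^ a' := by
  simp [sgnProd, blockWord, List.map_ofFn, Function.comp_def]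

theorem sgnProd_perm {L L' : List StarVar} (h : L.Perm L') : sgnProd L = sgnProd L' :=
  (h.map StarVar.sgn).prod_eq

theorem neg_one_pow_mul_eq_smul {A : Type*} [Ring A] [Algebra F A] (n : ℕ) (a : A) :
    (-1) ^ n * a = ((((-1 : ℤˣ) ^ n : ℤˣ) : ℤ) : F) • a := by
  rcases Nat.even_or_odd n with h | h <;> simp [h.neg_one_pow]

theorem neg_one_pow_succ_mul_eq_smul {A : Type*} [Ring A] [Algebra F A] (n : ℕ) (a : A) :
    (-1) ^ (n + 1) * a = (-((((-1 : ℤˣ) ^ n : ℤˣ) : ℤ) : F)) • a := by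
  rcases Nat.even_or_odd n with h | h <;> simp [pow_succ, h.neg_one_pow]

end Words

section Soundness

variable {F : Type*} [Field F] {V : StarVar → Matrix (Fin 4) (Fin 4) F}

theorem lift_comm (a : FreeStar F) (l : List (FreeStar F)) :
    FreeAlgebra.lift F V (comm a l) =
      comm (FreeAlgebra.lift F V a) (l.map (FreeAlgebra.lift F V)) :=
  map_comm (FreeAlgebra.lift F V).toRingHom a l

theorem lift_tailList {m : ℕ} (ε : Fin m → ℤˣ) (σ : Equiv.Perm (Fin m)) :
    (tailList F ε σ).map (FreeAlgebra.lift F V) = (tailWord ε σ).map V := by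
  simp [tailList_eq, Function.comp_def]

theorem lift_y (ε : ℤˣ) (i : ℕ) : FreeAlgebra.lift F V (y F ε i) = V ⟨0, ε, i⟩ := by simp [y]

theorem lift_z (ε : ℤˣ) (i : ℕ) : FreeAlgebra.lift F V (z F ε i) = V ⟨1, ε, i⟩ := by simp [z]

theorem IsMatrixAssignment.comm_tail (hV : IsMatrixAssignment V) (ε₁ ε₂ : ℤˣ) {m : ℕ}
    (ε : Fin m → ℤˣ) : ∃ c d, ∀ σ, FreeAlgebra.lift F V
      (comm (y F ε₁ 1) (y F ε₂ 2 :: tailList F ε σ)) = upper 0 0 c 0 0 0 d 0 0 0 := by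
  obtain ⟨a₁, e₁, c₁, h₁⟩ := hV.even ε₁ 1
  obtain ⟨a₂, e₂, c₂, h₂⟩ := hV.even ε₂ 2
  have h : ∃ c d, V ⟨0, ε₁, 1⟩ * V ⟨0, ε₂, 2⟩ - V ⟨0, ε₂, 2⟩ * V ⟨0, ε₁, 1⟩ =
      upper 0 0 c 0 0 0 d 0 0 0 := by
    rw [h₁, h₂, evMat, evMat, upper_mul, upper_mul, upper_sub]
    refine ⟨_, _, congr (congr (congr (congr (congr (congr (congr (congr (congr (congr rfl
      ?_) ?_) rfl) ?_) ?_) ?_) rfl) ?_) ?_) ?_⟩ <;> ring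
  obtain ⟨c, d, h⟩ := h
  refine ⟨c * ((tailWord ε 1).map fun x => V x 2 2 - V x 0 0).prod,
    d * ((tailWord ε 1).map fun x => V x 3 3 - V x 1 1).prod, fun σ => ?_⟩
  rw [lift_comm, List.map_cons, comm_cons, lift_y, lift_y, h, lift_tailList,
    hV.comm_word (isEven_tailWord ε σ), ((tailWord_perm ε σ).map _).prod_eq,
    ((tailWord_perm ε σ).map _).prod_eq]

/-- A word in distinct even letters, its rearrangements and their reversals are determined by the
entries `(1, 3)` and `(2, 4)`. -/
theorem IsMatrixAssignment.wWord (hV : IsMatrixAssignment V) {k : ℕ} (ε : Fin k → ℤˣ) :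
    ∃ a e : F, ∀ σ, ∃ c d, FreeAlgebra.lift F V (w F ε σ) =
        evMat ((((-1 : ℤˣ) ^ skewCount ε : ℤˣ) : ℤ) : F) a e c d ∧
      FreeAlgebra.lift F V (wRev F ε σ) =
        evMat ((((-1 : ℤˣ) ^ skewCount ε : ℤˣ) : ℤ) : F) a e
          (((((-1 : ℤˣ) ^ skewCount ε : ℤˣ) : ℤ) : F) * d)
          (((((-1 : ℤˣ) ^ skewCount ε : ℤˣ) : ℤ) : F) * c) := by
  refine ⟨((StarPI.wWord ε 1).map fun x => V x 0 0).prod,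
    ((StarPI.wWord ε 1).map fun x => V x 1 1).prod, fun σ => ?_⟩
  obtain ⟨c, d, h1, h2⟩ := hV.even_word (isEven_wWord ε σ)
  refine ⟨c, d, ?_⟩
  rw [neg_one_pow_skewCount, w_eq, wRev_eq, lift_mono, lift_mono, h1, h2,
    sgnProd_perm (wWord_perm ε σ), ((wWord_perm ε σ).map _).prod_eq,
    ((wWord_perm ε σ).map _).prod_eq]
  exact ⟨rfl, rfl⟩

theorem IsMatrixAssignment.block (hV : IsMatrixAssignment V) (s a a' : ℕ) :
    ∃ r e c d : F, FreeAlgebra.lift F V (block F s a a') =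
        evMat ((((-1 : ℤˣ) ^ a' : ℤˣ) : ℤ) : F) r e c d := by
  obtain ⟨c, d, h1, -⟩ := hV.even_word (isEven_blockWord s a a')
  exact ⟨_, _, c, d, by rw [block_eq, lift_mono, h1, sgnProd_blockWord]⟩

theorem IsMatrixAssignment.lift_three_blocks (hV : IsMatrixAssignment V) (a a' b b' c c' : ℕ) :
    FreeAlgebra.lift F V ((-1) ^ (a' + c') * (StarPI.block F 0 a a' * z F (-1) 1 *
        StarPI.block F (a + a') b b' * z F (-1) 2 * StarPI.block F (a + a' + b + b') c c')
      - (-1) ^ c' * (z F (-1) 1 * StarPI.block F 0 a a' * StarPI.block F (a + a') b b' *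
        z F (-1) 2 * StarPI.block F (a + a' + b + b') c c')
      + z F (-1) 1 * StarPI.block F 0 a a' * StarPI.block F (a + a') b b' *
        StarPI.block F (a + a' + b + b') c c' * z F (-1) 2
      - (-1) ^ a' * (StarPI.block F 0 a a' * z F (-1) 1 * StarPI.block F (a + a') b b' *
        StarPI.block F (a + a' + b + b') c c' * z F (-1) 2)) = 0 := by
  obtain ⟨_, _, _, _, h₁⟩ := hV.block 0 a a'
  obtain ⟨_, _, _, _, h₂⟩ := hV.block (a + a') b b'
  obtain ⟨_, _, _, _, h₃⟩ := hV.block (a + a' + b + b') c c'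
  obtain ⟨_, _, h₄⟩ := hV.odd_neg 1
  obtain ⟨_, _, h₅⟩ := hV.odd_neg 2
  have ha := sgn_mul_self (R := F) ((-1) ^ a')
  have hb := sgn_mul_self (R := F) ((-1) ^ b')
  have hc := sgn_mul_self (R := F) ((-1) ^ c')
  have hac : ((((-1 : ℤˣ) ^ (a' + c') : ℤˣ) : ℤ) : F) =
      ((((-1 : ℤˣ) ^ a' : ℤˣ) : ℤ) : F) * ((((-1 : ℤˣ) ^ c' : ℤˣ) : ℤ) : F) := by
    simp [pow_add]
  simp only [map_mul, map_sub, map_add, map_smul, lift_z, h₁, h₂, h₃, h₄, h₅,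
    neg_one_pow_mul_eq_smul (F := F), evMat, odMat, hac,
    upper_mul, upper_sub, upper_add, upper_smul]
  generalize ((((-1 : ℤˣ) ^ a' : ℤˣ) : ℤ) : F) = s at *
  generalize ((((-1 : ℤˣ) ^ b' : ℤˣ) : ℤ) : F) = t at *
  generalize ((((-1 : ℤˣ) ^ c' : ℤˣ) : ℤ) : F) = u at *
  rcases mul_self_eq_one_iff.mp ha with rfl | rfl <;>
    rcases mul_self_eq_one_iff.mp hb with rfl | rfl <;>
      rcases mul_self_eq_one_iff.mp hc with rfl | rfl
  all_goals
    simp only [mul_zero, zero_mul, add_zero, zero_add, sub_zero]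
    rw [← upper_zero]
    congr 1 <;> ring

/-- Every generator vanishes under the admissible matrix assignments. -/
theorem IsMatrixAssignment.lift_generator (hV : IsMatrixAssignment V) {f : FreeStar F}
    (hf : IsGenerator F f) : FreeAlgebra.lift F V f = 0 := by
  have hzero : ∀ a b c d e f g h i l : F, a = 0 → b = 0 → c = 0 → d = 0 → e = 0 → f = 0 → g = 0 →
      h = 0 → i = 0 → l = 0 → upper a b c d e f g h i l = 0 := by
    rintro _ _ _ _ _ _ _ _ _ _ rfl rfl rfl rfl rfl rfl rfl rfl rfl rfl
    exact upper_zero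
  have hpow : ∀ n : ℕ, ((((-1 : ℤˣ) ^ n : ℤˣ) : ℤ) : F) * ((((-1 : ℤˣ) ^ n : ℤˣ) : ℤ) : F) = 1 :=
    fun n => sgn_mul_self _
  cases hf with
  | comm_x_comm ε₁ ε₂ ε₃ ε₄ δ d =>
    obtain ⟨_, _, _, h₁⟩ := hV.even ε₁ 1
    obtain ⟨_, _, _, h₂⟩ := hV.even ε₂ 2
    obtain ⟨_, _, _, h₃⟩ := hV.even ε₃ 3
    obtain ⟨_, _, _, h₄⟩ := hV.even ε₄ 4
    have hd : d = 0 ∨ d = 1 := by revert d; decide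
    rcases hd with rfl | rfl
    · obtain ⟨_, _, _, h₅⟩ := hV.even δ 0
      simp only [map_mul, map_sub, comm_cons, comm_nil, lift_y, x, FreeAlgebra.lift_ι_apply,
        h₁, h₂, h₃, h₄, h₅, evMat, upper_mul, upper_sub]
      apply hzero <;> ring
    · obtain ⟨_, _, _, h₅⟩ := hV.odd δ 0
      simp only [map_mul, map_sub, comm_cons, comm_nil, lift_y, x, FreeAlgebra.lift_ι_apply,
        h₁, h₂, h₃, h₄, h₅, evMat, odMat, upper_mul, upper_sub]
      apply hzero <;> ring
  | jacobi ε₁ ε₂ ε₃ d₁ d₂ d₃ =>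
    rw [← map_zero (FreeAlgebra.lift F V)]
    congr 1
    simp only [comm_cons, comm_nil]
    noncomm_ring
  | comm_perm ε₁ ε₂ m ε σ =>
    obtain ⟨_, _, h⟩ := hV.comm_tail ε₁ ε₂ ε
    rw [map_sub, h, h, sub_self]
  | zpos_y_zpos ε =>
    obtain ⟨_, _, _, h₁⟩ := hV.even ε 0
    obtain ⟨_, _, h₂⟩ := hV.odd_pos 1
    obtain ⟨_, _, h₃⟩ := hV.odd_pos 2
    simp only [map_mul, lift_y, lift_z, h₁, h₂, h₃, evMat, odMat, upper_mul]
    apply hzero <;> ring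
  | zpos_swap δ =>
    obtain ⟨_, _, _, h₁⟩ := hV.odd δ 2
    obtain ⟨_, _, h₂⟩ := hV.odd_pos 1
    obtain ⟨_, _, h₃⟩ := hV.odd_pos 3
    simp only [map_mul, map_sub, lift_z, h₁, h₂, h₃, odMat, upper_mul, upper_sub]
    apply hzero <;> ring
  | zneg_swap δ =>
    obtain ⟨_, _, _, h₁⟩ := hV.odd δ 2
    obtain ⟨_, _, h₂⟩ := hV.odd_neg 1
    obtain ⟨_, _, h₃⟩ := hV.odd_neg 3
    simp only [map_mul, map_sub, lift_z, h₁, h₂, h₃, odMat, upper_mul, upper_sub]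
    apply hzero <;> ring
  | zzzz δ₁ δ₂ δ₃ δ₄ =>
    obtain ⟨_, _, _, h₁⟩ := hV.odd δ₁ 1
    obtain ⟨_, _, _, h₂⟩ := hV.odd δ₂ 2
    obtain ⟨_, _, _, h₃⟩ := hV.odd δ₃ 3
    obtain ⟨_, _, _, h₄⟩ := hV.odd δ₄ 4
    simp only [map_mul, lift_z, h₁, h₂, h₃, h₄, odMat, upper_mul]
    apply hzero <;> ring
  | zneg_zpos_zneg ε₄ ε₅ =>
    obtain ⟨_, _, _, h₄⟩ := hV.even ε₄ 4
    obtain ⟨_, _, _, h₅⟩ := hV.even ε₅ 5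
    obtain ⟨_, _, h₁⟩ := hV.odd_neg 1
    obtain ⟨_, _, h₂⟩ := hV.odd_pos 2
    obtain ⟨_, _, h₃⟩ := hV.odd_neg 3
    simp only [map_mul, lift_y, lift_z, h₁, h₂, h₃, h₄, h₅, evMat, odMat, upper_mul]
    apply hzero <;> ring
  | zneg_zneg_zpos ε₂ ε₄ =>
    obtain ⟨_, _, _, h₂⟩ := hV.even ε₂ 2
    obtain ⟨_, _, _, h₄⟩ := hV.even ε₄ 4
    obtain ⟨_, _, h₁⟩ := hV.odd_neg 1
    obtain ⟨_, _, h₃⟩ := hV.odd_neg 3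
    obtain ⟨_, _, h₅⟩ := hV.odd_pos 5
    simp only [map_mul, map_add, lift_y, lift_z, h₁, h₂, h₃, h₄, h₅, evMat, odMat, upper_mul,
      upper_add]
    apply hzero <;> ring
  | comm_z_ypos ε₁ ε₂ δ m ε =>
    obtain ⟨_, _, h⟩ := hV.comm_tail ε₁ ε₂ ε
    obtain ⟨_, _, _, h₁⟩ := hV.even 1 0
    obtain ⟨_, _, _, h₂⟩ := hV.odd δ 0
    simp only [map_mul, map_sub, lift_y, lift_z, h, h₁, h₂, evMat, odMat, upper_mul, upper_sub,
      Units.val_one, Int.cast_one]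
    apply hzero <;> ring
  | comm_z_yneg ε₁ ε₂ δ m ε =>
    obtain ⟨_, _, h⟩ := hV.comm_tail ε₁ ε₂ ε
    obtain ⟨_, _, _, h₁⟩ := hV.even (-1) 0
    obtain ⟨_, _, _, h₂⟩ := hV.odd δ 0
    simp only [map_mul, map_add, lift_y, lift_z, h, h₁, h₂, evMat, odMat, upper_mul, upper_add,
      Units.val_neg, Units.val_one, Int.cast_neg, Int.cast_one]
    apply hzero <;> ring
  | perm_zpos k ε σ =>
    obtain ⟨_, _, h⟩ := hV.wWord ε
    obtain ⟨_, _, h₁, h₁'⟩ := h 1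
    obtain ⟨_, _, h₂, h₂'⟩ := h σ
    obtain ⟨_, _, h₃⟩ := hV.odd_pos 0
    simp only [neg_one_pow_succ_mul_eq_smul (F := F), map_mul, map_sub, map_add, map_smul,
      lift_z, h₁, h₁', h₂, h₂', h₃, evMat, odMat, upper_mul, upper_sub, upper_add, upper_smul]
    have hs := hpow (skewCount ε)
    generalize ((((-1 : ℤˣ) ^ skewCount ε : ℤˣ) : ℤ) : F) = s at *
    rcases mul_self_eq_one_iff.mp hs with rfl | rfl
    all_goals apply hzero <;> ring
  | perm_zneg k ε σ =>
    obtain ⟨_, _, h⟩ := hV.wWord ε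
    obtain ⟨_, _, h₁, h₁'⟩ := h 1
    obtain ⟨_, _, h₂, h₂'⟩ := h σ
    obtain ⟨_, _, h₃⟩ := hV.odd_neg 0
    simp only [map_mul, map_sub, map_add, map_smul,
      lift_z, h₁, h₁', h₂, h₂', h₃, neg_one_pow_mul_eq_smul (F := F), evMat, odMat,
      upper_mul, upper_sub, upper_add, upper_smul]
    have hs := hpow (skewCount ε)
    generalize ((((-1 : ℤˣ) ^ skewCount ε : ℤˣ) : ℤ) : F) = s at *
    rcases mul_self_eq_one_iff.mp hs with rfl | rfl
    all_goals apply hzero <;> ring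
  | perm_z_z k ε σ δ₁ δ₂ =>
    obtain ⟨_, _, h⟩ := hV.wWord ε
    obtain ⟨_, _, h₁, -⟩ := h 1
    obtain ⟨_, _, h₂, -⟩ := h σ
    obtain ⟨_, _, _, h₃⟩ := hV.odd δ₁ 1
    obtain ⟨_, _, _, h₄⟩ := hV.odd δ₂ 2
    simp only [map_mul, map_sub, lift_z, h₁, h₂, h₃, h₄, evMat, odMat, upper_mul, upper_sub]
    apply hzero <;> ring
  | z_perm_z k ε σ δ₁ δ₂ =>
    obtain ⟨_, _, h⟩ := hV.wWord ε
    obtain ⟨_, _, h₁, -⟩ := h 1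
    obtain ⟨_, _, h₂, -⟩ := h σ
    obtain ⟨_, _, _, h₃⟩ := hV.odd δ₁ 1
    obtain ⟨_, _, _, h₄⟩ := hV.odd δ₂ 2
    simp only [map_mul, map_sub, lift_z, h₁, h₂, h₃, h₄, evMat, odMat, upper_mul, upper_sub]
    apply hzero <;> ring
  | z_z_perm k ε σ δ₁ δ₂ =>
    obtain ⟨_, _, h⟩ := hV.wWord ε
    obtain ⟨_, _, h₁, -⟩ := h 1
    obtain ⟨_, _, h₂, -⟩ := h σ
    obtain ⟨_, _, _, h₃⟩ := hV.odd δ₁ 1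
    obtain ⟨_, _, _, h₄⟩ := hV.odd δ₂ 2
    simp only [map_mul, map_sub, lift_z, h₁, h₂, h₃, h₄, evMat, odMat, upper_mul, upper_sub]
    apply hzero <;> ring
  | zneg_w_zpos k ε =>
    obtain ⟨_, _, h⟩ := hV.wWord ε
    obtain ⟨_, _, h₁, -⟩ := h 1
    obtain ⟨_, _, h₃⟩ := hV.odd_neg 0
    obtain ⟨_, _, h₄⟩ := hV.odd_pos 0
    simp only [neg_one_pow_succ_mul_eq_smul (F := F), map_mul, map_add, map_smul,
      lift_z, h₁, h₃, h₄, evMat, odMat, upper_mul, upper_add, upper_smul]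
    apply hzero <;> ring
  | zpos_w_zneg k ε =>
    obtain ⟨_, _, h⟩ := hV.wWord ε
    obtain ⟨_, _, h₁, -⟩ := h 1
    obtain ⟨_, _, h₃⟩ := hV.odd_neg 0
    obtain ⟨_, _, h₄⟩ := hV.odd_pos 0
    have hs := hpow (skewCount ε)
    simp only [neg_one_pow_succ_mul_eq_smul (F := F), map_mul, map_add, map_smul,
      lift_z, h₁, h₃, h₄, evMat, odMat, upper_mul, upper_add, upper_smul]
    generalize ((((-1 : ℤˣ) ^ skewCount ε : ℤˣ) : ℤ) : F) = s at *
    rcases mul_self_eq_one_iff.mp hs with rfl | rfl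
    all_goals apply hzero <;> ring
  | three_blocks a a' b b' c c' A B C hA hB hC =>
    subst hA hB hC
    exact hV.lift_three_blocks a a' b b' c c'
  | zz_w_z k ε δ₁ δ₂ δ₃ =>
    obtain ⟨_, _, h⟩ := hV.wWord ε
    obtain ⟨_, _, h₁, -⟩ := h 1
    obtain ⟨_, _, _, h₃⟩ := hV.odd δ₁ 1
    obtain ⟨_, _, _, h₄⟩ := hV.odd δ₂ 2
    obtain ⟨_, _, _, h₅⟩ := hV.odd δ₃ 3
    simp only [map_mul, map_sub, map_smul, lift_z, h₁, h₃, h₄, h₅,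
      neg_one_pow_mul_eq_smul (F := F), evMat, odMat, upper_mul, upper_sub, upper_smul]
    apply hzero <;> ring
  | w_zzz k ε δ₁ δ₂ δ₃ =>
    obtain ⟨_, _, h⟩ := hV.wWord ε
    obtain ⟨_, _, h₁, -⟩ := h 1
    obtain ⟨_, _, _, h₃⟩ := hV.odd δ₁ 1
    obtain ⟨_, _, _, h₄⟩ := hV.odd δ₂ 2
    obtain ⟨_, _, _, h₅⟩ := hV.odd δ₃ 3
    simp only [map_mul, map_sub, map_smul, lift_z, h₁, h₃, h₄, h₅,
      neg_one_pow_mul_eq_smul (F := F), evMat, odMat, upper_mul, upper_sub, upper_smul]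
    apply hzero <;> ring

end Soundness

/-! ### The admissible substitutions of the super-symplectic superinvolution -/

section

variable {F : Type*} [Field F]

instance elementaryGrading_gradedMonoid {n : ℕ} (g : Fin n → ZMod 2) :
    SetLike.GradedMonoid (elementaryGrading F g) where
  one_mem := by
    intro k j h
    have hkj : k ≠ j := by
      rintro rfl
      exact h (CharTwo.add_self_eq_zero _)
    exact Matrix.one_apply_ne hkj
  mul_mem i i' M N hM hN := by
    intro k j h
    change (M.1 * N.1) k j = 0
    rw [Matrix.mul_apply]
    refine Finset.sum_eq_zero fun l _ => ?_
    by_cases h1 : g k + g l = i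
    · have h2 : g l + g j ≠ i' := by
        rintro rfl
        refine h ?_
        rw [← h1, add_add_add_comm, add_comm (g l) (g j), add_assoc (g k) (g l),
          add_left_comm (g l), CharTwo.add_self_eq_zero, add_zero]
      rw [hN l j h2, mul_zero]
    · rw [hM k l h1, zero_mul]

theorem superSymplectic_one : (superSymplectic F).toFun 1 = 1 := by
  apply Subtype.ext
  change superSymplecticMatrix 1 = (1 : Matrix (Fin 4) (Fin 4) F)
  ext i j
  fin_cases i <;> fin_cases j <;> simp [superSymplecticMatrix]

theorem Admissible.isMatrixAssignment [CharZero F] {v : StarVar → UT F 4}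
    (hv : Admissible (superSymplectic F) v) : IsMatrixAssignment fun x => (v x).1 := by
  have hl : ∀ x, ∀ k j : Fin 4, j < k → (v x).1 k j = 0 := fun x k j h => (v x).2 h
  have hs : ∀ x k j, superSymplecticMatrix (v x).1 k j = ((x.sgn : ℤ) : F) * (v x).1 k j := by
    intro x k j
    have h := congrArg (fun M : UT F 4 => M.1 k j) (hv x).2
    rw [Units.smul_def, ← Int.cast_smul_eq_zsmul F] at h
    exact h
  have hupper : ∀ x, (v x).1 = upper ((v x).1 0 0) ((v x).1 0 1) ((v x).1 0 2) ((v x).1 0 3)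
      ((v x).1 1 1) ((v x).1 1 2) ((v x).1 1 3) ((v x).1 2 2) ((v x).1 2 3) ((v x).1 3 3) := by
    intro x
    ext k j
    fin_cases k <;> fin_cases j <;> first | rfl | exact hl x _ _ (by decide)
  have h2 : ∀ r : F, r = -r → r = 0 := fun r hr => self_eq_neg.mp hr
  refine ⟨fun ε i => ⟨(v ⟨0, ε, i⟩).1 0 0, (v ⟨0, ε, i⟩).1 1 1, (v ⟨0, ε, i⟩).1 0 2, ?_⟩,
    fun i => ⟨(v ⟨1, 1, i⟩).1 0 1, (v ⟨1, 1, i⟩).1 0 3, ?_⟩,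
    fun i => ⟨(v ⟨1, -1, i⟩).1 0 1, (v ⟨1, -1, i⟩).1 1 2, ?_⟩⟩
  · have hg : v ⟨0, ε, i⟩ ∈ elementaryGrading F ![0, 1, 0, 1] 0 := (hv ⟨0, ε, i⟩).1
    have h : ∀ k j, _ = ((ε : ℤ) : F) * _ := hs ⟨0, ε, i⟩
    refine (hupper _).trans ?_
    rw [evMat, hg 0 1 (by decide), hg 0 3 (by decide), hg 1 2 (by decide),
      hg 2 3 (by decide), ← h 0 2, ← h 1 1, ← h 0 0]
    rfl
  · have hg : v ⟨1, 1, i⟩ ∈ elementaryGrading F ![0, 1, 0, 1] 1 := (hv ⟨1, 1, i⟩).1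
    have h := hs ⟨1, 1, i⟩
    have h12 : (v ⟨1, 1, i⟩).1 1 2 = 0 := h2 _ (by simpa [superSymplecticMatrix] using (h 1 2).symm)
    have h23 : (v ⟨1, 1, i⟩).1 2 3 = 1 * (v ⟨1, 1, i⟩).1 0 1 := by
      simpa [superSymplecticMatrix] using h 0 1
    refine (hupper _).trans ?_
    rw [odMat, hg 0 0 (by decide), hg 0 2 (by decide), hg 1 1 (by decide),
      hg 1 3 (by decide), hg 2 2 (by decide), hg 3 3 (by decide), h12, h23]
  · have hg : v ⟨1, -1, i⟩ ∈ elementaryGrading F ![0, 1, 0, 1] 1 := (hv ⟨1, -1, i⟩).1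
    have h := hs ⟨1, -1, i⟩
    have h03 : (v ⟨1, -1, i⟩).1 0 3 = 0 := h2 _ (by simpa [superSymplecticMatrix] using h 0 3)
    have h23 : (v ⟨1, -1, i⟩).1 2 3 = -1 * (v ⟨1, -1, i⟩).1 0 1 := by
      simpa [superSymplecticMatrix] using h 0 1
    refine (hupper _).trans ?_
    rw [odMat, hg 0 0 (by decide), hg 0 2 (by decide), hg 1 1 (by decide),
      hg 1 3 (by decide), hg 2 2 (by decide), hg 3 3 (by decide), h03, h23]

theorem val_lift {n : ℕ} (v : StarVar → UT F n) (f : FreeStar F) :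
    (FreeAlgebra.lift F v f).1 = FreeAlgebra.lift F (fun x => (v x).1) f := by
  refine DFunLike.congr_fun (f := (UT F n).val.comp (FreeAlgebra.lift F v)) ?_ f
  ext a
  simp

/-- The generators are identities. -/
theorem generator_mem_starIdentities [CharZero F] {f : FreeStar F} (hf : IsGenerator F f) :
    f ∈ starIdentities (superSymplectic F) := by
  intro v hv
  have hv' : Admissible (superSymplectic F) v := hv
  exact Subtype.ext ((val_lift v f).trans (hv'.isMatrixAssignment.lift_generator hf))

theorem span_le_starIdentities [CharZero F] {f : FreeStar F}
    (hf : f ∈ t2StarIdealSpan {f | IsGenerator F f}) :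
    f ∈ starIdentities (superSymplectic F) := by
  rw [t2StarIdealSpan, TwoSidedIdeal.mem_sInf] at hf
  rw [← mem_identityIdeal]
  exact hf _ ⟨isT2StarIdeal_identityIdeal superSymplectic_one,
    fun g hg => mem_identityIdeal.mpr (generator_mem_starIdentities hg)⟩

end

/-! ### Substitution in the generators -/

section Substitution

variable {F : Type*} [Field F]

/-- A homogeneous element of degree `d` that is symmetric (`ε = 1`) or skew (`ε = -1`). -/
def IsHomog (d : ZMod 2) (ε : ℤˣ) (f : FreeStar F) : Prop :=
  f ∈ freeGrading F d ∧ (freeStar F).toFun f = ε • f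

theorem isHomog_ι (a : StarVar) : IsHomog a.deg a.sgn (FreeAlgebra.ι F a) :=
  ⟨ι_mem_freeGrading a, freeStar_ι a⟩

theorem isHomog_one : IsHomog 0 1 (1 : FreeStar F) :=
  ⟨SetLike.GradedOne.one_mem, by rw [freeStar_one, one_smul]⟩

/-- An additive property of homogeneous elements may be checked on symmetric and skew elements. -/
theorem homog_induction [CharZero F] {d : ZMod 2} {p : FreeStar F → Prop}
    (hp : ∀ ε f, IsHomog d ε f → p f) (hadd : ∀ f g, p f → p g → p (f + g)) {f : FreeStar F}
    (hf : f ∈ freeGrading F d) : p f := by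
  have hs := (freeStar F).map_mem d f hf
  have h : f = (2⁻¹ : F) • (f + (freeStar F).toFun f) + (2⁻¹ : F) • (f - (freeStar F).toFun f) := by
    rw [← smul_add, add_add_sub_cancel, ← two_smul F f, smul_smul, inv_mul_cancel₀ two_ne_zero,
      one_smul]
  rw [h]
  refine hadd _ _ (hp 1 _ ⟨Submodule.smul_mem _ _ (add_mem hf hs), ?_⟩)
    (hp (-1) _ ⟨Submodule.smul_mem _ _ (sub_mem hf hs), ?_⟩)
  · rw [map_smul, map_add, (freeStar F).involutive, one_smul, add_comm]
  · rw [map_smul, map_sub, (freeStar F).involutive, Units.neg_smul, one_smul, ← smul_neg, neg_sub]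

theorem isHomog_zero (d : ZMod 2) (ε : ℤˣ) : IsHomog d ε (0 : FreeStar F) :=
  ⟨zero_mem _, by rw [map_zero, smul_zero]⟩

variable {Q : Type*} [Ring Q] [Algebra F Q] {π : FreeStar F →ₐ[F] Q}

/-- All admissible substitutions in the generators map to zero. -/
def KillsGenerators (π : FreeStar F →ₐ[F] Q) : Prop :=
  ∀ f, IsGenerator F f → ∀ v, Admissible (freeStar F) v → π (FreeAlgebra.lift F v f) = 0

/-- Any homogeneous elements of the right symmetry may be substituted for the variables. -/
theorem KillsGenerators.exists_hom (hπ : KillsGenerators π) (fY fZ : ℤˣ → ℕ → FreeStar F)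
    (hY : ∀ ε i, IsHomog 0 ε (fY ε i)) (hZ : ∀ ε i, IsHomog 1 ε (fZ ε i)) :
    ∃ φ : FreeStar F →ₐ[F] Q, (∀ f, IsGenerator F f → φ f = 0) ∧
      (∀ ε i, φ (y F ε i) = π (fY ε i)) ∧ (∀ ε i, φ (z F ε i) = π (fZ ε i)) := by
  let v : StarVar → FreeStar F := fun a => if a.deg = 0 then fY a.sgn a.idx else fZ a.sgn a.idx
  have hv : Admissible (freeStar F) v := by
    intro a
    have hd : ∀ d : ZMod 2, d ≠ 0 → d = 1 := by decide
    change IsHomog a.deg a.sgn (if a.deg = 0 then fY a.sgn a.idx else fZ a.sgn a.idx)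
    split_ifs with h
    · exact h ▸ hY _ _
    · exact hd _ h ▸ hZ _ _
  refine ⟨π.comp (FreeAlgebra.lift F v), fun f hf => hπ f hf v hv, fun ε i => ?_, fun ε i => ?_⟩
  · simp [y, v]
  · simp [z, v]

/-- The assignment taking the `i`th entry of a list of elements labelled by their signs for the
variable of index `i` with that sign, and zero for all other variables. -/
def listValue (l : List (ℤˣ × FreeStar F)) (ε : ℤˣ) (i : ℕ) : FreeStar F :=
  match l[i]? with
  | some p => if p.1 = ε then p.2 else 0
  | none => 0

theorem isHomog_listValue {l : List (ℤˣ × FreeStar F)} {d : ZMod 2}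
    (hl : ∀ p ∈ l, IsHomog d p.1 p.2) (ε : ℤˣ) (i : ℕ) : IsHomog d ε (listValue l ε i) := by
  rw [listValue]
  split
  · next p hp =>
    split_ifs with h
    · exact h ▸ hl p (List.mem_of_getElem? hp)
    · exact isHomog_zero _ _
  · exact isHomog_zero _ _

theorem listValue_eq {l : List (ℤˣ × FreeStar F)} {i : ℕ} {p : ℤˣ × FreeStar F}
    (hp : l[i]? = some p) : listValue l p.1 i = p.2 := by
  simp [listValue, hp]

theorem KillsGenerators.exists_subst (hπ : KillsGenerators π) (lY lZ : List (ℤˣ × FreeStar F))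
    (hY : ∀ p ∈ lY, IsHomog 0 p.1 p.2) (hZ : ∀ p ∈ lZ, IsHomog 1 p.1 p.2) :
    ∃ φ : FreeStar F →ₐ[F] Q, (∀ f, IsGenerator F f → φ f = 0) ∧
      (∀ i p, lY[i]? = some p → φ (y F p.1 i) = π p.2) ∧
      (∀ i p, lZ[i]? = some p → φ (z F p.1 i) = π p.2) := by
  obtain ⟨φ, hφ, h1, h2⟩ := hπ.exists_hom (listValue lY) (listValue lZ) (isHomog_listValue hY)
    (isHomog_listValue hZ)
  exact ⟨φ, hφ, fun i p hp => by rw [h1, listValue_eq hp],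
    fun i p hp => by rw [h2, listValue_eq hp]⟩

/-- The image of a word. -/
def word (π : FreeStar F →ₐ[F] Q) (L : List StarVar) : Q := π (mono F L)

theorem word_nil : word π [] = 1 := by simp [word, mono]

theorem word_append (L L' : List StarVar) : word π (L ++ L') = word π L * word π L' := by
  simp [word, mono_append]

theorem word_cons (a : StarVar) (L : List StarVar) : word π (a :: L) = word π [a] * word π L :=
  word_append [a] L

theorem word_eq_prod (L : List StarVar) :
    word π L = (L.map fun a => π (FreeAlgebra.ι F a)).prod := by
  simp [word, mono, map_list_prod, Function.comp_def]

theorem word_singleton (a : StarVar) : word π [a] = π (FreeAlgebra.ι F a) := by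
  simp [word_eq_prod]

theorem exists_perm_of_perm {α : Type*} {L L' : List α} (h : L.Perm L') :
    ∃ σ : Equiv.Perm (Fin L.length), L' = List.ofFn fun i => L[σ i] := by
  have h1 : List.Forall₂ (fun (i : Fin L.length) a => L[i] = a) (List.finRange L.length) L := by
    rw [List.forall₂_iff_get]
    refine ⟨by simp, fun i hi hi' => by simp⟩
  have h2 : Relation.Comp (List.Forall₂ fun (i : Fin L.length) a => L[i] = a) List.Perm
      (List.finRange L.length) L' := ⟨L, h1, h⟩
  rw [List.forall₂_comp_perm_eq_perm_comp_forall₂] at h2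
  obtain ⟨P, hP, hP'⟩ := h2
  have hlen : P.length = L.length := by simpa using hP.length_eq.symm
  have hnd : P.Nodup := hP.nodup_iff.mp (List.nodup_finRange _)
  have hmem : ∀ i, i ∈ P := fun i => hP.mem_iff.mp (List.mem_finRange i)
  rw [List.forall₂_iff_get] at hP'
  refine ⟨(finCongr hlen.symm).trans (hnd.getEquivOfForallMemList P hmem), ?_⟩
  refine List.ext_getElem (by simp [← hP'.1, hlen]) fun i hi hi' => ?_
  have := hP'.2 i (by omega) hi
  simp only [List.get_eq_getElem] at this
  simp [← this]

/-- The product of the signs of the letters of a word, as a scalar. -/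
def sg (F : Type*) [Field F] (L : List StarVar) : F := ((sgnProd L : ℤ) : F)

theorem sg_mul_self (L : List StarVar) : sg F L * sg F L = 1 := sgn_mul_self _

theorem sg_append (L L' : List StarVar) : sg F (L ++ L') = sg F L * sg F L' := by
  simp [sg, sgnProd]

theorem sg_cons (a : StarVar) (L : List StarVar) :
    sg F (a :: L) = ((a.sgn : ℤ) : F) * sg F L := by
  simp [sg, sgnProd]

theorem sg_nil : sg F [] = 1 := by simp [sg, sgnProd]

theorem sg_perm {L L' : List StarVar} (h : L.Perm L') : sg F L = sg F L' := by
  rw [sg, sg, sgnProd_perm h]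

/-- The variant of `KillsGenerators.exists_hom` in which `w₁, …, w_k` are replaced by the letters
of a word. -/
theorem KillsGenerators.exists_hom_word (hπ : KillsGenerators π) {L : List StarVar}
    (hL : IsEven L) (fZ : ℤˣ → ℕ → FreeStar F) (hZ : ∀ ε i, IsHomog 1 ε (fZ ε i)) :
    ∃ (φ : FreeStar F →ₐ[F] Q) (k : ℕ) (ε : Fin k → ℤˣ), (∀ f, IsGenerator F f → φ f = 0) ∧
      ((((-1 : ℤˣ) ^ skewCount ε : ℤˣ) : ℤ) : F) = sg F L ∧
      φ (w F ε 1) = word π L ∧ φ (wRev F ε 1) = word π L.reverse ∧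
      (∀ L', L.Perm L' → ∃ σ, φ (w F ε σ) = word π L' ∧ φ (wRev F ε σ) = word π L'.reverse) ∧
      (∀ ε i, φ (z F ε i) = π (fZ ε i)) := by
  obtain ⟨φ, hφ, h1, h2⟩ := hπ.exists_hom
    (listValue ((1, 1) :: L.map fun a => (a.sgn, FreeAlgebra.ι F a))) fZ
    (isHomog_listValue <| by
      simp only [List.mem_cons, List.mem_map]
      rintro _ (rfl | ⟨a, ha, rfl⟩)
      · exact isHomog_one
      · have := isHomog_ι (F := F) a
        rwa [hL a ha] at this) hZ
  have hy : ∀ i : Fin L.length, φ (y F L[i].sgn (i + 1)) = π (FreeAlgebra.ι F L[i]) := fun i =>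
    (h1 L[i].sgn (i + 1)).trans
      (congrArg π (listValue_eq (p := (L[i].sgn, FreeAlgebra.ι F L[i])) (by simp)))
  have hlist : ∀ σ : Equiv.Perm (Fin L.length), (wList F (fun i => L[i].sgn) σ).map φ =
      (List.ofFn fun i => L[σ i]).map fun a => π (FreeAlgebra.ι F a) := by
    intro σ
    simp only [wList, List.map_ofFn]
    congr 1
    funext i
    exact hy (σ i)
  have hw : ∀ σ : Equiv.Perm (Fin L.length), φ (w F (fun i => L[i].sgn) σ) =
      word π (List.ofFn fun i => L[σ i]) := by
    intro σ
    rw [w, map_list_prod, hlist, word_eq_prod]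
  have hwr : ∀ σ : Equiv.Perm (Fin L.length), φ (wRev F (fun i => L[i].sgn) σ) =
      word π (List.ofFn fun i => L[σ i]).reverse := by
    intro σ
    rw [wRev, map_list_prod, List.map_reverse, hlist, word_eq_prod, List.map_reverse]
  have hone : (List.ofFn fun i => L[(1 : Equiv.Perm (Fin L.length)) i]) = L := by simp
  refine ⟨φ, L.length, fun i => L[i].sgn, hφ, ?_, ?_, ?_, fun L' hp => ?_, h2⟩
  · have h : (List.ofFn fun i : Fin L.length => L[i].sgn) = L.map StarVar.sgn := by
      conv_rhs => rw [← List.ofFn_getElem (xs := L), List.map_ofFn]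
      rfl
    rw [neg_one_pow_skewCount, sg, sgnProd, wWord, List.map_ofFn, sgnProd, ← h]
    rfl
  · rw [hw, hone]
  · rw [hwr, hone]
  · obtain ⟨σ, rfl⟩ := exists_perm_of_perm hp
    exact ⟨σ, hw σ, hwr σ⟩

theorem KillsGenerators.exists_subst_word (hπ : KillsGenerators π) {L : List StarVar}
    (hL : IsEven L) (lZ : List (ℤˣ × FreeStar F)) (hZ : ∀ p ∈ lZ, IsHomog 1 p.1 p.2) :
    ∃ (φ : FreeStar F →ₐ[F] Q) (k : ℕ) (ε : Fin k → ℤˣ), (∀ f, IsGenerator F f → φ f = 0) ∧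
      ((((-1 : ℤˣ) ^ skewCount ε : ℤˣ) : ℤ) : F) = sg F L ∧
      φ (w F ε 1) = word π L ∧ φ (wRev F ε 1) = word π L.reverse ∧
      (∀ L', L.Perm L' → ∃ σ, φ (w F ε σ) = word π L' ∧ φ (wRev F ε σ) = word π L'.reverse) ∧
      (∀ i p, lZ[i]? = some p → φ (z F p.1 i) = π p.2) := by
  obtain ⟨φ, k, ε, h1, h2, h3, h4, h5, h6⟩ :=
    hπ.exists_hom_word hL (listValue lZ) (isHomog_listValue hZ)
  exact ⟨φ, k, ε, h1, h2, h3, h4, h5, fun i p hp => by rw [h6, listValue_eq hp]⟩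

end Substitution

/-! ### Consequences of the generators -/

section Relations

variable {F : Type*} [Field F] {Q : Type*} [Ring Q] [Algebra F Q] {π : FreeStar F →ₐ[F] Q}

theorem mono_mem {L : List StarVar} {d : ZMod 2} (h : wordDeg L = d) :
    mono F L ∈ freeGrading F d := h ▸ mono_mem_freeGrading L

theorem IsEven.wordDeg {L : List StarVar} (h : IsEven L) : wordDeg L = 0 := by
  induction L with
  | nil => rfl
  | cons a L ih =>
    rw [IsEven.cons_iff] at h
    rw [wordDeg_cons, h.1, ih h.2, add_zero]

theorem wordDeg_even_append {L L' : List StarVar} (h : IsEven L) :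
    wordDeg (L ++ L') = wordDeg L' := by
  rw [wordDeg_append, h.wordDeg, zero_add]

theorem wordDeg_append_even {L L' : List StarVar} (h : IsEven L') :
    wordDeg (L ++ L') = wordDeg L := by
  rw [wordDeg_append, h.wordDeg, add_zero]

theorem isHomog_letter {a : StarVar} {d : ZMod 2} {ε : ℤˣ} (hd : a.deg = d) (hs : a.sgn = ε) :
    IsHomog d ε (FreeAlgebra.ι F a) := by
  subst hd hs
  exact isHomog_ι a

theorem odd_induction₂ [CharZero F] {p : FreeStar F → FreeStar F → Prop}
    (hp : ∀ ε₁ ε₂ f₁ f₂, IsHomog 1 ε₁ f₁ → IsHomog 1 ε₂ f₂ → p f₁ f₂)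
    (h₁ : ∀ f g a, p f a → p g a → p (f + g) a) (h₂ : ∀ f g a, p a f → p a g → p a (f + g))
    {f₁ f₂ : FreeStar F} (hf₁ : f₁ ∈ freeGrading F 1) (hf₂ : f₂ ∈ freeGrading F 1) : p f₁ f₂ :=
  homog_induction (p := fun f => p f f₂)
    (fun ε f hf => homog_induction (p := fun g => p f g) (fun ε' f' hf' => hp ε ε' f f' hf hf')
      (fun _ _ => h₂ _ _ _) hf₂) (fun _ _ => h₁ _ _ _) hf₁

theorem odd_induction₃ [CharZero F] {p : FreeStar F → FreeStar F → FreeStar F → Prop}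
    (hp : ∀ ε₁ ε₂ ε₃ f₁ f₂ f₃, IsHomog 1 ε₁ f₁ → IsHomog 1 ε₂ f₂ → IsHomog 1 ε₃ f₃ → p f₁ f₂ f₃)
    (h₁ : ∀ f g a b, p f a b → p g a b → p (f + g) a b)
    (h₂ : ∀ f g a b, p a f b → p a g b → p a (f + g) b)
    (h₃ : ∀ f g a b, p a b f → p a b g → p a b (f + g))
    {f₁ f₂ f₃ : FreeStar F} (hf₁ : f₁ ∈ freeGrading F 1) (hf₂ : f₂ ∈ freeGrading F 1)
    (hf₃ : f₃ ∈ freeGrading F 1) : p f₁ f₂ f₃ :=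
  homog_induction (p := fun f => p f f₂ f₃)
    (fun ε f hf => odd_induction₂ (p := p f) (fun ε' ε'' f' f'' => hp ε ε' ε'' f f' f'' hf)
      (fun _ _ _ => h₂ _ _ _ _) (fun _ _ _ => h₃ _ _ _ _) hf₂ hf₃) (fun _ _ => h₁ _ _ _ _) hf₁

namespace KillsGenerators

theorem word_odd_odd [CharZero F] (hπ : KillsGenerators π) {L L' : List StarVar}
    (hL : IsEven L) (hp : L.Perm L') {f g : FreeStar F}
    (hf : f ∈ freeGrading F 1) (hg : g ∈ freeGrading F 1) :
    word π L * π f * π g = word π L' * π f * π g := by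
  refine odd_induction₂ (p := fun f g => word π L * π f * π g = word π L' * π f * π g)
    (fun ε₁ ε₂ f g hf hg => ?_) (fun f g a h h' => by simp only [map_add, mul_add, add_mul, h, h'])
    (fun f g a h h' => by simp only [map_add, mul_add, h, h']) hf hg
  obtain ⟨φ, k, ε, hφ, -, hw, -, hp', hz⟩ := hπ.exists_subst_word hL
    [(1, 0), (ε₁, f), (ε₂, g)] (by simp [hf, hg, isHomog_zero])
  obtain ⟨σ, hσ, -⟩ := hp' L' hp
  have h := hφ _ (.perm_z_z k ε σ ε₁ ε₂)
  rw [map_sub, map_mul, map_mul, map_mul, map_mul, hσ, hw, hz 1 (ε₁, f) rfl,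
    hz 2 (ε₂, g) rfl] at h
  exact (sub_eq_zero.mp h).symm

theorem odd_word_odd [CharZero F] (hπ : KillsGenerators π) {L L' : List StarVar}
    (hL : IsEven L) (hp : L.Perm L') {f g : FreeStar F}
    (hf : f ∈ freeGrading F 1) (hg : g ∈ freeGrading F 1) :
    π f * word π L * π g = π f * word π L' * π g := by
  refine odd_induction₂ (p := fun f g => π f * word π L * π g = π f * word π L' * π g)
    (fun ε₁ ε₂ f g hf hg => ?_) (fun f g a h h' => by simp only [map_add, add_mul, h, h'])
    (fun f g a h h' => by simp only [map_add, mul_add, h, h']) hf hg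
  obtain ⟨φ, k, ε, hφ, -, hw, -, hp', hz⟩ := hπ.exists_subst_word hL
    [(1, 0), (ε₁, f), (ε₂, g)] (by simp [hf, hg, isHomog_zero])
  obtain ⟨σ, hσ, -⟩ := hp' L' hp
  have h := hφ _ (.z_perm_z k ε σ ε₁ ε₂)
  rw [map_sub, map_mul, map_mul, map_mul, map_mul, hσ, hw, hz 1 (ε₁, f) rfl,
    hz 2 (ε₂, g) rfl] at h
  exact (sub_eq_zero.mp h).symm

theorem odd_odd_word [CharZero F] (hπ : KillsGenerators π) {L L' : List StarVar}
    (hL : IsEven L) (hp : L.Perm L') {f g : FreeStar F}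
    (hf : f ∈ freeGrading F 1) (hg : g ∈ freeGrading F 1) :
    π f * π g * word π L = π f * π g * word π L' := by
  refine odd_induction₂ (p := fun f g => π f * π g * word π L = π f * π g * word π L')
    (fun ε₁ ε₂ f g hf hg => ?_) (fun f g a h h' => by simp only [map_add, add_mul, h, h'])
    (fun f g a h h' => by simp only [map_add, mul_add, add_mul, h, h']) hf hg
  obtain ⟨φ, k, ε, hφ, -, hw, -, hp', hz⟩ := hπ.exists_subst_word hL
    [(1, 0), (ε₁, f), (ε₂, g)] (by simp [hf, hg, isHomog_zero])
  obtain ⟨σ, hσ, -⟩ := hp' L' hp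
  have h := hφ _ (.z_z_perm k ε σ ε₁ ε₂)
  rw [map_sub, map_mul, map_mul, map_mul, map_mul, hσ, hw, hz 1 (ε₁, f) rfl,
    hz 2 (ε₂, g) rfl] at h
  exact (sub_eq_zero.mp h).symm

theorem odd_odd_word_odd [CharZero F] (hπ : KillsGenerators π) {L : List StarVar}
    (hL : IsEven L) {f g k : FreeStar F} (hf : f ∈ freeGrading F 1) (hg : g ∈ freeGrading F 1)
    (hk : k ∈ freeGrading F 1) :
    π f * π g * word π L * π k = sg F L • (π f * word π L * π g * π k) := by
  refine odd_induction₃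
    (p := fun f g k => π f * π g * word π L * π k = sg F L • (π f * word π L * π g * π k))
    (fun ε₁ ε₂ ε₃ f g k hf hg hk => ?_)
    (fun f g a b h h' => by simp only [map_add, add_mul, h, h', smul_add])
    (fun f g a b h h' => by simp only [map_add, add_mul, mul_add, h, h', smul_add])
    (fun f g a b h h' => by simp only [map_add, mul_add, h, h', smul_add]) hf hg hk
  obtain ⟨φ, m, ε, hφ, hs, hw, -, -, hz⟩ := hπ.exists_subst_word hL
    [(1, 0), (ε₁, f), (ε₂, g), (ε₃, k)] (by simp [hf, hg, hk, isHomog_zero])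
  have h := hφ _ (.zz_w_z m ε ε₁ ε₂ ε₃)
  rw [map_sub, neg_one_pow_mul_eq_smul (F := F), map_smul, hs] at h
  simp only [map_mul, hw, hz 1 (ε₁, f) rfl, hz 2 (ε₂, g) rfl, hz 3 (ε₃, k) rfl] at h
  exact sub_eq_zero.mp h

theorem odd_odd_odd_word [CharZero F] (hπ : KillsGenerators π) {L : List StarVar}
    (hL : IsEven L) {f g k : FreeStar F} (hf : f ∈ freeGrading F 1) (hg : g ∈ freeGrading F 1)
    (hk : k ∈ freeGrading F 1) :
    π f * π g * π k * word π L = sg F L • (word π L * π f * π g * π k) := by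
  refine odd_induction₃
    (p := fun f g k => π f * π g * π k * word π L = sg F L • (word π L * π f * π g * π k))
    (fun ε₁ ε₂ ε₃ f g k hf hg hk => ?_)
    (fun f g a b h h' => by simp only [map_add, add_mul, mul_add, h, h', smul_add])
    (fun f g a b h h' => by simp only [map_add, add_mul, mul_add, h, h', smul_add])
    (fun f g a b h h' => by simp only [map_add, add_mul, mul_add, h, h', smul_add]) hf hg hk
  obtain ⟨φ, m, ε, hφ, hs, hw, -, -, hz⟩ := hπ.exists_subst_word hL
    [(1, 0), (ε₁, f), (ε₂, g), (ε₃, k)] (by simp [hf, hg, hk, isHomog_zero])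
  have h := hφ _ (.w_zzz m ε ε₁ ε₂ ε₃)
  rw [map_sub, neg_one_pow_mul_eq_smul (F := F), map_smul, hs] at h
  simp only [map_mul, hw, hz 1 (ε₁, f) rfl, hz 2 (ε₂, g) rfl, hz 3 (ε₃, k) rfl] at h
  exact (sub_eq_zero.mp h).symm

theorem odd_odd_odd_odd [CharZero F] (hπ : KillsGenerators π) {f g k l : FreeStar F}
    (hf : f ∈ freeGrading F 1) (hg : g ∈ freeGrading F 1) (hk : k ∈ freeGrading F 1)
    (hl : l ∈ freeGrading F 1) : π f * π g * π k * π l = 0 := by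
  refine homog_induction (p := fun l => π f * π g * π k * π l = 0) (fun ε₄ l hl => ?_)
    (fun f g h h' => by simp only [map_add, mul_add, h, h', add_zero]) hl
  refine odd_induction₃ (p := fun f g k => π f * π g * π k * π l = 0)
    (fun ε₁ ε₂ ε₃ f g k hf hg hk => ?_)
    (fun f g a b h h' => by simp only [map_add, add_mul, h, h', add_zero])
    (fun f g a b h h' => by simp only [map_add, add_mul, mul_add, h, h', add_zero])
    (fun f g a b h h' => by simp only [map_add, add_mul, mul_add, h, h', add_zero]) hf hg hk
  obtain ⟨φ, hφ, -, hz⟩ := hπ.exists_subst []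
    [(1, 0), (ε₁, f), (ε₂, g), (ε₃, k), (ε₄, l)] (by simp) (by simp [hf, hg, hk, hl, isHomog_zero])
  have h := hφ _ (.zzzz ε₁ ε₂ ε₃ ε₄)
  simpa only [map_mul, hz 1 (ε₁, f) rfl, hz 2 (ε₂, g) rfl, hz 3 (ε₃, k) rfl,
    hz 4 (ε₄, l) rfl] using h

/-- Rearranging an even word on the left of an odd letter amounts to rearranging the reversed word
on its right. -/
theorem word_sub_mul_letter (hπ : KillsGenerators π) {L L' : List StarVar}
    (hL : IsEven L) (hp : L.Perm L') {a : StarVar} (ha : a.deg = 1) :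
    (word π L - word π L') * word π [a] =
      (((a.sgn : ℤ) : F) * sg F L) • (word π [a] * (word π L.reverse - word π L'.reverse)) := by
  obtain ⟨φ, m, ε, hφ, hs, hw, hwr, hp', hz⟩ := hπ.exists_subst_word hL
    [(a.sgn, FreeAlgebra.ι F a)] (by simp [isHomog_letter ha rfl])
  obtain ⟨σ, hσ, hσ'⟩ := hp' L' hp
  have hz0 := hz 0 (a.sgn, FreeAlgebra.ι F a) rfl
  rw [← word_singleton] at hz0
  rcases Int.units_eq_one_or a.sgn with h1 | h1 <;> simp only [h1] at hz0 ⊢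
  · have h := hφ _ (.perm_zpos m ε σ)
    rw [neg_one_pow_succ_mul_eq_smul (F := F), map_add, map_smul, hs] at h
    simp only [map_mul, map_sub, hz0, hw, hwr, hσ, hσ'] at h
    rw [neg_smul, ← sub_eq_add_neg] at h
    simpa using sub_eq_zero.mp h
  · have h := hφ _ (.perm_zneg m ε σ)
    rw [neg_one_pow_mul_eq_smul (F := F), map_add, map_smul, hs] at h
    simp only [map_mul, map_sub, hz0, hw, hwr, hσ, hσ'] at h
    simpa [neg_smul] using eq_neg_of_add_eq_zero_left h

theorem exists_hom_word_neg_pos (hπ : KillsGenerators π) {L : List StarVar} (hL : IsEven L)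
    {a b : StarVar} (ha : a.deg = 1) (hb : b.deg = 1) (ha' : a.sgn = -1) (hb' : b.sgn = 1) :
    ∃ (φ : FreeStar F →ₐ[F] Q) (k : ℕ) (ε : Fin k → ℤˣ), (∀ f, IsGenerator F f → φ f = 0) ∧
      ((((-1 : ℤˣ) ^ skewCount ε : ℤˣ) : ℤ) : F) = sg F L ∧ φ (w F ε 1) = word π L ∧
      φ (z F (-1) 0) = word π [a] ∧ φ (z F 1 0) = word π [b] := by
  obtain ⟨φ, k, ε, hφ, hs, hw, -, -, hz⟩ := hπ.exists_hom_word hL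
    (fun ε _ => if ε = 1 then FreeAlgebra.ι F b else FreeAlgebra.ι F a) (by
      intro ε i
      rcases Int.units_eq_one_or ε with rfl | rfl
      · simpa using isHomog_letter hb hb'
      · simpa using isHomog_letter ha ha')
  refine ⟨φ, k, ε, hφ, hs, hw, ?_, ?_⟩
  · rw [hz, word_singleton, if_neg (by decide)]
  · rw [hz, word_singleton, if_pos rfl]

theorem neg_word_pos (hπ : KillsGenerators π) {L : List StarVar} (hL : IsEven L) {a b : StarVar}
    (ha : a.deg = 1) (hb : b.deg = 1) (ha' : a.sgn = -1) (hb' : b.sgn = 1) :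
    word π [a] * word π L * word π [b] = sg F L • (word π L * word π [a] * word π [b]) := by
  obtain ⟨φ, m, ε, hφ, hs, hw, hza, hzb⟩ := hπ.exists_hom_word_neg_pos hL ha hb ha' hb'
  have h := hφ _ (.zneg_w_zpos m ε)
  rw [neg_one_pow_succ_mul_eq_smul (F := F), map_add, map_smul, hs] at h
  simp only [map_mul, hza, hzb, hw] at h
  rw [neg_smul, ← sub_eq_add_neg] at h
  exact sub_eq_zero.mp h

theorem pos_word_neg (hπ : KillsGenerators π) {L : List StarVar} (hL : IsEven L) {a b : StarVar}
    (ha : a.deg = 1) (hb : b.deg = 1) (ha' : a.sgn = -1) (hb' : b.sgn = 1) :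
    word π [b] * word π L * word π [a] = sg F L • (word π [b] * word π [a] * word π L) := by
  obtain ⟨φ, m, ε, hφ, hs, hw, hza, hzb⟩ := hπ.exists_hom_word_neg_pos hL ha hb ha' hb'
  have h := hφ _ (.zpos_w_zneg m ε)
  rw [neg_one_pow_succ_mul_eq_smul (F := F), map_add, map_smul, hs] at h
  simp only [map_mul, hza, hzb, hw] at h
  rw [neg_smul, ← sub_eq_add_neg] at h
  exact sub_eq_zero.mp h

theorem pos_even_pos [CharZero F] (hπ : KillsGenerators π) {f : FreeStar F}
    (hf : f ∈ freeGrading F 0) {a b : StarVar} (ha : a.deg = 1) (hb : b.deg = 1) (ha' : a.sgn = 1)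
    (hb' : b.sgn = 1) : word π [a] * π f * word π [b] = 0 := by
  refine homog_induction (p := fun f => word π [a] * π f * word π [b] = 0) (fun ε f hf => ?_)
    (fun f g h h' => by simp only [map_add, mul_add, add_mul, h, h', add_zero]) hf
  obtain ⟨φ, hφ, hy, hz⟩ := hπ.exists_subst [(ε, f)]
    [(1, 0), (1, FreeAlgebra.ι F a), (1, FreeAlgebra.ι F b)] (by simp [hf])
    (by simp [isHomog_letter ha ha', isHomog_letter hb hb', isHomog_zero])
  have h := hφ _ (.zpos_y_zpos ε)
  simpa only [map_mul, hy 0 (ε, f) rfl, hz 1 (1, FreeAlgebra.ι F a) rfl,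
    hz 2 (1, FreeAlgebra.ι F b) rfl, ← word_singleton] using h

theorem letter_odd_letter [CharZero F] (hπ : KillsGenerators π) {f : FreeStar F}
    (hf : f ∈ freeGrading F 1) {a b : StarVar} (ha : a.deg = 1) (hb : b.deg = 1)
    (hab : a.sgn = b.sgn) : word π [a] * π f * word π [b] = word π [b] * π f * word π [a] := by
  refine homog_induction
    (p := fun f => word π [a] * π f * word π [b] = word π [b] * π f * word π [a])
    (fun ε f hf => ?_) (fun f g h h' => by simp only [map_add, mul_add, add_mul, h, h']) hf
  have hA := isHomog_letter (F := F) ha rfl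
  have hB := isHomog_letter (F := F) hb hab.symm
  obtain ⟨φ, hφ, -, hz⟩ := hπ.exists_subst []
    [(1, 0), (a.sgn, FreeAlgebra.ι F a), (ε, f), (a.sgn, FreeAlgebra.ι F b)] (by simp)
    (by simp [hA, hB, hf, isHomog_zero])
  have h1 := hz 1 (a.sgn, FreeAlgebra.ι F a) rfl
  have h2 := hz 2 (ε, f) rfl
  have h3 := hz 3 (a.sgn, FreeAlgebra.ι F b) rfl
  rcases Int.units_eq_one_or a.sgn with hs | hs <;> simp only [hs] at h1 h3
  · have h := hφ _ (.zpos_swap ε)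
    simp only [map_sub, map_mul, h1, h2, h3, ← word_singleton] at h
    exact sub_eq_zero.mp h
  · have h := hφ _ (.zneg_swap ε)
    simp only [map_sub, map_mul, h1, h2, h3, ← word_singleton] at h
    exact sub_eq_zero.mp h

theorem neg_even_neg_pos [CharZero F] (hπ : KillsGenerators π) {f : FreeStar F}
    (hf : f ∈ freeGrading F 0) {a b c : StarVar} (ha : a.deg = 1) (hb : b.deg = 1) (hc : c.deg = 1)
    (ha' : a.sgn = -1) (hb' : b.sgn = 1) (hc' : c.sgn = -1) :
    word π [a] * π f * word π [c] * word π [b] =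
      -(word π [b] * π f * word π [c] * word π [a]) := by
  refine homog_induction
    (p := fun f => word π [a] * π f * word π [c] * word π [b] =
      -(word π [b] * π f * word π [c] * word π [a]))
    (fun ε f hf => ?_)
    (fun f g h h' => by simp only [map_add, mul_add, add_mul, h, h', neg_add]) hf
  obtain ⟨φ, hφ, hy, hz⟩ := hπ.exists_subst [(1, 0), (1, 0), (ε, f), (1, 0), (1, 1)]
    [(1, 0), (-1, FreeAlgebra.ι F a), (1, 0), (-1, FreeAlgebra.ι F c), (1, 0),
      (1, FreeAlgebra.ι F b)] (by simp [hf, isHomog_zero, isHomog_one])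
    (by simp [isHomog_letter ha ha', isHomog_letter hb hb', isHomog_letter hc hc', isHomog_zero])
  -- the second even variable is specialised to `1`
  have h := hφ _ (.zneg_zneg_zpos ε 1)
  simp only [map_add, map_mul, hy 2 (ε, f) rfl, hy 4 (1, 1) rfl, hz 1 (-1, FreeAlgebra.ι F a) rfl,
    hz 3 (-1, FreeAlgebra.ι F c) rfl, hz 5 (1, FreeAlgebra.ι F b) rfl, ← word_singleton, map_one,
    mul_one] at h
  exact eq_neg_of_add_eq_zero_left h

theorem neg_even_pos_even_neg [CharZero F] (hπ : KillsGenerators π) {f g : FreeStar F}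
    (hf : f ∈ freeGrading F 0) (hg : g ∈ freeGrading F 0) {a b c : StarVar} (ha : a.deg = 1)
    (hb : b.deg = 1) (hc : c.deg = 1) (ha' : a.sgn = -1) (hb' : b.sgn = -1) (hc' : c.sgn = 1) :
    word π [a] * π f * word π [c] * π g * word π [b] = 0 := by
  refine homog_induction (p := fun f => word π [a] * π f * word π [c] * π g * word π [b] = 0)
    (fun ε f hf => ?_)
    (fun f g h h' => by simp only [map_add, mul_add, add_mul, h, h', add_zero]) hf
  refine homog_induction (p := fun g => word π [a] * π f * word π [c] * π g * word π [b] = 0)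
    (fun ε' g hg => ?_)
    (fun f g h h' => by simp only [map_add, mul_add, add_mul, h, h', add_zero]) hg
  obtain ⟨φ, hφ, hy, hz⟩ := hπ.exists_subst [(1, 0), (1, 0), (1, 0), (1, 0), (ε, f), (ε', g)]
    [(1, 0), (-1, FreeAlgebra.ι F a), (1, FreeAlgebra.ι F c), (-1, FreeAlgebra.ι F b)]
    (by simp [hf, hg, isHomog_zero])
    (by simp [isHomog_letter ha ha', isHomog_letter hb hb', isHomog_letter hc hc', isHomog_zero])
  have h := hφ _ (.zneg_zpos_zneg ε ε')
  simpa only [map_mul, hy 4 (ε, f) rfl, hy 5 (ε', g) rfl, hz 1 (-1, FreeAlgebra.ι F a) rfl,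
    hz 2 (1, FreeAlgebra.ι F c) rfl, hz 3 (-1, FreeAlgebra.ι F b) rfl, ← word_singleton] using h

theorem comm_letters_mul [CharZero F] (hπ : KillsGenerators π) {a b c d : StarVar}
    (ha : a.deg = 0) (hb : b.deg = 0) (hc : c.deg = 0) (hd : d.deg = 0) (L : List StarVar) :
    (word π [a, b] - word π [b, a]) * word π L * (word π [c, d] - word π [d, c]) = 0 := by
  have hL := mono_mem_freeGrading (F := F) L
  change _ * π (mono F L) * _ = _
  generalize wordDeg L = e at hL
  refine homog_induction
    (p := fun f => (word π [a, b] - word π [b, a]) * π f * (word π [c, d] - word π [d, c]) = 0)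
    (fun ε f hf => ?_)
    (fun f g h h' => by simp only [map_add, mul_add, add_mul, h, h', add_zero]) hL
  have key : ∀ (φ : FreeStar F →ₐ[F] Q), (∀ f, IsGenerator F f → φ f = 0) →
      φ (y F a.sgn 1) = π (FreeAlgebra.ι F a) → φ (y F b.sgn 2) = π (FreeAlgebra.ι F b) →
      φ (y F c.sgn 3) = π (FreeAlgebra.ι F c) → φ (y F d.sgn 4) = π (FreeAlgebra.ι F d) →
      φ (x F e ε 0) = π f →
      (word π [a, b] - word π [b, a]) * π f * (word π [c, d] - word π [d, c]) = 0 := by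
    intro φ hφ h1 h2 h3 h4 h0
    have h := hφ _ (.comm_x_comm a.sgn b.sgn c.sgn d.sgn ε e)
    simpa only [map_mul, map_sub, comm_cons, comm_nil, h1, h2, h3, h4, h0,
      word_cons (_ : StarVar) [_], ← word_singleton] using h
  have hA := isHomog_letter (F := F) ha rfl
  have hB := isHomog_letter (F := F) hb rfl
  have hC := isHomog_letter (F := F) hc rfl
  have hD := isHomog_letter (F := F) hd rfl
  have he : ∀ e : ZMod 2, e = 0 ∨ e = 1 := by decide
  rcases he e with rfl | rfl
  · obtain ⟨φ, hφ, hy, -⟩ := hπ.exists_subst [(ε, f), (a.sgn, FreeAlgebra.ι F a),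
      (b.sgn, FreeAlgebra.ι F b), (c.sgn, FreeAlgebra.ι F c), (d.sgn, FreeAlgebra.ι F d)] []
      (by simp [hf, hA, hB, hC, hD]) (by simp)
    exact key φ hφ (hy 1 _ rfl) (hy 2 _ rfl) (hy 3 _ rfl) (hy 4 _ rfl) (hy 0 _ rfl)
  · obtain ⟨φ, hφ, hy, hz⟩ := hπ.exists_subst [(1, 0), (a.sgn, FreeAlgebra.ι F a),
      (b.sgn, FreeAlgebra.ι F b), (c.sgn, FreeAlgebra.ι F c), (d.sgn, FreeAlgebra.ι F d)] [(ε, f)]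
      (by simp [isHomog_zero, hA, hB, hC, hD]) (by simp [hf])
    exact key φ hφ (hy 1 _ rfl) (hy 2 _ rfl) (hy 3 _ rfl) (hy 4 _ rfl) (hz 0 _ rfl)

/-- Even letters commute up to their sign with `[y₁, y₂] f`, for every odd element `f`. -/
theorem comm_letters_odd_letter [CharZero F] (hπ : KillsGenerators π) {a b c : StarVar}
    (ha : a.deg = 0) (hb : b.deg = 0) (hc : c.deg = 0) {f : FreeStar F}
    (hf : f ∈ freeGrading F 1) :
    (word π [a, b] - word π [b, a]) * π f * word π [c] =
      ((c.sgn : ℤ) : F) • (word π [c] * (word π [a, b] - word π [b, a]) * π f) := by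
  refine homog_induction
    (p := fun f => (word π [a, b] - word π [b, a]) * π f * word π [c] =
      ((c.sgn : ℤ) : F) • (word π [c] * (word π [a, b] - word π [b, a]) * π f))
    (fun ε f hf => ?_)
    (fun f g h h' => by simp only [map_add, mul_add, add_mul, h, h', smul_add]) hf
  have hA := isHomog_letter (F := F) ha rfl
  have hB := isHomog_letter (F := F) hb rfl
  have hC := isHomog_letter (F := F) hc rfl
  obtain ⟨φ, hφ, hy, hz⟩ := hπ.exists_subst [(c.sgn, FreeAlgebra.ι F c), (a.sgn, FreeAlgebra.ι F a),
    (b.sgn, FreeAlgebra.ι F b)] [(ε, f)] (by simp [hA, hB, hC]) (by simp [hf])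
  have h0 := hy 0 (c.sgn, FreeAlgebra.ι F c) rfl
  have h1 := hy 1 (a.sgn, FreeAlgebra.ι F a) rfl
  have h2 := hy 2 (b.sgn, FreeAlgebra.ι F b) rfl
  have h3 := hz 0 (ε, f) rfl
  rw [word_cons a [b], word_cons b [a]]
  rcases Int.units_eq_one_or c.sgn with hs | hs <;> simp only [hs] at h0 ⊢
  -- only the commutators of length two are needed
  · have h := hφ _ (.comm_z_ypos a.sgn b.sgn ε 0 ![])
    simp only [tailList, List.ofFn_zero, comm_cons, comm_nil, map_mul, map_sub, h0, h1, h2, h3,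
      ← word_singleton] at h
    simpa using sub_eq_zero.mp h
  · have h := hφ _ (.comm_z_yneg a.sgn b.sgn ε 0 ![])
    simp only [tailList, List.ofFn_zero, comm_cons, comm_nil, map_mul, map_sub, map_add, h0, h1, h2,
      h3, ← word_singleton] at h
    simpa using eq_neg_of_add_eq_zero_left h

end KillsGenerators

end Relations

/-! ### The commutator ideal of the even words, and rearrangements between odd letters -/

section Rearrangement

variable {F : Type*} [Field F] {Q : Type*} [Ring Q] [Algebra F Q] {π : FreeStar F →ₐ[F] Q}

/-- The image of the commutator ideal of the algebra generated by the even letters. -/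
def commSpan (π : FreeStar F →ₐ[F] Q) : Submodule F Q :=
  Submodule.span F {q | ∃ U a b V, IsEven U ∧ a.deg = 0 ∧ b.deg = 0 ∧ IsEven V ∧
    q = word π U * (word π [a, b] - word π [b, a]) * word π V}

theorem word_mul_mem_commSpan {L : List StarVar} (hL : IsEven L) {c : Q} (hc : c ∈ commSpan π) :
    word π L * c ∈ commSpan π := by
  induction hc using Submodule.span_induction with
  | mem c hc =>
    obtain ⟨U, a, b, V, hU, ha, hb, hV, rfl⟩ := hc
    refine Submodule.subset_span ⟨L ++ U, a, b, V, IsEven.append_iff.mpr ⟨hL, hU⟩, ha, hb, hV, ?_⟩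
    simp only [word_append, mul_assoc]
  | zero => simp
  | add c d _ _ hc hd => rw [mul_add]; exact add_mem hc hd
  | smul r c _ hc => rw [mul_smul_comm]; exact Submodule.smul_mem _ r hc

theorem word_sub_word_mem_commSpan {L L' : List StarVar} (hL : IsEven L) (hp : L.Perm L') :
    word π L - word π L' ∈ commSpan π := by
  induction hp with
  | nil => simp
  | @cons a l₁ l₂ _ ih =>
    rw [IsEven.cons_iff] at hL
    rw [word_cons a l₁, word_cons a l₂, ← mul_sub]
    exact word_mul_mem_commSpan (by simp [IsEven, hL.1]) (ih hL.2)
  | swap a b l =>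
    rw [IsEven.cons_iff, IsEven.cons_iff] at hL
    refine Submodule.subset_span ⟨[], b, a, l, by simp [IsEven], hL.1, hL.2.1, hL.2.2, ?_⟩
    rw [word_nil, one_mul, sub_mul, ← word_append, ← word_append]
    rfl
  | trans h1 _ ih1 ih2 =>
    rw [← sub_add_sub_cancel]
    exact add_mem (ih1 hL) (ih2 (hL.perm h1))

namespace KillsGenerators

theorem commSpan_mul_word_mul_commSpan [CharZero F] (hπ : KillsGenerators π) {c d : Q}
    (hc : c ∈ commSpan π) (hd : d ∈ commSpan π) (L : List StarVar) : c * word π L * d = 0 := by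
  induction hc using Submodule.span_induction with
  | mem c hc =>
    obtain ⟨U, a, b, V, hU, ha, hb, hV, rfl⟩ := hc
    induction hd using Submodule.span_induction with
    | mem d hd =>
      obtain ⟨U', a', b', V', hU', ha', hb', hV', rfl⟩ := hd
      have h := hπ.comm_letters_mul ha hb ha' hb' (V ++ L ++ U')
      rw [word_append, word_append] at h
      calc _ = word π U * ((word π [a, b] - word π [b, a]) *
            (word π V * word π L * word π U') * (word π [a', b'] - word π [b', a'])) *
            word π V' := by noncomm_ring
        _ = 0 := by rw [h, mul_zero, zero_mul]
    | zero => simp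
    | add c d _ _ hc hd => rw [mul_add, hc, hd, add_zero]
    | smul r c _ hc => rw [mul_smul_comm, hc, smul_zero]
  | zero => simp
  | add c d _ _ hc hd => rw [add_mul, add_mul, hc, hd, add_zero]
  | smul r c _ hc => rw [smul_mul_assoc, smul_mul_assoc, hc, smul_zero]

/-- The commutator ideal is annihilated by itself, so that even words act on it commutatively. -/
theorem word_mul_commSpan [CharZero F] (hπ : KillsGenerators π) {L L' : List StarVar}
    (hL : IsEven L) (hp : L.Perm L') {c : Q} (hc : c ∈ commSpan π) :
    word π L * c = word π L' * c := by
  have h := hπ.commSpan_mul_word_mul_commSpan (word_sub_word_mem_commSpan hL hp) hc []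
  rwa [word_nil, mul_one, sub_mul, sub_eq_zero] at h

theorem commSpan_mul_odd_mul_letter [CharZero F] (hπ : KillsGenerators π) {c : Q}
    (hc : c ∈ commSpan π) {O : List StarVar} (hO : wordDeg O = 1) {a : StarVar} (ha : a.deg = 0) :
    c * word π O * word π [a] = ((a.sgn : ℤ) : F) • (word π [a] * c * word π O) := by
  induction hc using Submodule.span_induction with
  | mem c hc =>
    obtain ⟨U, b, d, V, hU, hb, hd, hV, rfl⟩ := hc
    have h := hπ.comm_letters_odd_letter hb hd ha
      (mono_mem (F := F) ((wordDeg_even_append hV).trans hO))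
    change _ * word π (V ++ O) * _ = _ • (_ * word π (V ++ O)) at h
    have h2 : word π U * word π [a] * (word π [b, d] - word π [d, b]) =
        word π [a] * word π U * (word π [b, d] - word π [d, b]) := by
      have h3 : word π [b, d] - word π [d, b] ∈ commSpan π :=
        word_sub_word_mem_commSpan (by simp [IsEven, hb, hd]) (.swap _ _ _)
      have h4 := hπ.word_mul_commSpan (L := U ++ [a]) (L' := [a] ++ U)
        (IsEven.append_iff.mpr ⟨hU, by simp [IsEven, ha]⟩) List.perm_append_comm h3
      rwa [word_append, word_append] at h4
    rw [word_append] at h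
    calc _ = word π U * ((word π [b, d] - word π [d, b]) * (word π V * word π O) * word π [a]) := by
          noncomm_ring
      _ = ((a.sgn : ℤ) : F) • (word π U * word π [a] * (word π [b, d] - word π [d, b]) *
            (word π V * word π O)) := by
          rw [h, mul_smul_comm]
          simp only [mul_assoc]
      _ = _ := by
          rw [h2]
          simp only [mul_assoc]
  | zero => simp
  | add c d _ _ hc hd => rw [add_mul, add_mul, hc, hd, mul_add, add_mul, smul_add]
  | smul r c _ hc =>
    rw [smul_mul_assoc, smul_mul_assoc, hc, mul_smul_comm, smul_mul_assoc, smul_comm]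

theorem commSpan_mul_odd_mul_word [CharZero F] (hπ : KillsGenerators π) {c : Q}
    (hc : c ∈ commSpan π) {O : List StarVar} (hO : wordDeg O = 1) {L : List StarVar}
    (hL : IsEven L) : c * word π O * word π L = sg F L • (word π L * c * word π O) := by
  induction L generalizing c with
  | nil => simp [word_nil, sg_nil]
  | cons a L ih =>
    rw [IsEven.cons_iff] at hL
    rw [word_cons, ← mul_assoc, hπ.commSpan_mul_odd_mul_letter hc hO hL.1, smul_mul_assoc,
      mul_assoc (word π [a]), mul_assoc (word π [a]), ih hc hL.2, mul_smul_comm, smul_smul, sg_cons]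
    simp only [mul_assoc]

/-- Between and around two odd letters the even letters commute. -/
theorem odd_odd_congr [CharZero F] (hπ : KillsGenerators π) {A A' B B' C C' : List StarVar}
    (hA : IsEven A) (hB : IsEven B) (hC : IsEven C) (hAp : A.Perm A') (hBp : B.Perm B')
    (hCp : C.Perm C') {a b : StarVar} (ha : a.deg = 1) (hb : b.deg = 1) :
    word π A * word π [a] * word π B * word π [b] * word π C =
      word π A' * word π [a] * word π B' * word π [b] * word π C' := by
  have hA' := hA.perm hAp
  have hda : wordDeg [a] = 1 := by simpa [wordDeg] using ha
  have hdb : wordDeg [b] = 1 := by simpa [wordDeg] using hb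
  have h1 : word π A * word π ([a] ++ B) * word π ([b] ++ C) =
      word π A' * word π ([a] ++ B) * word π ([b] ++ C) :=
    hπ.word_odd_odd hA hAp (mono_mem ((wordDeg_append_even hB).trans hda))
      (mono_mem ((wordDeg_append_even hC).trans hdb))
  have h2 : word π (A' ++ [a]) * word π B * word π ([b] ++ C) =
      word π (A' ++ [a]) * word π B' * word π ([b] ++ C) :=
    hπ.odd_word_odd hB hBp (mono_mem ((wordDeg_even_append hA').trans hda))
      (mono_mem ((wordDeg_append_even hC).trans hdb))
  have h3 : word π (A' ++ [a] ++ B') * word π [b] * word π C =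
      word π (A' ++ [a] ++ B') * word π [b] * word π C' :=
    hπ.odd_odd_word hC hCp (mono_mem (by
      rw [wordDeg_append_even (hB.perm hBp), wordDeg_even_append hA', hda])) (mono_mem hdb)
  simp only [word_append, ← mul_assoc] at h1 h2 h3
  rw [h1, h2, h3]

/-- A block of even variables is replaced by the letters of a word in which the symmetric letters
precede the skew ones. -/
theorem map_block {φ : FreeStar F →ₐ[F] Q} {P R A A' : List StarVar}
    (hφ : ∀ i p, ((1, 1) :: (P ++ (A ++ A') ++ R).map
      fun a => (a.sgn, FreeAlgebra.ι F a))[i]? = some p → φ (y F p.1 i) = π p.2)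
    (hA : ∀ a ∈ A, a.sgn = 1) (hA' : ∀ a ∈ A', a.sgn = -1) :
    φ (block F P.length A.length A'.length) = word π (A ++ A') := by
  rw [block, map_mul, map_list_prod, map_list_prod, word_append, word_eq_prod, word_eq_prod,
    List.map_ofFn, List.map_ofFn]
  congr 2
  · refine List.ext_getElem (by simp) fun i hi hi' => ?_
    have hi2 : i < A.length := by simpa using hi'
    have h := hφ (P.length + i + 1) (A[i].sgn, FreeAlgebra.ι F A[i]) (by
      rw [List.getElem?_cons_succ, List.getElem?_map, List.append_assoc,
        List.getElem?_append_right (by omega), Nat.add_sub_cancel_left, List.append_assoc,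
        List.getElem?_append_left hi2, List.getElem?_eq_getElem hi2]
      rfl)
    rw [hA _ (List.getElem_mem hi2)] at h
    simpa using h
  · refine List.ext_getElem (by simp) fun i hi hi' => ?_
    have hi2 : i < A'.length := by simpa using hi'
    have h := hφ (P.length + A.length + i + 1) (A'[i].sgn, FreeAlgebra.ι F A'[i]) (by
      rw [List.getElem?_cons_succ, List.getElem?_map, List.append_assoc,
        List.getElem?_append_right (by omega), List.append_assoc,
        List.getElem?_append_right (by omega), List.getElem?_append_left (by omega),
        show P.length + A.length + i - P.length - A.length = i by omega,
        List.getElem?_eq_getElem hi2]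
      rfl)
    rw [hA' _ (List.getElem_mem hi2)] at h
    simpa using h

theorem sg_symm_append_skew {A A' : List StarVar} (hA : ∀ a ∈ A, a.sgn = 1)
    (hA' : ∀ a ∈ A', a.sgn = -1) :
    ((((-1 : ℤˣ) ^ A'.length : ℤˣ) : ℤ) : F) = sg F (A ++ A') := by
  have h1 : A.map StarVar.sgn = List.replicate A.length 1 :=
    List.eq_replicate_iff.mpr ⟨by simp, by simpa using hA⟩
  have h2 : A'.map StarVar.sgn = List.replicate A'.length (-1) :=
    List.eq_replicate_iff.mpr ⟨by simp, by simpa using hA'⟩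
  rw [sg, sgnProd, List.map_append, h1, h2]
  simp

theorem three_blocks_sorted (hπ : KillsGenerators π) {A A' B B' C C' : List StarVar}
    (he : IsEven (A ++ A' ++ (B ++ B') ++ (C ++ C')))
    (hA : ∀ a ∈ A, a.sgn = 1) (hA' : ∀ a ∈ A', a.sgn = -1)
    (hB : ∀ a ∈ B, a.sgn = 1) (hB' : ∀ a ∈ B', a.sgn = -1)
    (hC : ∀ a ∈ C, a.sgn = 1) (hC' : ∀ a ∈ C', a.sgn = -1)
    {a b : StarVar} (ha : a.deg = 1) (hb : b.deg = 1) (ha' : a.sgn = -1) (hb' : b.sgn = -1) :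
    (sg F (A ++ A') * sg F (C ++ C')) • (word π (A ++ A') * word π [a] * word π (B ++ B') *
        word π [b] * word π (C ++ C'))
      - sg F (C ++ C') • (word π [a] * word π (A ++ A') * word π (B ++ B') * word π [b] *
        word π (C ++ C'))
      + word π [a] * word π (A ++ A') * word π (B ++ B') * word π (C ++ C') * word π [b]
      - sg F (A ++ A') • (word π (A ++ A') * word π [a] * word π (B ++ B') * word π (C ++ C') *
        word π [b]) = 0 := by
  obtain ⟨φ, hφ, hy, hz⟩ := hπ.exists_subst
    ((1, 1) :: (A ++ A' ++ (B ++ B') ++ (C ++ C')).map fun a => (a.sgn, FreeAlgebra.ι F a))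
    [(1, 0), (-1, FreeAlgebra.ι F a), (-1, FreeAlgebra.ι F b)] (by
      intro p hp
      rw [List.mem_cons, List.mem_map] at hp
      obtain rfl | ⟨a, ha, rfl⟩ := hp
      · exact isHomog_one
      · exact isHomog_letter (he a ha) rfl)
    (by simp [isHomog_letter ha ha', isHomog_letter hb hb', isHomog_zero])
  have h1 := map_block (P := []) (R := B ++ B' ++ (C ++ C')) (by simpa using hy) hA hA'
  have h2 := map_block (P := A ++ A') (R := C ++ C') (by simpa using hy) hB hB'
  have h3 := map_block (P := A ++ A' ++ (B ++ B')) (R := []) (by simpa using hy) hC hC'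
  simp only [List.length_append, List.length_nil, ← add_assoc] at h1 h2 h3
  have h := hφ _ (.three_blocks A.length A'.length B.length B'.length C.length C'.length _ _ _
    rfl rfl rfl)
  have hac : ((((-1 : ℤˣ) ^ (A'.length + C'.length) : ℤˣ) : ℤ) : F) =
      sg F (A ++ A') * sg F (C ++ C') := by
    rw [← sg_symm_append_skew hA hA', ← sg_symm_append_skew hC hC']
    simp [pow_add]
  simp only [neg_one_pow_mul_eq_smul (F := F), map_sub, map_add, map_smul] at h
  rw [hac, sg_symm_append_skew hA hA', sg_symm_append_skew hC hC'] at h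
  simpa only [map_mul, h1, h2, h3, hz 1 (-1, FreeAlgebra.ι F a) rfl,
    hz 2 (-1, FreeAlgebra.ι F b) rfl, ← word_singleton] using h

theorem three_blocks [CharZero F] (hπ : KillsGenerators π) {A B C : List StarVar} (hA : IsEven A)
    (hB : IsEven B) (hC : IsEven C) {a b : StarVar} (ha : a.deg = 1) (hb : b.deg = 1)
    (ha' : a.sgn = -1) (hb' : b.sgn = -1) :
    (sg F A * sg F C) • (word π A * word π [a] * word π B * word π [b] * word π C)
      - sg F C • (word π [a] * word π A * word π B * word π [b] * word π C)
      + word π [a] * word π A * word π B * word π C * word π [b]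
      - sg F A • (word π A * word π [a] * word π B * word π C * word π [b]) = 0 := by
  have hex : ∀ L : List StarVar, IsEven L → ∃ S T : List StarVar, (S ++ T).Perm L ∧
      IsEven (S ++ T) ∧ (∀ a ∈ S, a.sgn = 1) ∧ ∀ a ∈ T, a.sgn = -1 := by
    intro L hL
    have hp := List.filter_append_perm (fun a : StarVar => decide (a.sgn = 1)) L
    refine ⟨_, _, hp, hL.perm hp.symm, by simp, fun a ha => ?_⟩
    have h1 : a.sgn ≠ 1 := by simpa using (List.mem_filter.mp ha).2
    exact (Int.units_eq_one_or a.sgn).resolve_left h1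
  obtain ⟨A₁, A₂, hAp, hAe, hA1, hA2⟩ := hex A hA
  obtain ⟨B₁, B₂, hBp, hBe, hB1, hB2⟩ := hex B hB
  obtain ⟨C₁, C₂, hCp, hCe, hC1, hC2⟩ := hex C hC
  have h := hπ.three_blocks_sorted (F := F) (IsEven.append_iff.mpr
    ⟨IsEven.append_iff.mpr ⟨hAe, hBe⟩, hCe⟩) hA1 hA2 hB1 hB2 hC1 hC2 ha hb ha' hb'
  rw [sg_perm hAp, sg_perm hCp] at h
  generalize A₁ ++ A₂ = A' at *
  generalize B₁ ++ B₂ = B' at *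
  generalize C₁ ++ C₂ = C' at *
  have hn : IsEven [] := by simp [IsEven]
  have e1 := hπ.odd_odd_congr hAe hBe hCe hAp hBp hCp ha hb
  have e2 := hπ.odd_odd_congr hn (IsEven.append_iff.mpr ⟨hAe, hBe⟩) hCe .nil (hAp.append hBp)
    hCp ha hb
  have e3 := hπ.odd_odd_congr hn (IsEven.append_iff.mpr ⟨IsEven.append_iff.mpr ⟨hAe, hBe⟩, hCe⟩)
    hn .nil ((hAp.append hBp).append hCp) .nil ha hb
  have e4 := hπ.odd_odd_congr hAe (IsEven.append_iff.mpr ⟨hBe, hCe⟩) hn hAp (hBp.append hCp)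
    .nil ha hb
  simp only [word_append, word_nil, one_mul, mul_one, ← mul_assoc] at e2 e3 e4
  rwa [e1, e2, e3, e4] at h

end KillsGenerators

end Rearrangement

/-! ### Generic matrices -/

noncomputable section Generic

variable {F : Type*} [Field F]

/-- The polynomial ring in the entries of the generic matrices. The variables `(0, y)`, `(1, y)`,
`(2, y)` are the entries `(1, 1)`, `(2, 2)`, `(1, 3)` of the generic matrix of the even letter `y`,
and `(3, z)`, `(4, z)` are the entries `(1, 2)`, `(2, 3)` of that of the odd letter `z`. -/
abbrev EntryRing (F : Type*) [Field F] := MvPolynomial (Fin 5 × StarVar) F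

open scoped Classical in
/-- The monomial with the given multisets of letters, one for each of the five kinds of
variables. -/
def mon (F : Type*) [Field F] (A E C B D : Multiset StarVar) : EntryRing F :=
  MvPolynomial.monomial (Multiset.toFinsupp (A.map (Prod.mk 0) + E.map (Prod.mk 1) +
    C.map (Prod.mk 2) + B.map (Prod.mk 3) + D.map (Prod.mk 4))) 1

theorem mon_mul (A E C B D A' E' C' B' D' : Multiset StarVar) :
    mon F A E C B D * mon F A' E' C' B' D' =
      mon F (A + A') (E + E') (C + C') (B + B') (D + D') := by
  classical
  rw [mon, mon, mon, MvPolynomial.monomial_mul, ← map_add, one_mul]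
  congr 2
  simp only [Multiset.map_add]
  abel_nf

theorem mon_zero : mon F 0 0 0 0 0 = 1 := by
  simp [mon]

/-- The letters of the variables of the kind `j` in a monomial. -/
def lettersOfKind (j : Fin 5) (m : Fin 5 × StarVar →₀ ℕ) : Multiset StarVar :=
  (m.toMultiset.filter fun p => p.1 = j).map Prod.snd

/-- The linear map with prescribed values on the monomials. -/
def extendMon {Q : Type*} [AddCommGroup Q] [Module F Q]
    (n : Multiset StarVar → Multiset StarVar → Multiset StarVar → Multiset StarVar →
      Multiset StarVar → Q) : EntryRing F →ₗ[F] Q :=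
  (MvPolynomial.basisMonomials _ F).constr F fun m =>
    n (lettersOfKind 0 m) (lettersOfKind 1 m) (lettersOfKind 2 m) (lettersOfKind 3 m)
      (lettersOfKind 4 m)

theorem extendMon_mon {Q : Type*} [AddCommGroup Q] [Module F Q]
    (n : Multiset StarVar → Multiset StarVar → Multiset StarVar → Multiset StarVar →
      Multiset StarVar → Q) (A E C B D : Multiset StarVar) :
    extendMon n (mon F A E C B D) = n A E C B D := by
  classical
  have h : mon F A E C B D = MvPolynomial.basisMonomials _ F (Multiset.toFinsupp
      (A.map (Prod.mk 0) + E.map (Prod.mk 1) + C.map (Prod.mk 2) + B.map (Prod.mk 3) +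
        D.map (Prod.mk 4))) := by
    rw [MvPolynomial.coe_basisMonomials, mon]
  rw [h, extendMon, Module.Basis.constr_basis]
  simp [lettersOfKind, Multiset.filter_add, Multiset.filter_map]

/-- The generic matrices: even letters have arbitrary entries subject to degree and symmetry, and
odd letters have in addition the entry `(1, 4)` equal to zero. That entry is not needed: the words
with a single odd letter can already be told apart by their entries `(1, 2)` and `(1, 4)` without
it. -/
def genericMatrix (F : Type*) [Field F] (a : StarVar) : Matrix (Fin 4) (Fin 4) (EntryRing F) :=
  if a.deg = 0 then
    evMat ((a.sgn : ℤ) : EntryRing F) (mon F {a} 0 0 0 0) (mon F 0 {a} 0 0 0) (mon F 0 0 {a} 0 0)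
      (((a.sgn : ℤ) : EntryRing F) * mon F 0 0 {a} 0 0)
  else
    odMat ((a.sgn : ℤ) : EntryRing F) (mon F 0 0 0 {a} 0)
      (if a.sgn = -1 then mon F 0 0 0 0 {a} else 0) 0

theorem genericMatrix_even {a : StarVar} (ha : a.deg = 0) : genericMatrix F a =
    evMat ((a.sgn : ℤ) : EntryRing F) (mon F {a} 0 0 0 0) (mon F 0 {a} 0 0 0) (mon F 0 0 {a} 0 0)
      (((a.sgn : ℤ) : EntryRing F) * mon F 0 0 {a} 0 0) :=
  if_pos ha

theorem genericMatrix_odd {a : StarVar} (ha : a.deg = 1) : genericMatrix F a =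
    odMat ((a.sgn : ℤ) : EntryRing F) (mon F 0 0 0 {a} 0)
      (if a.sgn = -1 then mon F 0 0 0 0 {a} else 0) 0 :=
  if_neg (by rw [ha]; decide)

theorem cast_mul_eq_smul (u : ℤˣ) (p : EntryRing F) :
    ((u : ℤ) : EntryRing F) * p = ((u : ℤ) : F) • p := by
  rw [Int.cast_smul_eq_zsmul, zsmul_eq_mul]

theorem evMat_mul {R : Type*} [CommRing R] (s a e c s' a' e' c' d' : R) :
    evMat s a e c (s * c) * evMat s' a' e' c' d' =
      evMat (s * s') (a * a') (e * e') (a * c' + s' * (c * e')) (e * d' + s * (s' * (c * a'))) := by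
  rw [evMat, evMat, upper_mul, evMat]
  congr 1 <;> ring

/-- The entry `(1, 3)` of the product of the generic matrices of an even word. -/
def entry13 (F : Type*) [Field F] : List StarVar → EntryRing F
  | [] => 0
  | a :: L => mon F {a} 0 0 0 0 * entry13 F L + sg F L • mon F 0 (L : Multiset StarVar) {a} 0 0

/-- The entry `(2, 4)` of the product of the generic matrices of an even word. -/
def entry24 (F : Type*) [Field F] : List StarVar → EntryRing F
  | [] => 0
  | a :: L => mon F 0 {a} 0 0 0 * entry24 F L +
      (((a.sgn : ℤ) : F) * sg F L) • mon F (L : Multiset StarVar) 0 {a} 0 0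

theorem genericMatrix_word {L : List StarVar} (hL : IsEven L) :
    (L.map (genericMatrix F)).prod = evMat ((sgnProd L : ℤ) : EntryRing F)
      (mon F (L : Multiset StarVar) 0 0 0 0) (mon F 0 (L : Multiset StarVar) 0 0 0)
      (entry13 F L) (entry24 F L) := by
  induction L with
  | nil => simp [sgnProd, evMat, upper_one, mon_zero, entry13, entry24]
  | cons a L ih =>
    rw [IsEven.cons_iff] at hL
    have h1 : sgnProd (a :: L) = a.sgn * sgnProd L := by simp [sgnProd]
    have h2 : ((a :: L : List StarVar) : Multiset StarVar) = {a} + (L : Multiset StarVar) := rfl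
    have h3 : mon F {a} (L : Multiset StarVar) 0 0 0 =
      mon F {a} 0 0 0 0 * mon F 0 (L : Multiset StarVar) 0 0 0 := by simp [mon_mul]
    have h4 : mon F ({a} + (L : Multiset StarVar)) 0 0 0 0 =
      mon F {a} 0 0 0 0 * mon F (L : Multiset StarVar) 0 0 0 0 := by simp [mon_mul]
    have h5 : mon F 0 ({a} + (L : Multiset StarVar)) 0 0 0 =
      mon F 0 {a} 0 0 0 * mon F 0 (L : Multiset StarVar) 0 0 0 := by simp [mon_mul]
    have h6 : mon F 0 (L : Multiset StarVar) {a} 0 0 =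
      mon F 0 0 {a} 0 0 * mon F 0 (L : Multiset StarVar) 0 0 0 := by simp [mon_mul]
    have h7 : mon F (L : Multiset StarVar) 0 {a} 0 0 =
      mon F 0 0 {a} 0 0 * mon F (L : Multiset StarVar) 0 0 0 0 := by simp [mon_mul]
    rw [List.map_cons, List.prod_cons, ih hL.2, genericMatrix_even hL.1, entry13, entry24, h2, h4,
      h5, h6, h7, h1, sg, mul_smul, ← cast_mul_eq_smul, ← cast_mul_eq_smul, ← cast_mul_eq_smul,
      evMat_mul, Units.val_mul, Int.cast_mul]

/-! ### Polynomial identities vanish on the generic matrices -/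

theorem map_upper {R S : Type*} [CommRing R] [CommRing S] (φ : R →+* S)
    (a b c d e f g h i l : R) : φ.mapMatrix (upper a b c d e f g h i l) =
      upper (φ a) (φ b) (φ c) (φ d) (φ e) (φ f) (φ g) (φ h) (φ i) (φ l) := by
  ext j k
  fin_cases j <;> fin_cases k <;> simp [upper]

theorem superSymplecticMatrix_upper (a b c d e f g h i l : F) :
    superSymplecticMatrix (upper a b c d e f g h i l) = upper l i g d h (-f) c e b a :=
  rfl

theorem upper_mem (a b c d e f g h i l : F) : upper a b c d e f g h i l ∈ UT F 4 := by
  intro j k hjk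
  fin_cases j <;> fin_cases k <;> first | rfl | exact absurd hjk (by decide)

theorem exists_admissible_of_upper {d : ZMod 2} {ε : ℤˣ} {M : Matrix (Fin 4) (Fin 4) F}
    (hM : M ∈ UT F 4)
    (hg : ∀ k j, (![0, 1, 0, 1] : Fin 4 → ZMod 2) k + (![0, 1, 0, 1] : Fin 4 → ZMod 2) j ≠ d →
      M k j = 0)
    (hs : superSymplecticMatrix M = ((ε : ℤ) : F) • M) :
    ∃ N : UT F 4, (N ∈ elementaryGrading F (![0, 1, 0, 1] : Fin 4 → ZMod 2) d ∧
      (superSymplectic F).toFun N = ε • N) ∧ N.1 = M := by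
  refine ⟨⟨M, hM⟩, ⟨hg, Subtype.ext ?_⟩, rfl⟩
  rw [Units.smul_def, ← Int.cast_smul_eq_zsmul F]
  exact hs

theorem admissible_eval (p : Fin 5 × StarVar → F) :
    ∃ v : StarVar → UT F 4, Admissible (superSymplectic F) v ∧
      ∀ a, (v a).1 = (MvPolynomial.eval p).mapMatrix (genericMatrix F a) := by
  have hval : ∀ a, ∃ M : UT F 4, (M ∈ elementaryGrading F (![0, 1, 0, 1] : Fin 4 → ZMod 2) a.deg ∧
      (superSymplectic F).toFun M = a.sgn • M) ∧
      M.1 = (MvPolynomial.eval p).mapMatrix (genericMatrix F a) := by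
    rintro ⟨d, ε, i⟩
    have hd : ∀ d : ZMod 2, d = 0 ∨ d = 1 := by decide
    rcases hd d with rfl | rfl
    · rw [genericMatrix_even rfl, evMat, map_upper]
      refine exists_admissible_of_upper (d := 0) (upper_mem _ _ _ _ _ _ _ _ _ _) ?_ ?_
      · intro k j h
        fin_cases k <;> fin_cases j <;> first | rfl | exact map_zero _ | exact absurd (by decide) h
      · rw [superSymplecticMatrix_upper, upper_smul]
        rcases Int.units_eq_one_or ε with rfl | rfl <;> simp
    · rw [genericMatrix_odd rfl, odMat, map_upper]
      refine exists_admissible_of_upper (d := 1) (upper_mem _ _ _ _ _ _ _ _ _ _) ?_ ?_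
      · intro k j h
        fin_cases k <;> fin_cases j <;> first | rfl | exact map_zero _ | exact absurd (by decide) h
      · rw [superSymplecticMatrix_upper, upper_smul]
        rcases Int.units_eq_one_or ε with rfl | rfl
        · have h : ¬ (1 : ℤˣ) = -1 := by decide
          simp [h]
        · simp
  choose v hv hv' using hval
  exact ⟨v, hv, hv'⟩

theorem lift_genericMatrix_eq_zero [CharZero F] {f : FreeStar F}
    (hf : f ∈ starIdentities (superSymplectic F)) :
    FreeAlgebra.lift F (genericMatrix F) f = 0 := by
  refine Matrix.ext fun j k => MvPolynomial.funext (R := F) fun p => ?_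
  obtain ⟨v, hv, hv'⟩ := admissible_eval p
  have h1 : FreeAlgebra.lift F (fun a => (v a).1) f =
      (MvPolynomial.aeval p).mapMatrix (FreeAlgebra.lift F (genericMatrix F) f) := by
    refine DFunLike.congr_fun (g := ((MvPolynomial.aeval p).mapMatrix).comp
      (FreeAlgebra.lift F (genericMatrix F))) ?_ f
    ext a : 2
    simp only [Function.comp_apply, FreeAlgebra.lift_ι_apply, AlgHom.comp_apply, hv']
    rfl
  rw [← val_lift, hf v hv] at h1
  exact (congrFun (congrFun h1 j) k).symm

end Generic

/-! ### Recovering a word from its generic evaluation -/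

noncomputable section NormalForm

variable {F : Type*} [Field F] {Q : Type*} [Ring Q] [Algebra F Q] {π : FreeStar F →ₐ[F] Q}

/-- The image of a word spelled by a multiset of letters, in an arbitrary fixed order. -/
def mword (π : FreeStar F →ₐ[F] Q) (M : Multiset StarVar) : Q := word π M.toList

theorem mword_zero : mword π 0 = 1 := by rw [mword, Multiset.toList_zero, word_nil]

theorem toList_coe_perm (L : List StarVar) : (L : Multiset StarVar).toList.Perm L :=
  Multiset.coe_eq_coe.mp (Multiset.coe_toList _)

theorem toList_add_perm (M N : Multiset StarVar) :
    (M + N).toList.Perm (M.toList ++ N.toList) :=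
  Multiset.coe_eq_coe.mp (by rw [← Multiset.coe_add, Multiset.coe_toList, Multiset.coe_toList,
    Multiset.coe_toList])

theorem sg_toList_coe (L : List StarVar) : sg F (L : Multiset StarVar).toList = sg F L :=
  sg_perm (toList_coe_perm L)

theorem isEven_toList_add {M N : Multiset StarVar} (hM : IsEven M.toList) (hN : IsEven N.toList) :
    IsEven (M + N).toList :=
  (IsEven.append_iff.mpr ⟨hM, hN⟩).perm (toList_add_perm M N).symm

theorem word_sub_mword_mem {L : List StarVar} (hL : IsEven L) :
    word π L - mword π L ∈ commSpan π :=
  word_sub_word_mem_commSpan hL (toList_coe_perm L).symm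

namespace KillsGenerators

theorem mword_add_singleton_mul [CharZero F] (hπ : KillsGenerators π) {U : Multiset StarVar}
    (hU : IsEven U.toList) {a : StarVar} (ha : a.deg = 0) {c : Q} (hc : c ∈ commSpan π) :
    mword π (U + {a}) * c = mword π U * word π [a] * c := by
  have hp := toList_add_perm U {a}
  rw [Multiset.toList_singleton] at hp
  have hUa : IsEven (U.toList ++ [a]) := IsEven.append_iff.mpr ⟨hU, by simp [IsEven, ha]⟩
  rw [mword, hπ.word_mul_commSpan (hUa.perm hp.symm) hp hc, word_append, mword]

/-- The entry `(1, 3)` of an even word determines the difference between the word and its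
rearrangement: the contributions of the letters form a telescoping sum. -/
theorem telescope13 [CharZero F] (hπ : KillsGenerators π) {Λ : EntryRing F →ₗ[F] Q}
    {τ : EntryRing F} {t : Q}
    (hΛ : ∀ U V a, Λ (mon F U V {a} 0 0 * τ) =
      sg F V.toList • (mword π U * (word π [a] * mword π V - mword π ({a} + V)) * t))
    {L : List StarVar} (hL : IsEven L) {U : Multiset StarVar} (hU : IsEven U.toList) :
    Λ (mon F U 0 0 0 0 * entry13 F L * τ) =
      mword π U * (word π L - mword π L) * t := by
  induction L generalizing U with
  | nil =>
    rw [entry13, mul_zero, zero_mul, map_zero, Multiset.coe_nil, mword_zero, word_nil, sub_self,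
      mul_zero, zero_mul]
  | cons a L ih =>
    rw [IsEven.cons_iff] at hL
    have h1 : mon F U 0 0 0 0 * entry13 F (a :: L) * τ =
        mon F (U + {a}) 0 0 0 0 * entry13 F L * τ + sg F L • (mon F U L {a} 0 0 * τ) := by
      have h2 : mon F (U + {a}) 0 0 0 0 = mon F U 0 0 0 0 * mon F {a} 0 0 0 0 := by simp [mon_mul]
      have h3 : mon F U L {a} 0 0 = mon F U 0 0 0 0 * mon F 0 L {a} 0 0 := by simp [mon_mul]
      rw [entry13, h2, h3, mul_add, add_mul, mul_smul_comm, smul_mul_assoc, ← mul_assoc]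
    have ha : IsEven ({a} : Multiset StarVar).toList := by simp [IsEven, hL.1]
    have h4 : ({a} : Multiset StarVar) + L = ((a :: L : List StarVar) : Multiset StarVar) := rfl
    rw [h1, map_add, map_smul, ih hL.2 (isEven_toList_add hU ha), hΛ, sg_toList_coe, smul_smul,
      sg_mul_self, one_smul, hπ.mword_add_singleton_mul hU hL.1 (word_sub_mword_mem hL.2), h4,
      word_cons a L]
    noncomm_ring

/-- The analogue of `telescope13` for the entry `(2, 4)`, which sees the reversed word. -/
theorem telescope24 [CharZero F] (hπ : KillsGenerators π) {Λ : EntryRing F →ₗ[F] Q}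
    {τ : EntryRing F} {t : Q}
    (hΛ : ∀ U V a, Λ (mon F U V {a} 0 0 * τ) =
      sg F V.toList • (mword π U * (word π [a] * mword π V - mword π ({a} + V)) * t))
    {L : List StarVar} (hL : IsEven L) {U V : Multiset StarVar} (hU : IsEven U.toList)
    (hV : IsEven V.toList) :
    Λ (mon F U V 0 0 0 * entry24 F L * τ) =
      (sg F V.toList * sg F L) •
        (mword π U * (word π L.reverse * mword π V - mword π (L + V)) * t) := by
  induction L generalizing V with
  | nil =>
    rw [entry24, mul_zero, zero_mul, map_zero, Multiset.coe_nil, zero_add, List.reverse_nil,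
      word_nil, one_mul, sub_self, mul_zero, zero_mul, smul_zero]
  | cons a L ih =>
    rw [IsEven.cons_iff] at hL
    have h1 : mon F U V 0 0 0 * entry24 F (a :: L) * τ =
        mon F U ({a} + V) 0 0 0 * entry24 F L * τ +
          (((a.sgn : ℤ) : F) * sg F L) • (mon F (U + L) V {a} 0 0 * τ) := by
      have h2 : mon F U ({a} + V) 0 0 0 = mon F U V 0 0 0 * mon F 0 {a} 0 0 0 := by
        simp [mon_mul, add_comm]
      have h3 : mon F (U + L) V {a} 0 0 = mon F U V 0 0 0 * mon F L 0 {a} 0 0 := by simp [mon_mul]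
      rw [entry24, h2, h3, mul_add, add_mul, mul_smul_comm, smul_mul_assoc, ← mul_assoc]
    have ha : IsEven ({a} : Multiset StarVar).toList := by simp [IsEven, hL.1]
    have h4 : ((a :: L : List StarVar) : Multiset StarVar) + V = L + ({a} + V) := by
      rw [← add_assoc, add_comm (L : Multiset StarVar) {a}]
      rfl
    have h5 : sg F ({a} + V).toList = ((a.sgn : ℤ) : F) * sg F V.toList := by
      rw [sg_perm (toList_add_perm {a} V), Multiset.toList_singleton, List.singleton_append,
        sg_cons]
    have hc : word π [a] * mword π V - mword π ({a} + V) ∈ commSpan π := by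
      have hp := toList_add_perm {a} V
      rw [Multiset.toList_singleton, List.singleton_append] at hp
      rw [mword, ← word_cons]
      exact word_sub_word_mem_commSpan (IsEven.cons_iff.mpr ⟨hL.1, hV⟩) hp.symm
    have h6 : ∀ c ∈ commSpan π, mword π (U + L) * c = mword π U * word π L.reverse * c := by
      intro c hc
      have hp : (U + (L : Multiset StarVar)).toList.Perm (U.toList ++ L.reverse) :=
        (toList_add_perm U L).trans
          (((toList_coe_perm L).trans (List.reverse_perm L).symm).append_left _)
      rw [mword, hπ.word_mul_commSpan (isEven_toList_add hU
        (hL.2.perm (toList_coe_perm L).symm)) hp hc, word_append, mword]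
    rw [h1, map_add, map_smul, ih hL.2 (isEven_toList_add ha hV), hΛ, smul_smul, h6 _ hc, h5, h4,
      sg_cons, List.reverse_cons, word_append,
      show ((a.sgn : ℤ) : F) * sg F V.toList * sg F L =
        sg F V.toList * (((a.sgn : ℤ) : F) * sg F L) by ring,
      show ((a.sgn : ℤ) : F) * sg F L * sg F V.toList =
        sg F V.toList * (((a.sgn : ℤ) : F) * sg F L) by ring, ← smul_add]
    congr 1
    noncomm_ring

end KillsGenerators

/-- The value at a monomial of the linear map by which `recover` reads the entry `(1, 1)`: it
returns a word with the letters of the diagonal variables. -/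
def coeff11 (π : FreeStar F →ₐ[F] Q) (A _ _ _ _ : Multiset StarVar) : Q := mword π A

/-- The value at a monomial of the linear map by which `recover` reads the entry `(1, 2)`, which
for a word `A z B` records the letters of `A`, of `B` and `z`. -/
def coeff12 (π : FreeStar F →ₐ[F] Q) (A E _ B _ : Multiset StarVar) : Q :=
  match B.toList with
  | [z] => mword π A * word π [z] * word π E.toList.reverse
  | _ => 0

/-- The value at a monomial of the linear map by which `recover` reads the entry `(1, 3)`. A
monomial of even letters with one off-diagonal letter contributes a step of the telescoping sum of
`telescope13`; a monomial of a word with two odd letters contributes normal forms of such words. -/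
def coeff13 (π : FreeStar F →ₐ[F] Q) (A E C B D : Multiset StarVar) : Q :=
  match C.toList, B.toList, D.toList with
  | [y], [], [] => sg F E.toList • (mword π A * (word π [y] * mword π E - mword π ({y} + E)) * 1)
  | [], [b], [f] =>
    if b.sgn = 1 then mword π A * word π [b] * mword π E * word π [f]
    else mword π A * word π [b] * mword π E * word π [f] -
      sg F A.toList • (word π [b] * mword π (A + E) * word π [f])
  | _, _, _ => 0

/-- The value at a monomial of the linear map by which `recover` reads the entry `(2, 4)`. It
vanishes on the monomials of even words, whose entries `(1, 1)` and `(1, 3)` suffice. -/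
def coeff24 (π : FreeStar F →ₐ[F] Q) (A E C B D : Multiset StarVar) : Q :=
  match C.toList, B.toList, D.toList with
  | [], [b], [f] =>
    if b.sgn = 1 then sg F A.toList • (mword π E * word π [f] * word π [b] * mword π A)
    else -((sg F E.toList * sg F A.toList) • (word π [f] * mword π E * word π [b] * mword π A))
  | _, _, _ => 0

/-- The value at a monomial of the linear map by which `recover` reads the entry `(1, 4)`. It is a
step of a telescoping sum for one odd letter, and a normal form for three odd letters. In the
latter case the outer letters come in an order that is arbitrary, but does not matter. -/
def coeff14 (π : FreeStar F →ₐ[F] Q) (A E C B D : Multiset StarVar) : Q :=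
  match C.toList, B.toList, D.toList with
  | [y], [b], [] => sg F E.toList •
      (mword π A * (word π [y] * mword π E - mword π ({y} + E)) *
        (((b.sgn : ℤ) : F) • word π [b]))
  | [], [p, q], [f] => ((q.sgn : ℤ) : F) •
      (mword π A * word π [p] * mword π E * word π [f] * word π [q])
  | _, _, _ => 0

/-- The linear map recovering the image of a word from its evaluation on the generic matrices. On
the monomials that do not occur in such evaluations its value is immaterial. -/
def recover (π : FreeStar F →ₐ[F] Q) : Matrix (Fin 4) (Fin 4) (EntryRing F) →ₗ[F] Q :=
  extendMon (coeff11 π) ∘ₗ Matrix.entryLinearMap F _ 0 0 +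
  extendMon (coeff12 π) ∘ₗ Matrix.entryLinearMap F _ 0 1 +
  extendMon (coeff13 π) ∘ₗ Matrix.entryLinearMap F _ 0 2 +
  extendMon (coeff24 π) ∘ₗ Matrix.entryLinearMap F _ 1 3 +
  extendMon (coeff14 π) ∘ₗ Matrix.entryLinearMap F _ 0 3

theorem recover_upper (a b c d e f g h i l : EntryRing F) :
    recover π (upper a b c d e f g h i l) =
      extendMon (coeff11 π) a + extendMon (coeff12 π) b + extendMon (coeff13 π) c +
        extendMon (coeff24 π) g + extendMon (coeff14 π) d := rfl

theorem evMat_odMat_evMat {R : Type*} [CommRing R]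
    (s a e c d t b f s' a' e' c' d' : R) :
    evMat s a e c d * odMat t b f 0 * evMat s' a' e' c' d' =
      upper 0 (a * e' * b) 0 (a * d' * b + t * (s' * (a' * c * b))) 0 (s' * (e * e' * f)) 0 0
        (s * (t * (s' * (e * a' * b)))) 0 := by
  rw [evMat, odMat, evMat, upper_mul, upper_mul]
  congr 1 <;> ring

namespace KillsGenerators

theorem recover_even [CharZero F] (hπ : KillsGenerators π) {L : List StarVar} (hL : IsEven L) :
    recover π (L.map (genericMatrix F)).prod = word π L := by
  have h0 : IsEven (0 : Multiset StarVar).toList := by simp [IsEven]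
  have h13 := hπ.telescope13 (Λ := extendMon (coeff13 π)) (τ := 1) (t := 1) (fun U V a => by
    rw [mul_one, extendMon_mon]
    simp [coeff13]) hL h0
  have h24 := hπ.telescope24 (Λ := extendMon (coeff24 π)) (τ := 1) (t := 0) (fun U V a => by
    rw [mul_one, extendMon_mon]
    simp [coeff24]) hL h0 h0
  rw [mon_zero, one_mul, mul_one, mword_zero, one_mul, mul_one] at h13
  rw [mon_zero, one_mul, mul_one, mul_zero, smul_zero] at h24
  rw [genericMatrix_word hL, evMat, recover_upper, h13, h24, extendMon_mon, map_zero, map_zero,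
    coeff11]
  abel

/-- A word with one odd letter `a` in terms of the normal form `mword A * a * reverse of mword B`
(recorded by the entry `(1, 2)`) and of the corrections recorded by the entry `(1, 4)`. -/
theorem word_odd_word_eq [CharZero F] (hπ : KillsGenerators π) {A B : List StarVar}
    (hA : IsEven A) (hB : IsEven B) {a : StarVar} (ha : a.deg = 1) :
    mword π A * word π [a] * word π (B : Multiset StarVar).toList.reverse +
      (sg F B • (mword π A * (word π B.reverse - mword π B) * (((a.sgn : ℤ) : F) • word π [a])) +
        ((a.sgn : ℤ) : F) • (sg F B • (mword π B * (word π A - mword π A) *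
          (((a.sgn : ℤ) : F) • word π [a])))) = word π A * word π [a] * word π B := by
  have hp := toList_coe_perm B
  have hB' := hB.perm hp.symm
  have hda : wordDeg [a] = 1 := by simpa [wordDeg] using ha
  have hs := sgn_mul_self (R := F) a.sgn
  have h1 := hπ.word_sub_mul_letter hB.reverse ((List.reverse_perm B).trans hp.symm) ha
  have h2 := hπ.commSpan_mul_odd_mul_word (word_sub_mword_mem hA) hda hB'
  have h3 := hπ.commSpan_mul_word_mul_commSpan (word_sub_mword_mem hA) (word_sub_mword_mem hB) [a]
  rw [sg_perm (List.reverse_perm B), List.reverse_reverse] at h1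
  rw [sg_perm hp] at h2
  change _ * _ * mword π B = sg F B • (mword π B * _ * _) at h2
  change (word π B.reverse - mword π B) * _ = _ at h1
  have h4 : sg F B • (mword π A * (word π B.reverse - mword π B) *
      (((a.sgn : ℤ) : F) • word π [a])) =
      mword π A * word π [a] * (word π B - word π (B : Multiset StarVar).toList.reverse) := by
    rw [mul_smul_comm, mul_assoc, h1, mul_smul_comm, smul_smul, smul_smul,
      show sg F B * ((a.sgn : ℤ) : F) * (((a.sgn : ℤ) : F) * sg F B) = 1 by
        linear_combination sg F B * sg F B * hs + sg_mul_self (F := F) B, one_smul, mul_assoc]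
  have h5 : ((a.sgn : ℤ) : F) • (sg F B • (mword π B * (word π A - mword π A) *
      (((a.sgn : ℤ) : F) • word π [a]))) = (word π A - mword π A) * word π [a] * mword π B := by
    rw [h2, mul_smul_comm, smul_comm (sg F B), smul_smul, hs, one_smul]
  rw [mul_sub, sub_eq_zero] at h3
  rw [h4, h5, ← h3]
  noncomm_ring

theorem recover_odd₁ [CharZero F] (hπ : KillsGenerators π) {A B : List StarVar}
    (hA : IsEven A) (hB : IsEven B) {a : StarVar} (ha : a.deg = 1) :
    recover π ((A.map (genericMatrix F)).prod * genericMatrix F a *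
      (B.map (genericMatrix F)).prod) = word π A * word π [a] * word π B := by
  have h0 : IsEven (0 : Multiset StarVar).toList := by simp [IsEven]
  have hA' := hA.perm (toList_coe_perm A).symm
  have hB' := hB.perm (toList_coe_perm B).symm
  have hΛ : ∀ U V c, extendMon (coeff14 π) (mon F U V {c} 0 0 * mon F 0 0 0 {a} 0) =
      sg F V.toList • (mword π U * (word π [c] * mword π V - mword π ({c} + V)) *
        (((a.sgn : ℤ) : F) • word π [a])) := by
    intro U V c
    rw [mon_mul, extendMon_mon]
    simp [coeff14]
  have h1 := hπ.telescope24 hΛ hB hA' h0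
  have h2 := hπ.telescope13 hΛ hA hB'
  rw [genericMatrix_word hA, genericMatrix_word hB, genericMatrix_odd ha, evMat_odMat_evMat,
    recover_upper, map_zero, map_zero, map_zero, map_add, h1, cast_mul_eq_smul, cast_mul_eq_smul,
    map_smul, map_smul, h2, mon_mul, mon_mul, extendMon_mon, mword_zero, mul_one, add_zero,
    Multiset.toList_zero, sg_nil, one_mul]
  rw [← hπ.word_odd_word_eq hA hB ha]
  simp [coeff12, sg]

end KillsGenerators

end NormalForm

/-! ### Words with several odd letters, and completeness -/

noncomputable section Recover

variable {F : Type*} [Field F] {Q : Type*} [Ring Q] [Algebra F Q] {π : FreeStar F →ₐ[F] Q}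

theorem two_odMat {R : Type*} [CommRing R]
    (s₁ a₁ e₁ c₁ d₁ t₁ b₁ f₁ s₂ a₂ e₂ c₂ d₂ t₂ b₂ f₂ s₃ a₃ e₃ c₃ d₃ : R) :
    evMat s₁ a₁ e₁ c₁ d₁ * odMat t₁ b₁ f₁ 0 * evMat s₂ a₂ e₂ c₂ d₂ * odMat t₂ b₂ f₂ 0 *
        evMat s₃ a₃ e₃ c₃ d₃ =
      upper 0 0 (s₃ * (a₁ * (e₂ * e₃) * b₁ * f₂)) 0 0 0
        (s₂ * (t₂ * (s₃ * (a₃ * (e₁ * e₂) * b₂ * f₁)))) 0 0 0 := by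
  simp only [evMat, odMat, upper_mul]
  congr 1 <;> ring

theorem three_odMat {R : Type*} [CommRing R]
    (s₁ a₁ e₁ c₁ d₁ t₁ b₁ f₁ s₂ a₂ e₂ c₂ d₂ t₂ b₂ f₂ s₃ a₃ e₃ c₃ d₃ t₃ b₃ f₃ s₄ a₄ e₄ c₄ d₄ : R) :
    evMat s₁ a₁ e₁ c₁ d₁ * odMat t₁ b₁ f₁ 0 * evMat s₂ a₂ e₂ c₂ d₂ * odMat t₂ b₂ f₂ 0 *
        evMat s₃ a₃ e₃ c₃ d₃ * odMat t₃ b₃ f₃ 0 * evMat s₄ a₄ e₄ c₄ d₄ =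
      upper 0 0 0 (s₄ * (t₃ * (s₃ * (a₁ * a₄ * (e₂ * e₃) * (b₁ * b₃) * f₂)))) 0 0 0 0 0 0 := by
  rw [two_odMat]
  simp only [evMat, odMat, upper_mul]
  congr 1 <;> ring

theorem upper_corner_mul_odMat {R : Type*} [CommRing R] (r t b f : R) :
    upper 0 0 0 r 0 0 0 0 0 0 * odMat t b f 0 = 0 := by
  rw [odMat, upper_mul, ← upper_zero]
  congr 1 <;> ring

theorem coe_perm_toList (L : List StarVar) : L.Perm (L : Multiset StarVar).toList :=
  (toList_coe_perm L).symm

theorem eq_or_eq_of_perm_pair {α : Type*} {L : List α} {a b : α} (h : L.Perm [a, b]) :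
    L = [a, b] ∨ L = [b, a] := by
  match L, h.length_eq with
  | [p, q], _ =>
    have hp : p ∈ [a, b] := h.mem_iff.mp (by simp)
    simp only [List.mem_cons, List.not_mem_nil, or_false] at hp
    rcases hp with rfl | rfl
    · have h1 := List.perm_singleton.mp ((List.perm_cons p).mp h)
      left
      rw [h1]
    · have h1 := List.perm_singleton.mp ((List.perm_cons p).mp (h.trans (List.Perm.swap p a [])))
      right
      rw [h1]

/-- A word with two odd letters has no entries other than `(1, 3)` and `(2, 4)`; the former is
nonzero only if the second odd letter is skew, and the latter only if the first one is. -/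
theorem recover_two_odd [CharZero F] {A B D : List StarVar} (hA : IsEven A) (hB : IsEven B)
    (hD : IsEven D) {a b : StarVar} (ha : a.deg = 1) (hb : b.deg = 1) :
    recover π ((A.map (genericMatrix F)).prod * genericMatrix F a * (B.map (genericMatrix F)).prod *
        genericMatrix F b * (D.map (genericMatrix F)).prod) =
      sg F D • (if b.sgn = -1 then coeff13 π A (B ++ D : List StarVar) 0 {a} {b} else 0) +
      (sg F B * ((b.sgn : ℤ) : F) * sg F D) •
        (if a.sgn = -1 then coeff24 π D (A ++ B : List StarVar) 0 {b} {a} else 0) := by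
  rw [genericMatrix_word hA, genericMatrix_word hB, genericMatrix_word hD, genericMatrix_odd ha,
    genericMatrix_odd hb, two_odMat, recover_upper]
  simp only [cast_mul_eq_smul, map_smul, map_zero, zero_add, add_zero, mul_smul, mon_mul, sg]
  rw [Multiset.coe_add, Multiset.coe_add]
  congr 2
  · split_ifs
    · rw [mon_mul, extendMon_mon]
      simp
    · rw [mul_zero, map_zero]
  · split_ifs
    · rw [mon_mul, extendMon_mon]
      simp
    · rw [mul_zero, map_zero]

theorem isEven_or_exists_odd (L : List StarVar) :
    IsEven L ∨ ∃ A a L', IsEven A ∧ a.deg = 1 ∧ L = A ++ a :: L' := by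
  induction L with
  | nil => left; simp [IsEven]
  | cons b L ih =>
    have hd : ∀ d : ZMod 2, d = 0 ∨ d = 1 := by decide
    rcases hd b.deg with hb | hb
    · rcases ih with h | ⟨A, a, L', hA, ha, rfl⟩
      · exact .inl (IsEven.cons_iff.mpr ⟨hb, h⟩)
      · exact .inr ⟨b :: A, a, L', IsEven.cons_iff.mpr ⟨hb, hA⟩, ha, rfl⟩
    · exact .inr ⟨[], b, L, by simp [IsEven], hb, rfl⟩

namespace KillsGenerators

theorem recover_odd₂ [CharZero F] (hπ : KillsGenerators π) {A B D : List StarVar} (hA : IsEven A)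
    (hB : IsEven B) (hD : IsEven D) {a b : StarVar} (ha : a.deg = 1) (hb : b.deg = 1) :
    recover π ((A.map (genericMatrix F)).prod * genericMatrix F a * (B.map (genericMatrix F)).prod *
        genericMatrix F b * (D.map (genericMatrix F)).prod) =
      word π A * word π [a] * word π B * word π [b] * word π D := by
  have hn : IsEven [] := by simp [IsEven]
  have hAB : IsEven (A ++ B) := IsEven.append_iff.mpr ⟨hA, hB⟩
  have hBD : IsEven (B ++ D) := IsEven.append_iff.mpr ⟨hB, hD⟩
  have hABD : IsEven (A ++ (B ++ D)) := IsEven.append_iff.mpr ⟨hA, hBD⟩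
  have e1 := hπ.odd_odd_congr hA hBD hn (coe_perm_toList A) (coe_perm_toList _) .nil ha hb
  have e2 := hπ.odd_odd_congr hn hABD hn .nil (coe_perm_toList _) .nil ha hb
  have e3 := hπ.odd_odd_congr hn hAB hD .nil (coe_perm_toList _) (coe_perm_toList D) ha hb
  have e4 := hπ.odd_odd_congr hAB hn hD (coe_perm_toList _) .nil (coe_perm_toList D) ha hb
  have sA := sg_mul_self (F := F) A
  have sB := sg_mul_self (F := F) B
  have sD := sg_mul_self (F := F) D
  simp only [word_nil, one_mul, mul_one] at e1 e2 e3 e4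
  have hne : ¬ (1 : ℤˣ) = -1 := by decide
  have hne' : ¬ (-1 : ℤˣ) = 1 := by decide
  rw [recover_two_odd hA hB hD ha hb]
  rcases Int.units_eq_one_or a.sgn with ha' | ha' <;>
    rcases Int.units_eq_one_or b.sgn with hb' | hb'
  · rw [if_neg (by rw [hb']; exact hne), if_neg (by rw [ha']; exact hne), smul_zero, smul_zero,
      add_zero, mul_assoc (word π A), mul_assoc (word π A)]
    have h := hπ.pos_even_pos (mono_mem hB.wordDeg) ha hb ha' hb'
    change word π [a] * word π B * word π [b] = 0 at h
    rw [h, mul_zero, zero_mul]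
  · rw [if_pos hb', if_neg (by rw [ha']; exact hne), smul_zero, add_zero]
    simp only [coeff13, Multiset.toList_zero, Multiset.toList_singleton, ha', if_true]
    have h := hπ.pos_word_neg hBD hb ha hb' ha'
    have h' := hπ.pos_word_neg hB hb ha hb' ha'
    rw [mword, mword, ← e1, mul_assoc (word π A), mul_assoc (word π A), h, mul_assoc (word π A),
      mul_assoc (word π A), h', sg_append, mul_smul_comm, smul_smul, word_append,
      show sg F D * (sg F B * sg F D) = sg F B by linear_combination sg F B * sD]
    simp only [mul_smul_comm, smul_mul_assoc, mul_assoc]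
  · rw [if_neg (by rw [hb']; exact hne), if_pos ha', smul_zero, zero_add]
    simp only [coeff24, Multiset.toList_zero, Multiset.toList_singleton, hb', if_true]
    have h := hπ.neg_word_pos hB ha hb ha' hb'
    rw [mword, mword, ← e4, mul_assoc (word π A), mul_assoc (word π A), h, smul_smul, sg_perm
      (toList_coe_perm D), word_append, Units.val_one, Int.cast_one,
      show sg F B * 1 * sg F D * sg F D = sg F B by linear_combination sg F B * sD]
    simp only [mul_smul_comm, smul_mul_assoc, mul_assoc]
  · -- both entries contribute, and the relation between three blocks of even letters applies
    rw [if_pos hb', if_pos ha']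
    simp only [coeff13, coeff24, Multiset.toList_zero, Multiset.toList_singleton, ha', hb', hne',
      if_false]
    have h := hπ.three_blocks hA hB hD ha hb ha' hb'
    have h' := congrArg (fun q => (sg F A * sg F D) • q) h
    simp only [smul_sub, smul_add, smul_zero, smul_smul] at h'
    rw [Multiset.coe_add]
    simp only [mword]
    rw [← e1, ← e2, ← e3, sg_perm (toList_coe_perm A), sg_perm (toList_coe_perm D),
      sg_perm (toList_coe_perm (A ++ B)), sg_append]
    rw [show sg F A * sg F D * (sg F A * sg F D) = 1 by
        linear_combination sg F D * sg F D * sA + sD,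
      show sg F A * sg F D * sg F D = sg F A by linear_combination sg F A * sD,
      show sg F A * sg F D * sg F A = sg F D by linear_combination sg F D * sA, one_smul] at h'
    rw [smul_sub, smul_neg, smul_smul, smul_smul]
    rw [show sg F B * (((-1 : ℤˣ) : ℤ) : F) * sg F D * (sg F A * sg F B * sg F D) = -sg F A by
        push_cast
        linear_combination (-sg F A * sg F D * sg F D) * sB - sg F A * sD]
    simp only [word_append, ← mul_assoc] at h' ⊢
    rw [neg_smul, neg_neg, mul_comm (sg F D)]
    rw [← sub_eq_zero, ← neg_eq_zero, ← h']
    abel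

/-- Words with three odd letters have a normal form: the last two odd letters are moved to the end.
-/
theorem three_odd [CharZero F] (hπ : KillsGenerators π) {A B D H : List StarVar} (hB : IsEven B)
    (hD : IsEven D) (hH : IsEven H) {a b c : StarVar} (ha : a.deg = 1) (hb : b.deg = 1)
    (hc : c.deg = 1) :
    word π A * word π [a] * word π B * word π [b] * word π D * word π [c] * word π H =
      (sg F D * sg F H) • (word π (A ++ H) * word π [a] * word π (B ++ D) * word π [b] *
        word π [c]) := by
  have hd : ∀ {x : StarVar}, x.deg = 1 → wordDeg [x] = 1 := fun hx => by simpa [wordDeg] using hx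
  have h1 := hπ.odd_odd_odd_word hH
    (mono_mem (L := [a] ++ B) ((wordDeg_append_even hB).trans (hd ha)))
    (mono_mem (L := [b] ++ D) ((wordDeg_append_even hD).trans (hd hb))) (mono_mem (hd hc))
  change word π ([a] ++ B) * word π ([b] ++ D) * word π [c] * word π H =
    sg F H • (word π H * word π ([a] ++ B) * word π ([b] ++ D) * word π [c]) at h1
  have h2 := hπ.odd_odd_word_odd hD
    (mono_mem (L := [a] ++ B) ((wordDeg_append_even hB).trans (hd ha)))
    (mono_mem (hd hb)) (mono_mem (hd hc))
  change word π ([a] ++ B) * word π [b] * word π D * word π [c] =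
    sg F D • (word π ([a] ++ B) * word π D * word π [b] * word π [c]) at h2
  have h3 : word π A * word π [a] * word π B * word π [b] * word π D * word π [c] * word π H =
      word π A * (word π ([a] ++ B) * word π ([b] ++ D) * word π [c] * word π H) := by
    simp only [word_append, mul_assoc]
  have h4 : word π H * word π ([a] ++ B) * word π ([b] ++ D) * word π [c] =
      word π H * (word π ([a] ++ B) * word π [b] * word π D * word π [c]) := by
    simp only [word_append, mul_assoc]
  rw [h3, h1, h4, h2]
  simp only [mul_smul_comm, smul_smul, mul_comm (sg F H)]
  simp only [word_append, mul_assoc]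

/-- A word with three odd letters vanishes as soon as the middle one is symmetric. -/
theorem three_odd_eq_zero [CharZero F] (hπ : KillsGenerators π) {B D : List StarVar}
    (hB : IsEven B) (hD : IsEven D) {a b c : StarVar} (ha : a.deg = 1) (hb : b.deg = 1)
    (hc : c.deg = 1) (hb' : b.sgn = 1) :
    word π [a] * word π B * word π [b] * word π D * word π [c] = 0 := by
  rcases Int.units_eq_one_or a.sgn with ha' | ha'
  · have h := hπ.pos_even_pos (mono_mem hB.wordDeg) ha hb ha' hb'
    change word π [a] * word π B * word π [b] = 0 at h
    rw [h, zero_mul, zero_mul]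
  rcases Int.units_eq_one_or c.sgn with hc' | hc'
  · have h := hπ.pos_even_pos (mono_mem hD.wordDeg) hb hc hb' hc'
    change word π [b] * word π D * word π [c] = 0 at h
    rw [mul_assoc, mul_assoc, ← mul_assoc (word π [b]), h, mul_zero]
  · exact hπ.neg_even_pos_even_neg (mono_mem hB.wordDeg) (mono_mem hD.wordDeg) ha hc hb ha' hc' hb'

/-- Up to the sign of the last letter, the two outer odd letters may be exchanged when the middle
one is skew. -/
theorem exchange_outer [CharZero F] (hπ : KillsGenerators π) {B : List StarVar} (hB : IsEven B)
    {a b c : StarVar} (ha : a.deg = 1) (hb : b.deg = 1) (hc : c.deg = 1) (hb' : b.sgn = -1) :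
    ((a.sgn : ℤ) : F) • (word π [c] * word π B * word π [b] * word π [a]) =
      ((c.sgn : ℤ) : F) • (word π [a] * word π B * word π [b] * word π [c]) := by
  have hd : wordDeg (B ++ [b]) = 1 := (wordDeg_even_append hB).trans (by simpa [wordDeg] using hb)
  rcases Int.units_eq_one_or a.sgn with ha' | ha' <;>
    rcases Int.units_eq_one_or c.sgn with hc' | hc'
  case inl.inr =>
    have h := hπ.neg_even_neg_pos (mono_mem hB.wordDeg) hc ha hb hc' ha' hb'
    change word π [c] * word π B * _ * _ = -(word π [a] * word π B * _ * _) at h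
    rw [h, ha', hc']
    simp
  case inr.inl =>
    have h := hπ.neg_even_neg_pos (mono_mem hB.wordDeg) ha hc hb ha' hc' hb'
    change word π [a] * word π B * _ * _ = -(word π [c] * word π B * _ * _) at h
    rw [h, ha', hc']
    simp
  all_goals
    have h := hπ.letter_odd_letter (mono_mem hd) hc ha (hc'.trans ha'.symm)
    change word π [c] * word π (B ++ [b]) * _ = word π [a] * word π (B ++ [b]) * _ at h
    rw [word_append, ← mul_assoc, ← mul_assoc] at h
    rw [h, ha', hc']

theorem recover_odd₃ [CharZero F] (hπ : KillsGenerators π) {A B D H : List StarVar} (hA : IsEven A)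
    (hB : IsEven B) (hD : IsEven D) (hH : IsEven H) {a b c : StarVar} (ha : a.deg = 1)
    (hb : b.deg = 1) (hc : c.deg = 1) :
    recover π ((A.map (genericMatrix F)).prod * genericMatrix F a * (B.map (genericMatrix F)).prod *
        genericMatrix F b * (D.map (genericMatrix F)).prod * genericMatrix F c *
        (H.map (genericMatrix F)).prod) =
      word π A * word π [a] * word π B * word π [b] * word π D * word π [c] * word π H := by
  rw [genericMatrix_word hA, genericMatrix_word hB, genericMatrix_word hD, genericMatrix_word hH,
    genericMatrix_odd ha, genericMatrix_odd hb, genericMatrix_odd hc, three_odMat, recover_upper]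
  rcases Int.units_eq_one_or b.sgn with hb' | hb'
  · rw [if_neg (by rw [hb']; decide), mul_zero, mul_zero, mul_zero, mul_zero]
    simp only [map_zero, add_zero, mul_assoc (word π A)]
    rw [hπ.three_odd_eq_zero hB hD ha hb hc hb', zero_mul, mul_zero]
  rw [hπ.three_odd hB hD hH ha hb hc, if_pos hb']
  simp only [cast_mul_eq_smul, map_smul, map_zero, zero_add, mon_mul, extendMon_mon, add_zero]
  rw [Multiset.coe_add, Multiset.coe_add]
  have hAH : IsEven (A ++ H) := IsEven.append_iff.mpr ⟨hA, hH⟩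
  have hBD : IsEven (B ++ D) := IsEven.append_iff.mpr ⟨hB, hD⟩
  have hn : IsEven [] := by simp [IsEven]
  have hBD' := hBD.perm (coe_perm_toList _)
  have e1 := hπ.odd_odd_congr hAH hBD hn (coe_perm_toList _) (coe_perm_toList _) .nil ha hb
  rw [word_nil, mul_one, mul_one] at e1
  have hs := sgn_mul_self (R := F) c.sgn
  have hp : ({a} + {c} : Multiset StarVar).toList = [a, c] ∨
      ({a} + {c} : Multiset StarVar).toList = [c, a] := by
    have h := toList_add_perm {a} {c}
    rw [Multiset.toList_singleton, Multiset.toList_singleton] at h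
    exact eq_or_eq_of_perm_pair h
  -- the order in which the two letters are read off the multiset does not affect the value
  have h : coeff14 π (A ++ H : List StarVar) (B ++ D : List StarVar) 0 ({a} + {c}) {b} =
      ((c.sgn : ℤ) : F) • (word π (A ++ H) * word π [a] * word π (B ++ D) * word π [b] *
        word π [c]) := by
    rw [e1]
    rcases hp with hp | hp
    · simp only [coeff14, hp, Multiset.toList_zero, Multiset.toList_singleton, mword]
    · simp only [coeff14, hp, Multiset.toList_zero, Multiset.toList_singleton, mword]
      have h := congrArg (fun q => word π ((A ++ H : List StarVar) : Multiset StarVar).toList * q)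
        (hπ.exchange_outer hBD' ha hb hc hb')
      simpa only [mul_smul_comm, ← mul_assoc] using h
  rw [h, smul_smul, smul_smul, smul_smul]
  congr 1
  change sg F H * ((c.sgn : ℤ) : F) * sg F D * ((c.sgn : ℤ) : F) = _
  linear_combination sg F H * sg F D * hs

theorem recover_odd_of_four [CharZero F] (hπ : KillsGenerators π) {A B D H : List StarVar}
    (hA : IsEven A) (hB : IsEven B) (hD : IsEven D) (hH : IsEven H) {a b c d : StarVar}
    (ha : a.deg = 1) (hb : b.deg = 1) (hc : c.deg = 1) (hd : d.deg = 1) (L : List StarVar) :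
    recover π ((A.map (genericMatrix F)).prod * genericMatrix F a * (B.map (genericMatrix F)).prod *
        genericMatrix F b * (D.map (genericMatrix F)).prod * genericMatrix F c *
        (H.map (genericMatrix F)).prod * genericMatrix F d * (L.map (genericMatrix F)).prod) =
      word π A * word π [a] * word π B * word π [b] * word π D * word π [c] * word π H *
        word π [d] * word π L := by
  rw [genericMatrix_word hA, genericMatrix_word hB, genericMatrix_word hD, genericMatrix_word hH,
    genericMatrix_odd ha, genericMatrix_odd hb, genericMatrix_odd hc, genericMatrix_odd hd,
    three_odMat, upper_corner_mul_odMat, zero_mul, map_zero]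
  have hdeg : ∀ {K : List StarVar} {e : StarVar}, IsEven K → e.deg = 1 →
      mono F (K ++ [e]) ∈ freeGrading F 1 := fun hK he =>
    mono_mem ((wordDeg_even_append hK).trans (by simpa [wordDeg] using he))
  have h := hπ.odd_odd_odd_odd (hdeg hA ha) (hdeg hB hb) (hdeg hD hc) (hdeg hH hd)
  change word π _ * word π _ * word π _ * word π _ = 0 at h
  simp only [word_append, ← mul_assoc] at h
  rw [h, zero_mul]

/-- Modulo the generators a word is determined, linearly, by its generic evaluation. -/
theorem recover_word [CharZero F] (hπ : KillsGenerators π) (L : List StarVar) :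
    recover π (L.map (genericMatrix F)).prod = word π L := by
  have hs : ∀ (A L' : List StarVar) (a : StarVar), ((A ++ a :: L').map (genericMatrix F)).prod =
      (A.map (genericMatrix F)).prod * genericMatrix F a * (L'.map (genericMatrix F)).prod := by
    intro A L' a
    rw [List.map_append, List.prod_append, List.map_cons, List.prod_cons, mul_assoc]
  have hw : ∀ (A L' : List StarVar) (a : StarVar), word π (A ++ a :: L') =
      word π A * word π [a] * word π L' := by
    intro A L' a
    rw [word_append, word_cons, mul_assoc]
  rcases isEven_or_exists_odd L with hA | ⟨A, a, L, hA, ha, rfl⟩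
  · exact hπ.recover_even hA
  rcases isEven_or_exists_odd L with hB | ⟨B, b, L, hB, hb, rfl⟩
  · rw [hs, hw, hπ.recover_odd₁ hA hB ha]
  rcases isEven_or_exists_odd L with hD | ⟨D, c, L, hD, hc, rfl⟩
  · simp only [hs, hw, ← mul_assoc]
    exact hπ.recover_odd₂ hA hB hD ha hb
  rcases isEven_or_exists_odd L with hH | ⟨H, d, L, hH, hd, rfl⟩
  · simp only [hs, hw, ← mul_assoc]
    exact hπ.recover_odd₃ hA hB hD hH ha hb hc
  · simp only [hs, hw, ← mul_assoc]
    exact hπ.recover_odd_of_four hA hB hD hH ha hb hc hd L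

/-- A homomorphism that kills the generators factors linearly through the generic evaluation. -/
theorem apply_eq_zero [CharZero F] (hπ : KillsGenerators π) {f : FreeStar F}
    (hf : f ∈ starIdentities (superSymplectic F)) : π f = 0 := by
  have h : recover π ∘ₗ (FreeAlgebra.lift F (genericMatrix F)).toLinearMap = π.toLinearMap := by
    refine linearMap_ext_mono fun L => ?_
    change recover π (FreeAlgebra.lift F (genericMatrix F) (mono F L)) = word π L
    rw [lift_mono, hπ.recover_word]
  have h' := LinearMap.congr_fun h f
  change recover π (FreeAlgebra.lift F (genericMatrix F) f) = π f at h'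
  rw [← h', lift_genericMatrix_eq_zero hf, map_zero]

end KillsGenerators

/-- Completeness, applied to the quotient by the ideal generated by the generators. -/
theorem starIdentities_le_span [CharZero F] {f : FreeStar F}
    (hf : f ∈ starIdentities (superSymplectic F)) :
    f ∈ t2StarIdealSpan {f | IsGenerator F f} := by
  let J : TwoSidedIdeal (FreeStar F) := t2StarIdealSpan {f | IsGenerator F f}
  let π : FreeStar F →ₐ[F] J.ringCon.Quotient := J.ringCon.mkₐ F
  have hJ : ∀ g, π g = 0 ↔ g ∈ J := by
    intro g
    rw [TwoSidedIdeal.mem_iff]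
    exact RingCon.eq J.ringCon
  have hπ : KillsGenerators π := fun g hg v hv =>
    (hJ _).mpr ((isT2StarIdeal_span _).lift_mem hv (subset_t2StarIdealSpan hg))
  exact (hJ f).mp (hπ.apply_eq_zero hf)

end Recover

end StarPI

theorem mainTheorem1 (F : Type*) [Field F] [CharZero F] :
    StarPI.starIdentities (StarPI.superSymplectic F) =
      (StarPI.t2StarIdealSpan {f | StarPI.IsGenerator F f} : Set (StarPI.FreeStar F)) :=
  Set.Subset.antisymm (fun _ hf => StarPI.starIdentities_le_span hf)
    fun _ hf => StarPI.span_le_starIdentities hf
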